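/- **Setting.** Let $m,n,r\ge 0$ be integers with $m,n$ not both zero, $\mathcal Z=\mathbb Z[v,v^{-1}]$ with bar involution $\bar v=v^{-1}$, and $q=v^2$. Let $\mathcal H$ be the Hecke algebra of $\mathfrak S_r$ over $\mathcal Z$, with basis $T_w$ and relations $T_s^2=(q-1)T_s+q$ for simple transpositions $s$, and $T_yT_w=T_{yw}$ if $l(yw)=l(y)+l(w)$. Its bar involution is $\overline{\sum a_wT_w}=\sum \bar a_w T_{w^{-1}}^{-1}$. Let $\Lambda(m|n,r)$ be the set of compositions $\lambda|\mu=(\lambda_1,\dots,\lambda_m,\mu_1,\dots,\mu_n)$ of $r$ and $M(m|n,r)$ the set of $(m+n)\times(m+n)$ matrices over $\mathbb N$ with entry sum $r$ whose entries in the two off-diagonal blocks (one index $\le m$, the other $>m$) are $0$ or $1$. The Young subgroup $\mathfrak S_{\lambda|\mu}$ of $\lambda|\mu$ is $\mathfrak S_{\lambda^*}\times\mathfrak S_{{}^*\mu}$, where $\mathfrak S_{\lambda^*}$ (resp. $\mathfrak S_{{}^*\mu}$) permutes only points in the first $m$ (resp. last $n$) consecutive blocks. Put $$x_\lambda=\sum_{w\in\mathfrak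 S_{\lambda^*}}T_w,\qquad y_\mu=\sum_{w\in\mathfrak S_{{}^*\mu}}(-q)^{-l(w)}T_w,\qquad \mathcal T_{\lambda|\mu}=v^{-l(w_{0,\lambda})+l(w_{0,\mu})}x_\lambda y_\mu,$$ where $w_{0,\lambda},w_{0,\mu}$ are the longest elements of $\mathfrak S_{\lambda^*},\mathfrak S_{{}^*\mu}$. The quantum Schur superalgebra is $\mathcal S(m|n,r)=\mathrm{End}_{\mathcal H}\big(\bigoplus_{\lambda|\mu\in\Lambda(m|n,r)} x_\lambda y_\mu\mathcal H\big)$, where $\mathrm{Hom}_{\mathcal H}(x_\xi y_\eta\mathcal H,x_\lambda y_\mu\mathcal H)$ has degree $|\mu|+|\eta|$ in $\mathbb Z/2$, with the multiplication $fg=(-1)^{ij}f\circ g$ for $f,g$ homogeneous of degrees $i,j$. Let $D=(a_{ij})\in M(m|n,r)$ have row sums $\mathrm{ro}(D)=\lambda|\mu$ and column sums $\mathrm{co}(D)=\xi|\eta$, and identify $D$ with the double coset in $\mathfrak S_{\lambda|\mu}\backslash\mathfrak S_r/\mathfrak S_{\xi|\eta}$ of all $w$ with $|R_i\cap wR'_j|=a_{ij}$,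 where $R_i,R'_j$ are the consecutive blocks of $\lambda|\mu$ and $\xi|\eta$. Let $d$ and $w_D^+$ be its shortest and longest elements, $d^*$ and ${}^*d$ the longest elements of $\mathfrak S_{\lambda^*}d\,\mathfrak S_{\xi^*}$ and $\mathfrak S_{{}^*\mu}d\,\mathfrak S_{{}^*\eta}$, and put $$T_D=\sum_{u,v}(-q)^{-l(v)}x_\lambda y_\mu T_dT_uT_v,\qquad \mathcal T_D=v^{-l(d^*)+l({}^*d)-l(d)}\,T_D,$$ where the sum is over $u\in\mathfrak S_{\xi^*}$, $v\in\mathfrak S_{{}^*\eta}$ such that $uv$ is a shortest right coset representative of $d^{-1}\mathfrak S_{\lambda|\mu}d\cap\mathfrak S_{\xi|\eta}$. Write $C\le D$ if $\mathrm{ro}(C)=\mathrm{ro}(D)$, $\mathrm{co}(C)=\mathrm{co}(D)$ and $w_C^+\le w_D^+$ in the Bruhat order. **Theorem.** There are unique elements $\varphi_D\in\mathcal S(m|n,r)$, $D\in M(m|n,r)$, with $\varphi_D(\mathcal T_{\alpha|\beta}\,h)=\delta_{\alpha|\beta,\mathrm{co}(D)}\,\mathcal T_D h\in x_\lambda y_\mu\mathcal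 H$ (where $\lambda|\mu=\mathrm{ro}(D)$) for all $\alpha|\beta\in\Lambda(m|n,r)$, $h\in\mathcal H$; they form a $\mathcal Z$-basis of $\mathcal S(m|n,r)$. There are unique scalars $r_{C,D}\in\mathcal Z$, with $r_{C,D}=0$ unless $C\le D$, such that $\overline{\mathcal T_D}=\sum_{C\le D}r_{C,D}\mathcal T_C$ for all $D$; moreover $r_{D,D}=1$. The bar involution of $\mathcal Z$ extends to a unique ring homomorphism $\bar{\ }:\mathcal S(m|n,r)\to\mathcal S(m|n,r)$ with $$\bar\varphi_D=\sum_C r_{C,D}\,\varphi_C\qquad\text{for all }D,$$ and it is an involution. There is a unique family $\{\Theta_D\}_{D\in M(m|n,r)}$ in $\mathcal S(m|n,r)$ with $$\bar\Theta_D=\Theta_D,\qquad \Theta_D-\varphi_D\in\sum_{C<D}v^{-1}\mathbb Z[v^{-1}]\,\varphi_C\qquad\text{for all }D,$$ and it is a $\mathcal Z$-basis of $\mathcal S(m|n,r)$. -/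

import Mathlib

open scoped BigOperators Pointwise

noncomputable section

namespace QSuper

open Equiv (Perm)

/-! ### The ground ring `ℤ[v, v⁻¹]` -/

/-- The ring `ℤ[v, v⁻¹]`; its bar involution `v ↦ v⁻¹` is `LaurentPolynomial.invert`. -/
abbrev Zv : Type := LaurentPolynomial ℤ

/-- The power `v ^ k`, for `k` an integer. -/
abbrev vpow (k : ℤ) : Zv := LaurentPolynomial.T k

/-- `q = v ^ 2`. -/
abbrev qq : Zv := vpow 2

/-- The set `v⁻¹ ℤ[v⁻¹]`. -/
def vInvPoly : Set Zv :=
  {p | ∃ f : Polynomial ℤ, p = vpow (-1) * Polynomial.aeval (vpow (-1)) f}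

/-! ### The symmetric group -/

section Symm

variable {r : ℕ}

/-- The point `i`, for the `i`-th simple transposition. -/
def lo (i : Fin (r - 1)) : Fin r := ⟨i, by omega⟩

/-- The point `i + 1`, for the `i`-th simple transposition. -/
def hi (i : Fin (r - 1)) : Fin r := ⟨i + 1, by omega⟩

/-- The simple transposition `(i, i+1)`. -/
def simple (i : Fin (r - 1)) : Perm (Fin r) := Equiv.swap (lo i) (hi i)

/-- The Coxeter length of a permutation, as its number of inversions. -/
def len (w : Perm (Fin r)) : ℕ :=
  (Finset.univ.filter fun p : Fin r × Fin r => p.1 < p.2 ∧ w p.2 < w p.1).card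

/-- The Chevalley-Bruhat order: the reflexive transitive closure of `u < u t` for a transposition
`t` that increases the length. -/
def bruhatLE (u w : Perm (Fin r)) : Prop :=
  Relation.ReflTransGen
    (fun x y : Perm (Fin r) => ∃ a b : Fin r, y = x * Equiv.swap a b ∧ len x < len y) u w

theorem lo_lt_hi (i : Fin (r - 1)) : lo i < hi i := by
  simp [lo, hi, Fin.lt_def]

theorem simple_mul_self (i : Fin (r - 1)) : simple i * simple i = 1 :=
  Equiv.swap_mul_self _ _

theorem simple_inv (i : Fin (r - 1)) : (simple i)⁻¹ = simple i :=
  Equiv.swap_inv _ _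

theorem simple_lt_iff (i : Fin (r - 1)) {x y : Fin r} (h1 : ¬ (x = lo i ∧ y = hi i))
    (h2 : ¬ (x = hi i ∧ y = lo i)) : simple i x < simple i y ↔ x < y := by
  simp only [simple, Equiv.swap_apply_def, lo, hi, Fin.ext_iff, Fin.lt_def] at *
  split_ifs <;> simp_all <;> omega

/-- `w` has a left ascent at `i`, that is, `s_i w > w`. -/
def LeftAsc (i : Fin (r - 1)) (w : Perm (Fin r)) : Prop := w⁻¹ (lo i) < w⁻¹ (hi i)

/-- `w` has a right ascent at `i`, that is, `w s_i > w`. -/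
def RightAsc (i : Fin (r - 1)) (w : Perm (Fin r)) : Prop := w (lo i) < w (hi i)

theorem not_leftAsc (i : Fin (r - 1)) (w : Perm (Fin r)) :
    ¬ LeftAsc i w ↔ w⁻¹ (hi i) < w⁻¹ (lo i) := by
  rw [LeftAsc, not_lt, le_iff_lt_or_eq]
  refine or_iff_left fun h => (lo_lt_hi i).ne' (w⁻¹.injective h)

theorem leftAsc_simple_mul (i : Fin (r - 1)) (w : Perm (Fin r)) :
    LeftAsc i (simple i * w) ↔ ¬ LeftAsc i w := by
  rw [not_leftAsc, LeftAsc, mul_inv_rev, simple_inv]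
  simp [simple]

theorem len_simple_mul (i : Fin (r - 1)) (w : Perm (Fin r)) (h : LeftAsc i w) :
    len (simple i * w) = len w + 1 := by
  have hnot : (w⁻¹ (lo i), w⁻¹ (hi i)) ∉
      (Finset.univ.filter fun p : Fin r × Fin r => p.1 < p.2 ∧ w p.2 < w p.1) := by
    simp [(lo_lt_hi i).le]
  rw [len, len, ← Finset.card_insert_of_notMem hnot]
  congr 1
  ext ⟨a, b⟩
  rw [Finset.mem_insert, Finset.mem_filter, Finset.mem_filter]
  simp only [Finset.mem_univ, true_and, Prod.mk.injEq, Perm.mul_apply]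
  by_cases h1 : w a = lo i ∧ w b = hi i
  · obtain ⟨ha, hb⟩ := h1
    have ha' : a = w⁻¹ (lo i) := by rw [← ha]; simp
    have hb' : b = w⁻¹ (hi i) := by rw [← hb]; simp
    rw [ha, hb]
    simp only [simple, Equiv.swap_apply_left, Equiv.swap_apply_right, lo_lt_hi, and_true]
    constructor
    · intro _
      exact Or.inl ⟨ha', hb'⟩
    · intro _
      rw [ha', hb']
      exact h
  · by_cases h2 : w a = hi i ∧ w b = lo i
    · obtain ⟨ha, hb⟩ := h2
      have ha' : a = w⁻¹ (hi i) := by rw [← ha]; simp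
      have hb' : b = w⁻¹ (lo i) := by rw [← hb]; simp
      have hab : ¬ a < b := by
        rw [ha', hb']
        exact not_lt.2 (le_of_lt h)
      have hne : ¬ (a = w⁻¹ (lo i) ∧ b = w⁻¹ (hi i)) := by
        rintro ⟨rfl, rfl⟩
        simp at ha
        exact (lo_lt_hi i).ne ha
      simp only [hab, hne, false_and, or_false]
    · have hne : ¬ (a = w⁻¹ (lo i) ∧ b = w⁻¹ (hi i)) := by
        rintro ⟨rfl, rfl⟩
        simp at h1
      rw [simple_lt_iff i (x := w b) (y := w a) (fun hh => h2 ⟨hh.2, hh.1⟩)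
        (fun hh => h1 ⟨hh.2, hh.1⟩)]
      simp only [hne, false_or]

theorem len_simple_mul_lt (i : Fin (r - 1)) (w : Perm (Fin r)) (h : ¬ LeftAsc i w) :
    len (simple i * w) < len w := by
  have h1 := len_simple_mul i (simple i * w) ((leftAsc_simple_mul i w).2 h)
  rw [← mul_assoc, simple_mul_self, one_mul] at h1
  omega

theorem eq_one_of_leftAsc (w : Perm (Fin r)) (h : ∀ i, LeftAsc i w) : w = 1 := by
  cases r with
  | zero => exact Subsingleton.elim _ _
  | succ k =>
    have hm : StrictMono (w⁻¹ : Perm (Fin (k + 1))) := by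
      rw [Fin.strictMono_iff_lt_succ]
      intro i
      exact h i
    have : (hm.orderIsoOfSurjective _ (w⁻¹).surjective) = OrderIso.refl _ :=
      Subsingleton.elim _ _
    have h2 : w⁻¹ = 1 := by
      ext x
      have := congrArg (fun f : Fin (k + 1) ≃o Fin (k + 1) => f x) this
      simpa using congrArg Fin.val this
    exact inv_eq_one.1 h2

end Symm

/-! ### The Hecke algebra of the symmetric group -/

/-- The Hecke algebra of `𝔖_r` over `ℤ[v, v⁻¹]`: the free module with basis `T_w`, with the
multiplication constructed below. -/
def Hecke (r : ℕ) : Type := Perm (Fin r) →₀ Zv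

namespace Hecke

variable {r : ℕ}

instance : AddCommGroup (Hecke r) := inferInstanceAs (AddCommGroup (Perm (Fin r) →₀ Zv))

instance : Module Zv (Hecke r) := inferInstanceAs (Module Zv (Perm (Fin r) →₀ Zv))

/-- The basis `T_w`. -/
def basis (r : ℕ) : Module.Basis (Perm (Fin r)) Zv (Hecke r) := Finsupp.basisSingleOne

/-- The basis element `T_w`. -/
def T (w : Perm (Fin r)) : Hecke r := basis r w

open Classical in
/-- Left multiplication by `T_{s_i}`. -/
def opL (i : Fin (r - 1)) : Module.End Zv (Hecke r) :=
  (basis r).constr Zv fun w =>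
    if LeftAsc i w then T (simple i * w) else (qq - 1) • T w + qq • T (simple i * w)

open Classical in
/-- Right multiplication by `T_{s_i}`. -/
def opR (i : Fin (r - 1)) : Module.End Zv (Hecke r) :=
  (basis r).constr Zv fun w =>
    if RightAsc i w then T (w * simple i) else (qq - 1) • T w + qq • T (w * simple i)

open Classical in
/-- Left multiplication by `T_w`: a composition of the operators `opL` along a reduced
expression of `w`. -/
def opT (w : Perm (Fin r)) : Module.End Zv (Hecke r) :=
  if h : ∃ i, ¬ LeftAsc i w then opL h.choose * opT (simple h.choose * w) else 1
termination_by len w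
decreasing_by exact len_simple_mul_lt _ _ h.choose_spec

/-- Left multiplication by an element of the Hecke algebra. -/
def opMul : Hecke r →ₗ[Zv] Module.End Zv (Hecke r) := (basis r).constr Zv opT

instance : Mul (Hecke r) := ⟨fun a b => opMul a b⟩

instance : One (Hecke r) := ⟨T 1⟩

theorem mul_def (a b : Hecke r) : a * b = opMul a b := rfl

theorem one_def : (1 : Hecke r) = T 1 := rfl

open Classical in
theorem opL_T (i : Fin (r - 1)) (w : Perm (Fin r)) : opL i (T w) =
    if LeftAsc i w then T (simple i * w) else (qq - 1) • T w + qq • T (simple i * w) := by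
  exact (basis r).constr_basis Zv _ w

open Classical in
theorem opR_T (i : Fin (r - 1)) (w : Perm (Fin r)) : opR i (T w) =
    if RightAsc i w then T (w * simple i) else (qq - 1) • T w + qq • T (w * simple i) := by
  exact (basis r).constr_basis Zv _ w

theorem opMul_T (w : Perm (Fin r)) : opMul (T w) = opT w := by
  exact (basis r).constr_basis Zv _ w

theorem ext_T {f g : Module.End Zv (Hecke r)} (h : ∀ w, f (T w) = g (T w)) : f = g :=
  (basis r).ext h

theorem commute_opL_opR (i j : Fin (r - 1)) : Commute (opL (r := r) i) (opR j) := by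
  classical
  refine ext_T fun w => ?_
  simp only [Module.End.mul_apply]
  by_cases h1 : w (lo j) = lo i ∧ w (hi j) = hi i
  · have hs : simple i * w = w * simple j := by
      rw [simple, simple, ← h1.1, ← h1.2, Equiv.mul_swap_eq_swap_mul]
    have ha : LeftAsc i w := by
      rw [LeftAsc, ← h1.1, ← h1.2]
      simpa using lo_lt_hi j
    have hb : RightAsc j w := by
      rw [RightAsc, h1.1, h1.2]
      exact lo_lt_hi i
    have ha' : ¬ LeftAsc i (w * simple j) := by
      rw [← hs, leftAsc_simple_mul]
      exact not_not.2 ha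
    have hb' : ¬ RightAsc j (w * simple j) := by
      simp only [RightAsc, Perm.mul_apply, simple, Equiv.swap_apply_left, Equiv.swap_apply_right]
      exact not_lt.2 (le_of_lt hb)
    rw [opR_T, opL_T, if_pos ha, if_pos hb, hs, opL_T, opR_T, if_neg ha', if_neg hb', ← hs,
      ← mul_assoc, simple_mul_self, one_mul, hs, mul_assoc, simple_mul_self, mul_one]
  · by_cases h2 : w (lo j) = hi i ∧ w (hi j) = lo i
    · have hs : simple i * w = w * simple j := by
        rw [simple, simple, ← h2.1, ← h2.2, Equiv.mul_swap_eq_swap_mul, Equiv.swap_comm]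
      have ha : ¬ LeftAsc i w := by
        rw [not_leftAsc, ← h2.1, ← h2.2]
        simpa using lo_lt_hi j
      have hb : ¬ RightAsc j w := by
        rw [RightAsc, h2.1, h2.2]
        exact not_lt.2 (lo_lt_hi i).le
      have key : opL i (T w) = opR j (T w) := by
        rw [opL_T, opR_T, if_neg ha, if_neg hb, hs]
      have ha' : LeftAsc i (w * simple j) := by
        rw [← hs, leftAsc_simple_mul]
        exact ha
      have hb' : RightAsc j (w * simple j) := by
        simp only [RightAsc, Perm.mul_apply, simple, Equiv.swap_apply_left,
          Equiv.swap_apply_right]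
        rw [h2.1, h2.2]
        exact lo_lt_hi i
      rw [opR_T, opL_T, if_neg ha, if_neg hb, hs]
      simp only [map_add, map_smul]
      rw [key, opL_T, opR_T, if_pos ha', opR_T, if_pos hb', ← hs,
        ← mul_assoc, simple_mul_self, one_mul, hs, mul_assoc, simple_mul_self, mul_one]
    · have ha : LeftAsc i (w * simple j) ↔ LeftAsc i w := by
        simp only [LeftAsc, mul_inv_rev, simple_inv, Perm.mul_apply]
        apply simple_lt_iff
        · rintro ⟨e1, e2⟩
          rw [← e1, ← e2] at h1
          simp at h1
        · rintro ⟨e1, e2⟩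
          rw [← e1, ← e2] at h2
          simp at h2
      have hb : RightAsc j (simple i * w) ↔ RightAsc j w := by
        simp only [RightAsc, Perm.mul_apply]
        exact simple_lt_iff i h1 h2
      by_cases pa : LeftAsc i w <;> by_cases pb : RightAsc j w <;>
        simp only [opL_T, opR_T, pa, pb, ha, hb, if_true, if_false, map_add, map_smul, mul_assoc]
      module

/-- The algebra of left multiplication operators. -/
def ops (r : ℕ) : Subalgebra Zv (Module.End Zv (Hecke r)) := Algebra.adjoin Zv (Set.range opL)

theorem opL_mem (i : Fin (r - 1)) : opL i ∈ ops r := Algebra.subset_adjoin ⟨i, rfl⟩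

theorem opT_mem (w : Perm (Fin r)) : opT w ∈ ops r := by
  classical
  induction hn : len w using Nat.strong_induction_on generalizing w with
  | _ n ih =>
    rw [opT]
    split_ifs with h
    · exact mul_mem (opL_mem _) (ih _ (hn ▸ len_simple_mul_lt _ _ h.choose_spec) _ rfl)
    · exact one_mem _

theorem opT_one (w : Perm (Fin r)) : opT w (T 1) = T w := by
  classical
  induction hn : len w using Nat.strong_induction_on generalizing w with
  | _ n ih =>
    rw [opT]
    split_ifs with h
    · rw [Module.End.mul_apply, ih _ (hn ▸ len_simple_mul_lt _ _ h.choose_spec) _ rfl, opL_T,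
        if_pos ((leftAsc_simple_mul _ _).2 h.choose_spec), ← mul_assoc, simple_mul_self, one_mul]
    · push Not at h
      rw [eq_one_of_leftAsc w h]
      rfl

theorem commute_ops {P : Module.End Zv (Hecke r)} (hP : P ∈ ops r) (j : Fin (r - 1)) :
    Commute P (opR j) := by
  induction hP using Algebra.adjoin_induction with
  | mem x hx =>
    obtain ⟨i, rfl⟩ := hx
    exact commute_opL_opR i j
  | algebraMap c => exact Algebra.commutes c _
  | add x y _ _ hx hy => exact hx.add_left hy
  | mul x y _ _ hx hy => exact hx.mul_left hy

theorem ops_ext {P Q : Module.End Zv (Hecke r)} (hP : P ∈ ops r) (hQ : Q ∈ ops r)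
    (h : P (T 1) = Q (T 1)) : P = Q := by
  classical
  refine ext_T fun w => ?_
  suffices H : ∀ w : Perm (Fin r), P (T w⁻¹) = Q (T w⁻¹) by simpa using H w⁻¹
  intro w
  induction hn : len w using Nat.strong_induction_on generalizing w with
  | _ n ih =>
    by_cases hw : ∃ i, ¬ LeftAsc i w
    · obtain ⟨i, hi⟩ := hw
      have e := ih _ (hn ▸ len_simple_mul_lt i w hi) (simple i * w) rfl
      have hR : opR i (T (simple i * w)⁻¹) = T w⁻¹ := by
        rw [opR_T, if_pos, mul_inv_rev, simple_inv, mul_assoc, simple_mul_self, mul_one]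
        exact (leftAsc_simple_mul i w).2 hi
      rw [← hR, ← Module.End.mul_apply, ← Module.End.mul_apply, (commute_ops hP i).eq,
        (commute_ops hQ i).eq, Module.End.mul_apply, Module.End.mul_apply, e]
    · push Not at hw
      rw [eq_one_of_leftAsc w hw, inv_one, h]

theorem opMul_mem (a : Hecke r) : opMul a ∈ ops r := by
  rw [opMul, Module.Basis.constr_apply]
  exact sum_mem fun w _ => (ops r).smul_mem (opT_mem w) _

theorem opMul_one (a : Hecke r) : opMul a (T 1) = a := by
  have : (LinearMap.applyₗ (T 1)).comp (opMul (r := r)) = (1 : Module.End Zv (Hecke r)) :=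
    ext_T fun w => by
      simp only [LinearMap.comp_apply, LinearMap.applyₗ_apply_apply, opMul_T, opT_one,
        Module.End.one_apply]
  exact LinearMap.congr_fun this a

instance : Ring (Hecke r) :=
  { (inferInstance : AddCommGroup (Hecke r)) with
    mul := (· * ·)
    one := 1
    left_distrib := fun a b c => by simp only [mul_def, map_add]
    right_distrib := fun a b c => by simp only [mul_def, map_add, LinearMap.add_apply]
    zero_mul := fun a => by simp only [mul_def, map_zero, LinearMap.zero_apply]
    mul_zero := fun a => by simp only [mul_def, map_zero]
    mul_assoc := fun a b c => by
      have : opMul (opMul a b) = opMul a * opMul b := by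
        refine ops_ext (opMul_mem _) (mul_mem (opMul_mem _) (opMul_mem _)) ?_
        rw [opMul_one, Module.End.mul_apply, opMul_one]
      simp only [mul_def, this, Module.End.mul_apply]
    one_mul := fun a => by
      have : opMul (T 1) = (1 : Module.End Zv (Hecke r)) :=
        ops_ext (opMul_mem _) (one_mem _) (by rw [opMul_one, Module.End.one_apply])
      rw [mul_def, one_def, this, Module.End.one_apply]
    mul_one := fun a => by rw [mul_def, one_def, opMul_one] }

instance : Algebra Zv (Hecke r) :=
  Algebra.ofModule (fun c a b => by simp only [mul_def, map_smul, LinearMap.smul_apply])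
    (fun c a b => by simp only [mul_def, map_smul])

theorem opMul_T_simple (i : Fin (r - 1)) : opMul (T (simple i)) = opL i := by
  classical
  refine ops_ext (opMul_mem _) (opL_mem i) ?_
  rw [opMul_one, opL_T, if_pos, mul_one]
  simpa [LeftAsc] using lo_lt_hi i

open Classical in
theorem T_simple_mul (i : Fin (r - 1)) (w : Perm (Fin r)) : T (simple i) * T w =
    if LeftAsc i w then T (simple i * w) else (qq - 1) • T w + qq • T (simple i * w) := by
  rw [mul_def, opMul_T_simple, opL_T]

/-- The quadratic relation of the Hecke algebra. -/
theorem T_simple_sq (i : Fin (r - 1)) :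
    T (simple i) * T (simple i) = (qq - 1) • T (simple i) + qq • (1 : Hecke r) := by
  classical
  rw [T_simple_mul, if_neg, simple_mul_self, one_def]
  have h := leftAsc_simple_mul i (1 : Perm (Fin r))
  rw [mul_one] at h
  rw [h, not_not]
  simpa [LeftAsc] using lo_lt_hi i

theorem len_mul_le (y w : Perm (Fin r)) : len (y * w) ≤ len y + len w := by
  induction hn : len y using Nat.strong_induction_on generalizing y with
  | _ n ih =>
    by_cases hy : ∃ i, ¬ LeftAsc i y
    · obtain ⟨i, hi⟩ := hy
      have h1 := len_simple_mul_lt i y hi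
      have h2 := ih _ (hn ▸ h1) (simple i * y) rfl
      have h3 : len (y * w) ≤ len (simple i * y * w) + 1 := by
        rw [mul_assoc]
        by_cases ha : LeftAsc i (simple i * (y * w))
        · have := len_simple_mul i _ ha
          rw [← mul_assoc (simple i) (simple i), simple_mul_self, one_mul] at this
          omega
        · have := len_simple_mul_lt i _ ha
          rw [← mul_assoc (simple i) (simple i), simple_mul_self, one_mul] at this
          omega
      omega
    · push Not at hy
      rw [eq_one_of_leftAsc y hy, one_mul]
      omega

/-- The relation `T_y T_w = T_{yw}` if the lengths add up. -/
theorem T_mul_T (y w : Perm (Fin r)) (h : len (y * w) = len y + len w) :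
    T y * T w = T (y * w) := by
  classical
  induction hn : len y using Nat.strong_induction_on generalizing y with
  | _ n ih =>
    by_cases hy : ∃ i, ¬ LeftAsc i y
    · obtain ⟨i, hi⟩ := hy
      have h1 := len_simple_mul_lt i y hi
      have hasc := (leftAsc_simple_mul i y).2 hi
      have h1' := len_simple_mul i _ hasc
      have hback : simple i * (simple i * y) = y := by
        rw [← mul_assoc, simple_mul_self, one_mul]
      rw [hback] at h1'
      have hyw : simple i * (simple i * y * w) = y * w := by
        rw [← mul_assoc, hback]
      have h2 := len_mul_le (simple i * y) w
      have hasc2 : LeftAsc i (simple i * y * w) := by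
        by_contra hc
        have := len_simple_mul_lt i _ hc
        rw [hyw] at this
        omega
      have h3 := len_simple_mul i _ hasc2
      rw [hyw] at h3
      have e := ih _ (hn ▸ h1) (simple i * y) (by omega) rfl
      have hTy : T y = T (simple i) * T (simple i * y) := by
        rw [T_simple_mul, if_pos hasc, hback]
      rw [hTy, mul_assoc, e, T_simple_mul, if_pos hasc2, hyw]
    · push Not at hy
      rw [eq_one_of_leftAsc y hy, one_mul, ← one_def, one_mul]

theorem isUnit_T_simple (i : Fin (r - 1)) : IsUnit (T (simple i)) := by
  have hq : vpow (-2) * qq = 1 := by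
    rw [vpow, qq, vpow, ← LaurentPolynomial.T_add]
    simp
  have hq' : vpow (-2) * (qq - 1) + (vpow (-2) - 1) = 0 := by
    rw [mul_sub, hq]
    ring
  have hc : Commute (T (simple i))
      (vpow (-2) • T (simple i) + (vpow (-2) - 1) • (1 : Hecke r)) :=
    ((Commute.refl _).smul_right _).add_right ((Commute.one_right _).smul_right _)
  have h : T (simple i) * (vpow (-2) • T (simple i) + (vpow (-2) - 1) • (1 : Hecke r)) = 1 := by
    rw [mul_add, mul_smul_comm, mul_smul_comm, mul_one, T_simple_sq, smul_add, smul_smul,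
      smul_smul, hq, one_smul, add_right_comm, ← add_smul, hq', zero_smul, zero_add]
  exact ⟨⟨_, _, h, hc.eq ▸ h⟩, rfl⟩

/-- Every `T_w` is invertible. -/
theorem isUnit_T (w : Perm (Fin r)) : IsUnit (T w) := by
  classical
  induction hn : len w using Nat.strong_induction_on generalizing w with
  | _ n ih =>
    by_cases hw : ∃ i, ¬ LeftAsc i w
    · obtain ⟨i, hi⟩ := hw
      have hTy : T w = T (simple i) * T (simple i * w) := by
        rw [T_simple_mul, if_pos ((leftAsc_simple_mul i w).2 hi), ← mul_assoc, simple_mul_self,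
          one_mul]
      rw [hTy]
      exact (isUnit_T_simple i).mul (ih _ (hn ▸ len_simple_mul_lt i w hi) _ rfl)
    · push Not at hw
      rw [eq_one_of_leftAsc w hw, ← one_def]
      exact isUnit_one

/-- The bar involution of the Hecke algebra: `∑ a_w T_w ↦ ∑ ā_w (T_{w⁻¹})⁻¹`. -/
def bar (h : Hecke r) : Hecke r :=
  ∑ w, LaurentPolynomial.invert ((basis r).repr h w) • Ring.inverse (T w⁻¹)

end Hecke

/-! ### Endomorphism superalgebras -/

section SuperEnd

variable {ι : Type} [Fintype ι] [DecidableEq ι] {p : ι → ZMod 2} {A : Type} [Ring A]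
  {M : ι → Type} [∀ i, AddCommGroup (M i)] [∀ i, Module A (M i)]

/-- The endomorphism superalgebra of the `A`-module `⊕ M_i`, the sum being over a finite set,
with `M_i` in degree `p i`. It carries the supermultiplication below, not the composition. -/
def SuperEnd {ι : Type} (_p : ι → ZMod 2) (A : Type) [Ring A] (M : ι → Type)
    [∀ i, AddCommGroup (M i)] [∀ i, Module A (M i)] : Type := Module.End A (∀ i, M i)

namespace SuperEnd

set_option linter.unusedSectionVars false

instance : AddCommGroup (SuperEnd p A M) :=
  inferInstanceAs (AddCommGroup (Module.End A (∀ i, M i)))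

/-- The underlying endomorphism. -/
def toEnd : SuperEnd p A M ≃+ Module.End A (∀ i, M i) := AddEquiv.refl _

/-- The component of an endomorphism in `Hom(M_k, M_l)`. -/
def entry (l k : ι) : Module.End A (∀ i, M i) →+ (M k →ₗ[A] M l) where
  toFun f := LinearMap.proj l ∘ₗ f ∘ₗ LinearMap.single _ _ k
  map_zero' := rfl
  map_add' _ _ := rfl

theorem entry_apply (l k : ι) (f : Module.End A (∀ i, M i)) (x : M k) :
    entry l k f x = f (Pi.single k x) l := rfl

/-- The homogeneous component of degree `i` for the `ℤ/2`-grading, in which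
`Hom(M_k, M_l)` has the degree `p l + p k`. -/
def homPart (p : ι → ZMod 2) (i : ZMod 2) (f : Module.End A (∀ i, M i)) :
    Module.End A (∀ i, M i) :=
  ∑ l : ι, ∑ k : ι,
    if p l + p k = i then LinearMap.single _ _ l ∘ₗ entry l k f ∘ₗ LinearMap.proj k
    else 0

/-- The sign `(-1)^a`, for `a ∈ ℤ/2`. -/
def sgn (a : ZMod 2) : ℤ := (-1) ^ a.val

/-- The supermultiplication: `f g = (-1)^{ij} f ∘ g` for `f`, `g` homogeneous of degrees `i`,
`j`, extended bilinearly. -/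
instance : Mul (SuperEnd p A M) :=
  ⟨fun f g => toEnd.symm (∑ i : ZMod 2, ∑ j : ZMod 2,
    sgn (i * j) • (homPart p i (toEnd f) ∘ₗ homPart p j (toEnd g)))⟩

instance : One (SuperEnd p A M) := ⟨toEnd.symm LinearMap.id⟩

theorem ext_entry {f g : Module.End A (∀ i, M i)}
    (h : ∀ l k, entry l k f = entry l k g) : f = g := by
  refine LinearMap.pi_ext fun k x => ?_
  funext l
  exact LinearMap.congr_fun (h l k) x

theorem entry_comp (l k : ι) (f g : Module.End A (∀ i, M i)) :
    entry l k (f ∘ₗ g) = ∑ j, entry l j f ∘ₗ entry j k g := by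
  ext1 x
  have h : g (Pi.single k x) = ∑ j, Pi.single j (g (Pi.single k x) j) :=
    (Finset.univ_sum_single _).symm
  change f (g (Pi.single k x)) l = _
  rw [h, map_sum, Finset.sum_apply, LinearMap.sum_apply]
  rfl

theorem entry_homPart (p : ι → ZMod 2) (l k : ι) (i : ZMod 2)
    (f : Module.End A (∀ i, M i)) :
    entry l k (homPart p i f) = if p l + p k = i then entry l k f else 0 := by
  classical
  rw [homPart, map_sum, Finset.sum_eq_single l, map_sum, Finset.sum_eq_single k]
  · split_ifs
    · ext1 x
      simp [entry_apply]
    · rw [map_zero]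
  · intro b _ hb
    split_ifs
    · ext1 x
      simp [entry_apply, Pi.single_eq_of_ne hb]
    · rw [map_zero]
  · simp
  · intro b _ hb
    rw [map_sum]
    refine Finset.sum_eq_zero fun c _ => ?_
    split_ifs
    · ext1 x
      simp [entry_apply, Pi.single_eq_of_ne hb.symm]
    · rw [map_zero]
  · simp

theorem entry_mul (l k : ι) (f g : SuperEnd p A M) :
    entry l k (toEnd (f * g)) = ∑ c : ι,
      sgn ((p l + p c) * (p c + p k)) •
        (entry l c (toEnd f) ∘ₗ entry c k (toEnd g)) := by
  change entry l k (∑ i : ZMod 2, ∑ j : ZMod 2,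
    sgn (i * j) • (homPart p i (toEnd f) ∘ₗ homPart p j (toEnd g))) = _
  simp only [map_sum, map_zsmul, entry_comp, entry_homPart, Finset.smul_sum]
  rw [Finset.sum_congr rfl fun i _ => Finset.sum_comm, Finset.sum_comm]
  refine Finset.sum_congr rfl fun c _ => ?_
  rw [Finset.sum_eq_single (p l + p c), Finset.sum_eq_single (p c + p k)]
  · rw [if_pos rfl, if_pos rfl]
  · intro j _ hj
    rw [if_neg hj.symm, LinearMap.comp_zero, smul_zero]
  · simp
  · intro i _ hi
    refine Finset.sum_eq_zero fun j _ => ?_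
    rw [if_neg hi.symm, LinearMap.zero_comp, smul_zero]
  · simp

theorem entry_one (l k : ι) :
    entry l k (toEnd (1 : SuperEnd p A M)) =
      LinearMap.proj (R := A) (φ := M) l ∘ₗ LinearMap.single _ _ k := rfl

theorem entry_one_of_ne {l k : ι} (h : l ≠ k) :
    entry l k (toEnd (1 : SuperEnd p A M)) = 0 := by
  ext1 x
  simp [entry_one, Pi.single_eq_of_ne h]

theorem entry_one_self (l : ι) :
    entry l l (toEnd (1 : SuperEnd p A M)) = LinearMap.id := by
  ext1 x
  simp [entry_one]

theorem sgn_assoc (a b c d : ZMod 2) :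
    sgn ((a + c) * (c + d)) * sgn ((a + b) * (b + c)) =
      sgn ((a + b) * (b + d)) * sgn ((b + c) * (c + d)) := by
  revert a b c d
  decide

theorem ext_toEnd {f g : SuperEnd p A M}
    (h : ∀ l k, entry l k (toEnd f) = entry l k (toEnd g)) : f = g :=
  toEnd.injective (ext_entry h)

theorem add_self_zmod (a : ZMod 2) : a + a = 0 := CharTwo.add_self_eq_zero a

instance : Ring (SuperEnd p A M) :=
  { (inferInstance : AddCommGroup (SuperEnd p A M)) with
    mul := (· * ·)
    one := 1
    left_distrib := fun f g h => ext_toEnd fun l k => by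
      simp only [entry_mul, map_add, LinearMap.comp_add, smul_add, Finset.sum_add_distrib]
    right_distrib := fun f g h => ext_toEnd fun l k => by
      simp only [entry_mul, map_add, LinearMap.add_comp, smul_add, Finset.sum_add_distrib]
    zero_mul := fun f => ext_toEnd fun l k => by
      simp only [entry_mul, map_zero, LinearMap.zero_comp, smul_zero, Finset.sum_const_zero]
    mul_zero := fun f => ext_toEnd fun l k => by
      simp only [entry_mul, map_zero, LinearMap.comp_zero, smul_zero, Finset.sum_const_zero]
    mul_assoc := fun f g h => ext_toEnd fun l k => by
      have e1 : ∀ c b : ι,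
          (sgn ((p l + p b) * (p b + p c)) •
            (entry l b (toEnd f) ∘ₗ entry b c (toEnd g))) ∘ₗ entry c k (toEnd h) =
          sgn ((p l + p b) * (p b + p c)) •
            (entry l b (toEnd f) ∘ₗ entry b c (toEnd g) ∘ₗ entry c k (toEnd h)) :=
        fun c b => rfl
      have e2 : ∀ b c : ι,
          entry l b (toEnd f) ∘ₗ (sgn ((p b + p c) * (p c + p k)) •
            (entry b c (toEnd g) ∘ₗ entry c k (toEnd h))) =
          sgn ((p b + p c) * (p c + p k)) •
            (entry l b (toEnd f) ∘ₗ entry b c (toEnd g) ∘ₗ entry c k (toEnd h)) := by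
        intro b c
        ext1 x
        simp
      have hs : ∀ (s : Finset ι) (c : ι) (F : ι → (M c →ₗ[A] M l))
          (G : M k →ₗ[A] M c),
          (∑ b ∈ s, F b) ∘ₗ G = ∑ b ∈ s, F b ∘ₗ G := by
        intro s c F G
        ext1 x
        simp
      have ht : ∀ (s : Finset ι) (b : ι) (F : ι → (M k →ₗ[A] M b))
          (G : M b →ₗ[A] M l),
          G ∘ₗ (∑ c ∈ s, F c) = ∑ c ∈ s, G ∘ₗ F c := by
        intro s b F G
        ext1 x
        simp
      simp only [entry_mul, hs, ht, e1, e2, Finset.smul_sum, smul_smul]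
      rw [Finset.sum_comm]
      refine Finset.sum_congr rfl fun b _ => Finset.sum_congr rfl fun c _ => ?_
      rw [sgn_assoc]
    one_mul := fun f => ext_toEnd fun l k => by
      rw [entry_mul, Finset.sum_eq_single l]
      · rw [entry_one_self, add_self_zmod, zero_mul, LinearMap.id_comp]
        exact one_smul _ _
      · intro b _ hb
        rw [entry_one_of_ne hb.symm, LinearMap.zero_comp, smul_zero]
      · simp
    mul_one := fun f => ext_toEnd fun l k => by
      rw [entry_mul, Finset.sum_eq_single k]
      · rw [entry_one_self, add_self_zmod, mul_zero, LinearMap.comp_id]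
        exact one_smul _ _
      · intro b _ hb
        rw [entry_one_of_ne hb, LinearMap.comp_zero, smul_zero]
      · simp }

variable {K : Type} [CommRing K] [Algebra K A] [∀ i, Module K (M i)]
  [∀ i, IsScalarTower K A (M i)]

instance : Module K (SuperEnd p A M) := inferInstanceAs (Module K (Module.End A (∀ i, M i)))

theorem entry_smul (l k : ι) (c : K) (f : SuperEnd p A M) :
    entry l k (toEnd (c • f)) = c • entry l k (toEnd f) := rfl

instance : Algebra K (SuperEnd p A M) :=
  Algebra.ofModule
    (fun c f g => ext_toEnd fun l k => by
      simp only [entry_mul, entry_smul, Finset.smul_sum]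
      refine Finset.sum_congr rfl fun j _ => ?_
      rw [smul_comm c]
      rfl)
    (fun c f g => ext_toEnd fun l k => by
      simp only [entry_mul, entry_smul, Finset.smul_sum]
      refine Finset.sum_congr rfl fun j _ => ?_
      rw [smul_comm c]
      congr 1
      ext1 x
      exact (entry l j (toEnd f)).map_smul_of_tower c _)

end SuperEnd

end SuperEnd

/-! ### Compositions, Young subgroups and matrices -/

section Combinatorics

variable {m n r : ℕ}

/-- The parity of an index in `{1, …, m + n}`: the first `m` indices are even, the others odd. -/
def idxParity (i : Fin (m + n)) : ZMod 2 := if (i : ℕ) < m then 0 else 1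

variable (m n r) in
/-- The set `Λ(m|n, r)` of compositions `λ|μ` of `r` with `m + n` parts, the first `m` of them
forming `λ` and the last `n` forming `μ`. -/
abbrev SComp : Type := {ν : Fin (m + n) → ℕ // ∑ i, ν i = r}

variable (m n r) in
/-- The set `M(m|n, r)` of matrices over `ℕ` with entry sum `r` whose entries in the two
off-diagonal blocks are at most `1`. -/
abbrev SMat : Type :=
  {A : Fin (m + n) → Fin (m + n) → ℕ //
    ∑ i, ∑ j, A i j = r ∧ ∀ i j, idxParity i + idxParity j = 1 → A i j ≤ 1}

instance : Finite (SComp m n r) := by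
  refine Finite.of_injective
    (fun ν : SComp m n r => fun i => (⟨ν.1 i, ?_⟩ : Fin (r + 1))) ?_
  · have h := Finset.single_le_sum (f := ν.1) (fun _ _ => Nat.zero_le _) (Finset.mem_univ i)
    rw [ν.2] at h
    omega
  · intro ν ρ h
    ext i
    exact congrArg Fin.val (congrFun h i)

instance : Fintype (SComp m n r) := Fintype.ofFinite _

/-- The row sums of a matrix. -/
def SMat.ro (A : SMat m n r) : SComp m n r := ⟨fun i => ∑ j, A.1 i j, A.2.1⟩

/-- The column sums of a matrix. -/
def SMat.co (A : SMat m n r) : SComp m n r :=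
  ⟨fun j => ∑ i, A.1 i j, by rw [Finset.sum_comm]; exact A.2.1⟩

instance : Finite (SMat m n r) := by
  refine Finite.of_injective
    (fun A : SMat m n r => fun i j => (⟨A.1 i j, ?_⟩ : Fin (r + 1))) ?_
  · have h := Finset.single_le_sum (f := fun j => A.1 i j) (fun _ _ => Nat.zero_le _)
      (Finset.mem_univ j)
    have h' := Finset.single_le_sum (f := fun i => ∑ j, A.1 i j) (fun _ _ => Nat.zero_le _)
      (Finset.mem_univ i)
    have := A.2.1
    exact Nat.lt_succ_of_le (h.trans (h'.trans this.le))
  · intro A B h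
    ext i j
    exact congrArg Fin.val (congrFun (congrFun h i) j)

instance : Fintype (SMat m n r) := Fintype.ofFinite _

/-- The parity of `λ|μ`, that is, `|μ|` modulo `2`. -/
def SComp.parity (ν : SComp m n r) : ZMod 2 :=
  ((∑ i with idxParity i = 1, ν.1 i : ℕ) : ZMod 2)

/-- The sum of the parts before the `k`-th one. -/
def SComp.before (ν : SComp m n r) (k : Fin (m + n)) : ℕ := ∑ j with j < k, ν.1 j

/-- The `k`-th block `R_k` of consecutive points, of size `ν_k`. -/
def SComp.row (ν : SComp m n r) (k : Fin (m + n)) : Finset (Fin r) :=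
  Finset.univ.filter fun x => ν.before k ≤ x ∧ (x : ℕ) < ν.before k + ν.1 k

/-- The Young subgroup `𝔖_{λ|μ}`. -/
def SComp.young (ν : SComp m n r) : Subgroup (Perm (Fin r)) :=
  ⨅ k, MulAction.stabilizer (Perm (Fin r)) (ν.row k : Set (Fin r))

/-- The factor `𝔖_{λ^*}` of the Young subgroup `𝔖_{λ|μ}`: it fixes the points of the odd rows. -/
def SComp.evenYoung (ν : SComp m n r) : Subgroup (Perm (Fin r)) :=
  ν.young ⊓ fixingSubgroup (Perm (Fin r)) {x | ∃ k, idxParity k = 1 ∧ x ∈ ν.row k}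

/-- The factor `𝔖_{^*μ}` of the Young subgroup `𝔖_{λ|μ}`: it fixes the points of the even rows. -/
def SComp.oddYoung (ν : SComp m n r) : Subgroup (Perm (Fin r)) :=
  ν.young ⊓ fixingSubgroup (Perm (Fin r)) {x | ∃ k, idxParity k = 0 ∧ x ∈ ν.row k}

open Classical in
/-- The elements of a subgroup of `𝔖_r`. -/
def elts (H : Subgroup (Perm (Fin r))) : Finset (Perm (Fin r)) := Finset.univ.filter (· ∈ H)

open Classical in
/-- The double coset `H d K`. -/
def dcoset (H K : Subgroup (Perm (Fin r))) (d : Perm (Fin r)) : Finset (Perm (Fin r)) :=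
  Finset.univ.filter fun w => ∃ x ∈ H, ∃ y ∈ K, w = x * d * y

/-- The length of the longest element of a set of permutations. -/
def maxLen (s : Finset (Perm (Fin r))) : ℕ := s.sup len

open Classical in
/-- The minimal length representatives of the right cosets `K w`. -/
def minReps (K : Subgroup (Perm (Fin r))) : Finset (Perm (Fin r)) :=
  Finset.univ.filter fun w => ∀ z ∈ K, len w ≤ len (z * w)

open Classical in
/-- The permutations `w` with `|R_i ∩ w R_j| = a_{ij}`, where the rows `R_i` are those of `ro(A)`
and the rows `R_j` are those of `co(A)`. -/
def SMat.perms (A : SMat m n r) : Finset (Perm (Fin r)) :=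
  Finset.univ.filter fun w =>
    ∀ i j, (A.ro.row i ∩ (A.co.row j).map w.toEmbedding).card = A.1 i j

theorem SComp.exists_equiv (ν : SComp m n r) (B : Fin (m + n) → Type) [∀ i, Fintype (B i)]
    (hB : ∀ i, Fintype.card (B i) = ν.1 i) :
    ∃ e : (Σ i, B i) ≃ Fin r, ∀ x i, e x ∈ ν.row i ↔ x.1 = i := by
  classical
  let e1 : (Σ i, B i) ≃ Σ i, Fin (ν.1 i) :=
    Equiv.sigmaCongrRight fun i => Fintype.equivFinOfCardEq (hB i)
  refine ⟨(e1.trans finSigmaFinEquiv).trans (finCongr ν.2), ?_⟩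
  have hval : ∀ x, (((e1.trans finSigmaFinEquiv).trans (finCongr ν.2)) x : ℕ)
      = ν.before x.1 + (e1 x).2 := by
    intro x
    simp only [Equiv.trans_apply, finCongr_apply, Fin.val_cast, finSigmaFinEquiv_apply]
    congr 1
    rw [SComp.before]
    symm
    refine Finset.sum_bij' (fun j hj => ⟨j, by simpa [e1] using hj⟩)
      (fun j _ => Fin.castLE (e1 x).1.2.le j) ?_ ?_ ?_ ?_ ?_
    · intro j hj
      simp
    · intro j hj
      simp only [Finset.mem_filter, Finset.mem_univ, true_and]
      exact j.2
    · intro j hj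
      rfl
    · intro j hj
      rfl
    · intro j hj
      rfl
  have hmono : ∀ i j : Fin (m + n), i < j → ν.before i + ν.1 i ≤ ν.before j := by
    intro i j hij
    rw [SComp.before, SComp.before, add_comm, ← Finset.sum_insert (by simp)]
    refine Finset.sum_le_sum_of_subset fun k hk => ?_
    simp only [Finset.mem_insert, Finset.mem_filter, Finset.mem_univ, true_and] at hk ⊢
    rcases hk with rfl | hk
    · exact hij
    · exact hk.trans hij
  intro x i
  have h2 : ((e1 x).2 : ℕ) < ν.1 x.1 := (e1 x).2.2
  rw [SComp.row, Finset.mem_filter, hval]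
  constructor
  · rintro ⟨-, ha, hb⟩
    rcases lt_trichotomy x.1 i with h | h | h
    · have := hmono _ _ h
      omega
    · exact h
    · have := hmono _ _ h
      omega
  · rintro rfl
    exact ⟨Finset.mem_univ _, by omega, by omega⟩

theorem SMat.perms_nonempty (A : SMat m n r) : A.perms.Nonempty := by
  classical
  obtain ⟨e, he⟩ := A.ro.exists_equiv (fun i => Σ j, Fin (A.1 i j)) (fun i => by simp [SMat.ro])
  obtain ⟨f, hf⟩ := A.co.exists_equiv (fun j => Σ i, Fin (A.1 i j)) (fun i => by simp [SMat.co])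
  let g : (Σ j, Σ i, Fin (A.1 i j)) ≃ (Σ i, Σ j, Fin (A.1 i j)) :=
    ⟨fun x => ⟨x.2.1, x.1, x.2.2⟩, fun x => ⟨x.2.1, x.1, x.2.2⟩, fun _ => rfl, fun _ => rfl⟩
  refine ⟨(f.symm.trans g).trans e, ?_⟩
  rw [SMat.perms, Finset.mem_filter]
  refine ⟨Finset.mem_univ _, fun i j => ?_⟩
  have : A.ro.row i ∩ (A.co.row j).map ((f.symm.trans g).trans e).toEmbedding =
      (Finset.univ : Finset (Fin (A.1 i j))).map
        ⟨fun k => e ⟨i, j, k⟩, fun a b h => by simpa using h⟩ := by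
    ext y
    simp only [Finset.mem_inter, Finset.mem_map, Finset.mem_univ, true_and]
    constructor
    · rintro ⟨h1, z, hz, rfl⟩
      obtain ⟨⟨j', i', k⟩, rfl⟩ := f.surjective z
      rw [hf] at hz
      have hw : ((f.symm.trans g).trans e) (f ⟨j', i', k⟩) = e ⟨i', j', k⟩ := by
        rw [Equiv.trans_apply, Equiv.trans_apply, Equiv.symm_apply_apply]
        rfl
      have h1' : e ⟨i', j', k⟩ ∈ A.ro.row i := hw ▸ h1
      rw [he] at h1'
      obtain rfl : j' = j := hz
      obtain rfl : i' = i := h1'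
      exact ⟨k, hw.symm⟩
    · rintro ⟨k, rfl⟩
      refine ⟨(he _ _).2 rfl, f ⟨j, i, k⟩, (hf _ _).2 rfl, ?_⟩
      change ((f.symm.trans g).trans e) (f ⟨j, i, k⟩) = e ⟨i, j, k⟩
      rw [Equiv.trans_apply, Equiv.trans_apply, Equiv.symm_apply_apply]
      rfl
  rw [this, Finset.card_map, Finset.card_univ, Fintype.card_fin]

/-- The shortest element `d` of the double coset attached to the matrix `A`. -/
def SMat.d (A : SMat m n r) : Perm (Fin r) :=
  (A.perms.exists_min_image len A.perms_nonempty).choose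

theorem dcoset_nonempty (H K : Subgroup (Perm (Fin r))) (d : Perm (Fin r)) :
    (dcoset H K d).Nonempty :=
  ⟨d, by
    classical
    rw [dcoset, Finset.mem_filter]
    exact ⟨Finset.mem_univ _, 1, H.one_mem, 1, K.one_mem, by simp⟩⟩

/-- The longest element `w⁺` of the double coset attached to the matrix `A`. -/
def SMat.wPlus (A : SMat m n r) : Perm (Fin r) :=
  ((dcoset A.ro.young A.co.young A.d).exists_max_image len (dcoset_nonempty _ _ _)).choose

/-- `C ≤ D`: the same row sums, the same column sums, and `w⁺_C ≤ w⁺_D` in the Bruhat order. -/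
def SMat.le (C D : SMat m n r) : Prop :=
  C.ro = D.ro ∧ C.co = D.co ∧ bruhatLE C.wPlus D.wPlus

/-- `C < D`. -/
def SMat.lt (C D : SMat m n r) : Prop := C.le D ∧ C ≠ D

/-- The length of `d^*`, the longest element of `𝔖_{λ^*} d 𝔖_{ξ^*}`. -/
def SMat.lenEven (A : SMat m n r) : ℕ := maxLen (dcoset A.ro.evenYoung A.co.evenYoung A.d)

/-- The length of `^*d`, the longest element of `𝔖_{^*μ} d 𝔖_{^*η}`. -/
def SMat.lenOdd (A : SMat m n r) : ℕ := maxLen (dcoset A.ro.oddYoung A.co.oddYoung A.d)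

/-- The parabolic subgroup `𝔖_{α|β} = d⁻¹ 𝔖_{λ|μ} d ∩ 𝔖_{ξ|η}`. -/
def SMat.stab (A : SMat m n r) : Subgroup (Perm (Fin r)) :=
  A.ro.young.comap (MulAut.conj A.d).toMonoidHom ⊓ A.co.young

/-! ### Signed `q`-permutation modules -/

/-- The element `x_λ = ∑ T_w`, `w ∈ 𝔖_{λ^*}`. -/
def SComp.x (ν : SComp m n r) : Hecke r := ∑ w ∈ elts ν.evenYoung, Hecke.T w

/-- The scalar `(-q)^{-k}`. -/
def negqPow (k : ℕ) : Zv := (-vpow (-2)) ^ k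

/-- The element `y_μ = ∑ (-q)^{-l(w)} T_w`, `w ∈ 𝔖_{^*μ}`. -/
def SComp.y (ν : SComp m n r) : Hecke r :=
  ∑ w ∈ elts ν.oddYoung, negqPow (len w) • Hecke.T w

/-- The element `T_D = ∑ (-q)^{-l(v)} x_λ y_μ T_d T_u T_v`, over all `u ∈ 𝔖_{ξ^*}` and
`v ∈ 𝔖_{^*η}` such that `u v` is a minimal right coset representative of `𝔖_{α|β}`. -/
def SMat.TD (D : SMat m n r) : Hecke r :=
  ∑ u ∈ elts D.co.evenYoung, ∑ v ∈ elts D.co.oddYoung with u * v ∈ minReps D.stab,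
    negqPow (len v) • (D.ro.x * D.ro.y * Hecke.T D.d * Hecke.T u * Hecke.T v)

/-- The normalized element `𝒯_D = v^{-l(d^*) + l(^*d) - l(d)} T_D`. -/
def SMat.nTD (D : SMat m n r) : Hecke r :=
  vpow (-(D.lenEven : ℤ) + D.lenOdd - len D.d) • D.TD

/-- The normalized generator `𝒯_{𝔖_{λ|μ}} = v^{-l(w_{0,λ}) + l(w_{0,μ})} x_λ y_μ`. -/
def SComp.nT (ν : SComp m n r) : Hecke r :=
  vpow (-(maxLen (elts ν.evenYoung) : ℤ) + maxLen (elts ν.oddYoung)) • (ν.x * ν.y)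

/-- The signed `q`-permutation module `x_λ y_μ ℋ`, a right ideal of the Hecke algebra. -/
def SComp.qmod (ν : SComp m n r) : Submodule (Hecke r)ᵐᵒᵖ (Hecke r) :=
  Submodule.span (Hecke r)ᵐᵒᵖ {ν.x * ν.y}

theorem SComp.nT_mul_mem (ν : SComp m n r) (h : Hecke r) : ν.nT * h ∈ ν.qmod := by
  rw [SComp.nT, smul_mul_assoc, ← mul_smul_comm, ← op_smul_eq_mul]
  exact Submodule.smul_mem _ _ (Submodule.subset_span rfl)

end Combinatorics

/-! ### The quantum Schur superalgebra -/

section Schur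

variable {m n r : ℕ}

/-- The element `𝒯_{𝔖_{λ|μ}} h` of the summand of index `λ|μ`. -/
def genMul (ν : SComp m n r) (h : Hecke r) : ∀ k : SComp m n r, k.qmod :=
  Pi.single ν ⟨ν.nT * h, ν.nT_mul_mem h⟩

variable (m n r) in
/-- The quantum Schur superalgebra over `ℤ[v, v⁻¹]`: the endomorphism superalgebra of the right
`ℋ`-module `⊕ x_λ y_μ ℋ`, the sum being over the finite set `Λ(m|n, r)`, where `x_λ y_μ ℋ` has the
degree `|μ|` modulo `2`. -/
abbrev QSchur : Type :=
  SuperEnd (SComp.parity (m := m) (n := n) (r := r)) (Hecke r)ᵐᵒᵖ (fun ν => ν.qmod)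

end Schur

/-! ### Standard bases, the bar involution and canonical bases -/

section Canonical

variable {m n r : ℕ}

open Classical in
/-- `φ` is the family of the elements `φ_D` of the quantum Schur superalgebra determined by
`φ_D (𝒯_{𝔖_ν} h) = δ_{ν, co(D)} 𝒯_D h`, an element of the summand of index `ro(D)`. The value of
`φ_D` is compared in all summands, as an element of the Hecke algebra. -/
def IsStandardFamily (φ : SMat m n r → QSchur m n r) : Prop :=
  ∀ (D : SMat m n r) (ν : SComp m n r) (h : Hecke r) (k : SComp m n r),
    ((SuperEnd.toEnd (φ D) (genMul ν h) k : k.qmod) : Hecke r) =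
      if ν = D.co ∧ k = D.ro then D.nTD * h else 0

open Classical in
/-- `R` is the matrix of the coefficients in `bar 𝒯_D = ∑_{C ≤ D} r_{C,D} 𝒯_C` (with the
convention `r_{C,D} = 0` unless `C ≤ D`). -/
def IsBarMatrix (R : SMat m n r → SMat m n r → Zv) : Prop :=
  (∀ C D, ¬ C.le D → R C D = 0) ∧
    ∀ D : SMat m n r, Hecke.bar D.nTD = ∑ C with C.le D, R C D • C.nTD

/-- `β` extends the bar involution of `ℤ[v, v⁻¹]` and satisfies `β φ_D = ∑ r_{C,D} φ_C`. -/
def IsBarExtension (φ : SMat m n r → QSchur m n r) (R : SMat m n r → SMat m n r → Zv)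
    (β : QSchur m n r →+* QSchur m n r) : Prop :=
  (∀ a : Zv, β (algebraMap Zv (QSchur m n r) a) =
      algebraMap Zv (QSchur m n r) (LaurentPolynomial.invert a)) ∧
    ∀ D, β (φ D) = ∑ C, R C D • φ C

open Classical in
/-- `Θ_D` is fixed by `β`, and `Θ_D - φ_D ∈ ∑_{C < D} v⁻¹ ℤ[v⁻¹] φ_C`. -/
def IsCanonicalFamily (φ : SMat m n r → QSchur m n r) (β : QSchur m n r →+* QSchur m n r)
    (Θ : SMat m n r → QSchur m n r) : Prop :=
  (∀ D, β (Θ D) = Θ D) ∧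
    ∀ D, ∃ p : SMat m n r → Zv, (∀ C, p C ∈ vInvPoly) ∧
      Θ D - φ D = ∑ C with SMat.lt C D, p C • φ C

end Canonical

end QSuper

end

/-! Everything takes place among two-sided eigenvectors in the Hecke algebra. For a composition `ν`,
`leftEig ν` consists of the `z` with `T_s z = q z` for the even simple transpositions `s` of the
Young subgroup and `T_s z = -z` for the odd ones; `rightEig` is the mirror image. In coefficients,
an ascending step by `s` multiplies the coefficient by `1` in the even case and by `-q⁻¹` in the odd
case. So an element of `leftEig ν ∩ rightEig ξ` is determined on each double coset by one
coefficient. If an off-diagonal entry of the matrix of a double coset exceeds `1`, some `w` in it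
satisfies `s w = w s'` with `s`, `s'` of opposite parity; the two ratios differ, and the
coefficients on the double coset vanish. The remaining double cosets are those of `M(m|n,r)`, and
each carries the eigenvector with coefficients `(-q)^{-k}`, where `k` counts the inversions of odd
kind. This eigenvector is `T_D` (`SMat.TD_eq_eigvec`), so the `𝒯_D` form a basis of the two-sided
eigenvectors (`eq_sum_nTD`).

The bar involution preserves the eigenvector equations, so `bar 𝒯_D` is a combination of the `𝒯_C`.
As `bar T_w` is supported on elements below `w`, reading the coefficient at `w_C^+` gives
triangularity. The exponent in the normalization is exactly such that the coefficient of `𝒯_D` at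
`w_D^+` is `± v^{-l(w_D^+)}`, which yields `r_{D,D} = 1` (`SMat.exponent_eq`, `barMat_self`). For a
diagonal matrix nothing lies below, so the generators `𝒯_ν` are fixed by bar (`SComp.bar_nT`).

A homomorphism out of `x_ξ y_η ℋ` is determined by the image of the generator, which is a two-sided
eigenvector. Conversely, a right eigenvector `z` satisfies `z x_ξ y_η = P z` with `P ≠ 0`, so it is
annihilated by everything that annihilates the generator, and `𝒯_ξ h ↦ z h` is well defined. Hence
the `φ_D` form a basis. The bar involution of the superalgebra is conjugation by the bar involutions
of the modules; since these fix the generators, its matrix is that of `bar 𝒯_D`. The `Θ_D` then come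
from the Kazhdan-Lusztig argument for a unitriangular semilinear involution (`IsBarInvolution`). -/

namespace QSuper

open Equiv (Perm)

/-! ### Inversions, lengths, the Bruhat order and parabolic subgroups -/

section Coxeter

variable {r : ℕ}

open Classical in
/-- The number of inversions `(a, b)` of `w` such that `K a b (w a) (w b)`. -/
noncomputable def invCount (K : Fin r → Fin r → Fin r → Fin r → Prop) (w : Perm (Fin r)) : ℕ :=
  (Finset.univ.filter fun p : Fin r × Fin r =>
    p.1 < p.2 ∧ w p.2 < w p.1 ∧ K p.1 p.2 (w p.1) (w p.2)).card

theorem len_eq_invCount (w : Perm (Fin r)) : len w = invCount (fun _ _ _ _ => True) w := by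
  simp [len, invCount]

theorem invCount_inv (K : Fin r → Fin r → Fin r → Fin r → Prop) (w : Perm (Fin r)) :
    invCount K w⁻¹ = invCount (fun a b x y => K y x b a) w := by
  classical
  refine Finset.card_bij' (fun p _ => (w⁻¹ p.2, w⁻¹ p.1)) (fun p _ => (w p.2, w p.1)) ?_ ?_ ?_ ?_
  · rintro ⟨a, b⟩ h
    simp only [Finset.mem_filter, Finset.mem_univ, true_and] at h ⊢
    simpa [and_left_comm] using h
  · rintro ⟨a, b⟩ h
    simp only [Finset.mem_filter, Finset.mem_univ, true_and] at h ⊢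
    simpa [and_left_comm] using h
  · rintro ⟨a, b⟩ _
    simp
  · rintro ⟨a, b⟩ _
    simp

theorem len_inv (w : Perm (Fin r)) : len w⁻¹ = len w := by
  rw [len_eq_invCount, invCount_inv, len_eq_invCount]

theorem simple_lo (i : Fin (r - 1)) : simple i (lo i) = hi i := Equiv.swap_apply_left _ _

theorem simple_hi (i : Fin (r - 1)) : simple i (hi i) = lo i := Equiv.swap_apply_right _ _

theorem simple_simple (i : Fin (r - 1)) (x : Fin r) : simple i (simple i x) = x :=
  by
  simp [simple]

theorem leftAsc_inv (i : Fin (r - 1)) (w : Perm (Fin r)) : LeftAsc i w⁻¹ ↔ RightAsc i w := by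
  rw [LeftAsc, inv_inv, RightAsc]

-- Applying `s_i` to both points matches the inversions of `w` with those of `w s_i` other than `(i,
-- i+1)`, because every other pair keeps its order. The hypothesis `hK` makes the matching respect
-- `K`.
open Classical in
theorem invCount_mul_simple (K : Fin r → Fin r → Fin r → Fin r → Prop) (w : Perm (Fin r))
    (i : Fin (r - 1)) (h : RightAsc i w)
    (hK : ∀ a b x y, K (simple i a) (simple i b) x y ↔ K a b x y) :
    invCount K (w * simple i) =
      invCount K w + if K (lo i) (hi i) (w (hi i)) (w (lo i)) then 1 else 0 := by
  have hinj : Function.Injective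
      (fun p : Fin r × Fin r => (simple i p.1, simple i p.2)) := by
    rintro ⟨a, b⟩ ⟨c, d⟩ h
    simpa using h
  have hset : (Finset.univ.filter fun p : Fin r × Fin r =>
      p.1 < p.2 ∧ (w * simple i) p.2 < (w * simple i) p.1 ∧
        K p.1 p.2 ((w * simple i) p.1) ((w * simple i) p.2)) =
      ((Finset.univ.filter fun p : Fin r × Fin r =>
        p.1 < p.2 ∧ w p.2 < w p.1 ∧ K p.1 p.2 (w p.1) (w p.2)).image
          fun p => (simple i p.1, simple i p.2)) ∪
        (if K (lo i) (hi i) (w (hi i)) (w (lo i)) then {(lo i, hi i)} else ∅) := by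
    ext ⟨a, b⟩
    have hmem : (a, b) ∈ ((Finset.univ.filter fun p : Fin r × Fin r =>
        p.1 < p.2 ∧ w p.2 < w p.1 ∧ K p.1 p.2 (w p.1) (w p.2)).image
          fun p => (simple i p.1, simple i p.2)) ↔
        simple i a < simple i b ∧ w (simple i b) < w (simple i a) ∧
          K a b (w (simple i a)) (w (simple i b)) := by
      simp only [Finset.mem_image, Finset.mem_filter, Finset.mem_univ, true_and, Prod.exists,
        Prod.mk.injEq]
      constructor
      · rintro ⟨a, b, ⟨h1, h2, h3⟩, rfl, rfl⟩
        simpa [simple_simple, hK] using ⟨h1, h2, h3⟩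
      · rintro ⟨h1, h2, h3⟩
        exact ⟨simple i a, simple i b, ⟨h1, h2, (hK _ _ _ _).2 h3⟩, simple_simple _ _,
          simple_simple _ _⟩
    rw [Finset.mem_union, hmem, Finset.mem_filter]
    simp only [Finset.mem_univ, true_and, Perm.mul_apply]
    by_cases h1 : a = lo i ∧ b = hi i
    · obtain ⟨rfl, rfl⟩ := h1
      have h' : w (lo i) < w (hi i) := h
      simp only [simple_lo, simple_hi, lo_lt_hi, h', true_and, not_lt.2 (lo_lt_hi i).le, false_and,
        false_or]
      split_ifs with hk <;> simp [hk]
    · have hn : (a, b) ∉ (if K (lo i) (hi i) (w (hi i)) (w (lo i)) then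
          ({(lo i, hi i)} : Finset (Fin r × Fin r)) else ∅) := by
        split_ifs
        · simpa using h1
        · simp
      simp only [hn, or_false]
      by_cases h2 : a = hi i ∧ b = lo i
      · obtain ⟨rfl, rfl⟩ := h2
        have h' : ¬ w (hi i) < w (lo i) := not_lt.2 (le_of_lt h)
        simp [simple_lo, simple_hi, not_lt.2 (lo_lt_hi i).le, h']
      · rw [simple_lt_iff i h1 h2]
  rw [invCount, hset, Finset.card_union_of_disjoint, Finset.card_image_of_injective _ hinj,
    invCount]
  · split_ifs <;> simp
  · split_ifs
    · rw [Finset.disjoint_singleton_right]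
      simp only [Finset.mem_image, Finset.mem_filter, Finset.mem_univ, true_and, Prod.exists,
        Prod.mk.injEq, not_exists, not_and]
      rintro a b ⟨h1, -⟩ h2 h3
      have ha : a = hi i := by rw [← simple_lo, ← h2, simple_simple]
      have hb : b = lo i := by rw [← simple_hi, ← h3, simple_simple]
      rw [ha, hb] at h1
      exact absurd h1 (not_lt.2 (lo_lt_hi i).le)
    · simp

open Classical in
theorem invCount_simple_mul (K : Fin r → Fin r → Fin r → Fin r → Prop) (w : Perm (Fin r))
    (i : Fin (r - 1)) (h : LeftAsc i w)
    (hK : ∀ a b x y, K a b (simple i x) (simple i y) ↔ K a b x y) :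
    invCount K (simple i * w) =
      invCount K w + if K (w⁻¹ (lo i)) (w⁻¹ (hi i)) (hi i) (lo i) then 1 else 0 := by
  have h1 := invCount_mul_simple (fun a b x y => K y x b a) w⁻¹ i h
    (fun a b x y => hK y x b a)
  have h2 := invCount_inv (fun a b x y => K y x b a) w
  have h3 := invCount_inv (fun a b x y => K y x b a) (simple i * w)
  rw [mul_inv_rev, simple_inv] at h3
  exact h3.symm.trans (h1.trans (by rw [h2]))

theorem len_mul_simple (i : Fin (r - 1)) (w : Perm (Fin r)) (h : RightAsc i w) :
    len (w * simple i) = len w + 1 := by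
  rw [len_eq_invCount, invCount_mul_simple _ _ _ h (by simp), len_eq_invCount, if_pos trivial]

theorem not_rightAsc (i : Fin (r - 1)) (w : Perm (Fin r)) :
    ¬ RightAsc i w ↔ w (hi i) < w (lo i) := by
  rw [← leftAsc_inv, not_leftAsc, inv_inv]

theorem rightAsc_mul_simple (i : Fin (r - 1)) (w : Perm (Fin r)) :
    RightAsc i (w * simple i) ↔ ¬ RightAsc i w := by
  rw [not_rightAsc, RightAsc, Perm.mul_apply, Perm.mul_apply, simple_lo, simple_hi]

theorem len_one : len (1 : Perm (Fin r)) = 0 := by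
  rw [len, Finset.card_eq_zero, Finset.filter_eq_empty_iff]
  rintro ⟨a, b⟩ _ ⟨h1, h2⟩
  exact absurd h1 (not_lt.2 (le_of_lt h2))

theorem eq_one_of_len (w : Perm (Fin r)) (h : len w = 0) : w = 1 := by
  refine eq_one_of_leftAsc w fun i => ?_
  by_contra hi
  have := len_simple_mul_lt i w hi
  omega

theorem simple_mul_simple_mul (i : Fin (r - 1)) (w : Perm (Fin r)) :
    simple i * (simple i * w) = w := by
  rw [← mul_assoc, simple_mul_self, one_mul]

theorem mul_simple_mul_simple (i : Fin (r - 1)) (w : Perm (Fin r)) :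
    w * simple i * simple i = w := by
  rw [mul_assoc, simple_mul_self, mul_one]

/-- The inversions of `w` inject into those of `w t` other than `(a, b)`: a pair is moved by `t`
when `t` keeps its order, and left in place when `t` reverses it. -/
theorem len_mul_swap_lt (w : Perm (Fin r)) {a b : Fin r} (hab : a < b) (hw : w a < w b) :
    len w < len (w * Equiv.swap a b) := by
  classical
  set t := Equiv.swap a b with ht
  have htt : ∀ x, t (t x) = x := fun x => by simp [ht]
  have hta : t a = b := Equiv.swap_apply_left _ _
  have htb : t b = a := Equiv.swap_apply_right _ _
  have hto : ∀ x, x ≠ a → x ≠ b → t x = x := fun x h1 h2 => Equiv.swap_apply_of_ne_of_ne h1 h2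
  have hmem : (a, b) ∈ (Finset.univ.filter fun p : Fin r × Fin r =>
      p.1 < p.2 ∧ (w * t) p.2 < (w * t) p.1) := by
    rw [Finset.mem_filter]
    exact ⟨Finset.mem_univ _, hab, by rw [Perm.mul_apply, Perm.mul_apply, hta, htb]; exact hw⟩
  rw [len, len, ← Finset.card_erase_add_one hmem, Nat.lt_succ_iff]
  refine Finset.card_le_card_of_injOn
    (fun p => if t p.1 < t p.2 then (t p.1, t p.2) else p) ?_ ?_
  · rintro ⟨x, y⟩ h
    rw [Finset.mem_coe, Finset.mem_filter] at h
    obtain ⟨-, h1, h2⟩ := h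
    rw [Finset.mem_coe, Finset.mem_erase, Finset.mem_filter]
    dsimp only at h1 h2 ⊢
    split_ifs with h3
    · refine ⟨?_, Finset.mem_univ _, h3, by simpa [htt] using h2⟩
      intro he
      rw [Prod.mk.injEq] at he
      have hx : x = b := by rw [← htt x, he.1, hta]
      have hy : y = a := by rw [← htt y, he.2, htb]
      rw [hx, hy] at h1
      exact absurd h1 (not_lt.2 hab.le)
    · have hne : ¬ (x = a ∧ y = b) := by
        rintro ⟨rfl, rfl⟩
        exact absurd h2 (not_lt.2 hw.le)
      refine ⟨by simpa using hne, Finset.mem_univ _, h1, ?_⟩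
      rw [Perm.mul_apply, Perm.mul_apply]
      dsimp only
      by_cases hxa : x = a
      · subst hxa
        have hyb : y ≠ b := fun h => hne ⟨rfl, h⟩
        rw [hta, hto y h1.ne' hyb]
        exact h2.trans hw
      · by_cases hyb : y = b
        · subst hyb
          rw [htb, hto x hxa h1.ne]
          exact hw.trans h2
        · exfalso
          apply h3
          by_cases hxb : x = b
          · subst hxb
            rw [htb, hto y (hab.trans h1).ne' hyb]
            exact hab.trans h1
          · by_cases hya : y = a
            · subst hya
              rw [hta, hto x hxa hxb]
              exact h1.trans hab
            · rw [hto x hxa hxb, hto y hya hyb]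
              exact h1
  · rintro ⟨x, y⟩ h1 ⟨z, u⟩ h2 h
    rw [Finset.mem_coe, Finset.mem_filter] at h1 h2
    replace h1 := h1.2
    replace h2 := h2.2
    dsimp only at h
    split_ifs at h with h3 h4 h4
    · simpa using h
    · rw [Prod.mk.injEq] at h
      rw [← h.1, ← h.2, htt, htt] at h4
      exact absurd h1.1 h4
    · rw [Prod.mk.injEq] at h
      rw [h.1, h.2, htt, htt] at h3
      exact absurd h2.1 h3
    · exact h

theorem lt_of_len_lt_mul_swap (w : Perm (Fin r)) {a b : Fin r} (hab : a < b)
    (h : len w < len (w * Equiv.swap a b)) : w a < w b := by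
  by_contra hc
  have hlt : w b < w a := lt_of_le_of_ne (not_lt.1 hc) fun e => hab.ne' (w.injective e)
  have := len_mul_swap_lt (w * Equiv.swap a b) hab (by simpa using hlt)
  rw [Equiv.mul_swap_mul_self] at this
  omega

theorem bruhatLE.len_le {u w : Perm (Fin r)} (h : bruhatLE u w) : len u ≤ len w := by
  induction h with
  | refl => exact le_rfl
  | tail _ h ih =>
    obtain ⟨a, b, -, h⟩ := h
    omega

theorem bruhatLE.eq_of_len_le {u w : Perm (Fin r)} (h : bruhatLE u w) (hl : len w ≤ len u) :
    u = w := by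
  cases h with
  | refl => rfl
  | tail h1 h =>
    have := bruhatLE.len_le h1
    obtain ⟨a, b, -, h⟩ := h
    omega

theorem bruhatLE_mul_simple (i : Fin (r - 1)) (w : Perm (Fin r)) (h : RightAsc i w) :
    bruhatLE w (w * simple i) :=
  .single ⟨lo i, hi i, rfl, by rw [len_mul_simple i w h]; omega⟩

theorem bruhatLE_simple_mul (i : Fin (r - 1)) (w : Perm (Fin r)) (h : LeftAsc i w) :
    bruhatLE w (simple i * w) := by
  refine .single ⟨w⁻¹ (lo i), w⁻¹ (hi i), ?_, by rw [len_simple_mul i w h]; omega⟩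
  rw [Equiv.mul_swap_eq_swap_mul]
  simp [simple]

/-- Left multiplication by `s_i` keeps the relative order of two values unless they are `i` and
`i+1`, and in that case `s_i x = x t`. -/
theorem len_lt_simple_mul_mul_swap {i : Fin (r - 1)} {x : Perm (Fin r)} {a b : Fin r}
    (h : len x < len (x * Equiv.swap a b)) (hne : simple i * x ≠ x * Equiv.swap a b) :
    len (simple i * x) < len (simple i * x * Equiv.swap a b) := by
  wlog hab : a < b generalizing a b
  · rcases eq_or_lt_of_le (not_lt.1 hab) with rfl | hba
    · exact absurd h (by rw [Equiv.swap_self, ← Perm.one_def, mul_one]; exact lt_irrefl _)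
    · rw [Equiv.swap_comm] at h hne ⊢
      exact this h hne hba
  have h1 := lt_of_len_lt_mul_swap x hab h
  refine len_mul_swap_lt _ hab ?_
  rw [Perm.mul_apply, Perm.mul_apply]
  refine (simple_lt_iff i ?_ ?_).2 h1
  · rintro ⟨ha, hb⟩
    rw [Equiv.mul_swap_eq_swap_mul, ha, hb] at hne
    exact hne rfl
  · rintro ⟨ha, hb⟩
    rw [ha, hb] at h1
    exact absurd h1 (not_lt.2 (lo_lt_hi i).le)

/-- The lifting property of the Bruhat order. -/
theorem bruhatLE.simple_mul {u w : Perm (Fin r)} (h : bruhatLE u w) (i : Fin (r - 1))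
    (hw : LeftAsc i w) : bruhatLE (simple i * u) (simple i * w) := by
  induction h using Relation.ReflTransGen.head_induction_on with
  | refl => exact .refl
  | @head x y hxy hyw ih =>
    obtain ⟨a, b, rfl, hl⟩ := hxy
    -- Either the first step of the chain is `x → s_i x`, and `s_i x = y ≤ w ≤ s_i w`; or left
    -- multiplication by `s_i` carries the step to a step.
    by_cases hne : simple i * x = x * Equiv.swap a b
    · rw [hne]
      exact Relation.ReflTransGen.trans hyw (bruhatLE_simple_mul i w hw)
    · exact .head ⟨a, b, (mul_assoc _ _ _).symm, mul_assoc (simple i) x _ ▸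
        len_lt_simple_mul_mul_swap hl hne⟩ ih

/-! Stabilizers of monotone maps. -/

variable {α : Type*} [LinearOrder α] {c : Fin r → α}

/-- Parabolic subgroups appear as stabilizers of monotone maps. A descent of `x` at `i` reverses `i`
and `i+1` under `x⁻¹`, which preserves `c`; so `c (hi i) ≤ c (lo i)`, and `s_i` is itself in the
stabilizer. -/
theorem exists_not_leftAsc (hc : Monotone c) {x : Perm (Fin r)} (hx : c ∘ x = c) (h1 : x ≠ 1) :
    ∃ i, ¬ LeftAsc i x ∧ c (lo i) = c (hi i) := by
  by_contra hcon
  push Not at hcon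
  refine h1 (eq_one_of_leftAsc x fun i => ?_)
  by_contra hi'
  refine hcon i hi' (le_antisymm (hc (lo_lt_hi i).le) ?_)
  have e : ∀ y, c (x⁻¹ y) = c y := fun y => by
    rw [← congrFun hx (x⁻¹ y)]
    simp
  rw [← e (hi i), ← e (lo i)]
  exact hc (le_of_lt ((not_leftAsc i x).1 hi'))

theorem comp_simple {β : Type*} {c : Fin r → β} {i : Fin (r - 1)} (h : c (lo i) = c (hi i)) :
    c ∘ simple i = c := by
  ext x
  simp only [Function.comp_apply, simple, Equiv.swap_apply_def]
  split_ifs with h1 h2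
  · rw [h1, h]
  · rw [h2, h]
  · rfl

theorem comp_mul {β : Type*} {c : Fin r → β} {x y : Perm (Fin r)} (hx : c ∘ x = c)
    (hy : c ∘ y = c) : c ∘ (x * y : Perm (Fin r)) = c := by
  ext k
  rw [Function.comp_apply, Perm.mul_apply, ← Function.comp_apply (f := c) (g := x), hx]
  exact congrFun hy k

theorem comp_inv {β : Type*} {c : Fin r → β} {x : Perm (Fin r)} (hx : c ∘ x = c) :
    c ∘ (x⁻¹ : Perm (Fin r)) = c := by
  ext k
  have := congrFun hx ((x⁻¹ : Perm (Fin r)) k)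
  simpa using this.symm

/-- Induction along a reduced expression in the stabilizer of a monotone map. -/
theorem stab_induction (hc : Monotone c) {Q : Perm (Fin r) → Prop} (one : Q 1)
    (step : ∀ i (x : Perm (Fin r)), c (lo i) = c (hi i) → c ∘ x = c → LeftAsc i x → Q x → Q (simple i * x))
    (x : Perm (Fin r)) (hx : c ∘ x = c) : Q x := by
  induction hn : len x using Nat.strong_induction_on generalizing x with
  | _ n ih =>
    by_cases h1 : x = 1
    · rw [h1]
      exact one
    · obtain ⟨i, hi', hci⟩ := exists_not_leftAsc hc hx h1
      have hx' := comp_mul (comp_simple hci) hx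
      have := step i _ hci hx' ((leftAsc_simple_mul i x).2 hi')
        (ih _ (hn ▸ len_simple_mul_lt i x hi') _ hx' rfl)
      rwa [simple_mul_simple_mul] at this

/-- A map is increasing on the fibres of `c`. -/
def IncrOn {β : Type*} (c : Fin r → β) (w : Perm (Fin r)) : Prop :=
  ∀ a b, a < b → c a = c b → w a < w b

/-- The fibres of a monotone map are intervals, so two points of a fibre are joined by consecutive
points of it. -/
theorem incrOn_of_simple (hc : Monotone c) {w : Perm (Fin r)}
    (h : ∀ i, c (lo i) = c (hi i) → RightAsc i w) : IncrOn c w := by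
  intro a b hab hcab
  obtain ⟨k, hk⟩ : ∃ k : ℕ, (b : ℕ) = a + k + 1 := ⟨b - a - 1, by have := Fin.lt_def.1 hab; omega⟩
  induction k generalizing b with
  | zero =>
    have ha : (a : ℕ) < r - 1 := by omega
    have h1 : a = lo ⟨a, ha⟩ := rfl
    have h2 : b = hi ⟨a, ha⟩ := Fin.ext hk
    have := h ⟨a, ha⟩ (by rw [← h1, ← h2, hcab])
    rwa [RightAsc, ← h1, ← h2] at this
  | succ k ih =>
    have hb : (a : ℕ) + k + 1 < r - 1 := by omega
    have h2 : b = hi ⟨a + k + 1, hb⟩ := Fin.ext hk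
    have hlt : a < lo ⟨a + k + 1, hb⟩ := by rw [Fin.lt_def]; simp only [lo]; omega
    have hle : c (lo ⟨a + k + 1, hb⟩) ≤ c b := hc (h2 ▸ (lo_lt_hi _).le)
    have hc1 : c a = c (lo ⟨a + k + 1, hb⟩) := le_antisymm (hc hlt.le) (hcab ▸ hle)
    refine (ih _ hlt hc1 rfl).trans ?_
    have := h ⟨a + k + 1, hb⟩ (by rw [← hc1, ← h2, hcab])
    rwa [RightAsc, ← h2] at this

/-- That `w⁻¹` increases on the fibres makes `w` the shortest element of its right coset of the
stabilizer: each ascending step of `x` then remains ascending for `x w`. -/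
theorem len_mul_of_incrOn (hc : Monotone c) {w : Perm (Fin r)} (hw : IncrOn c w⁻¹)
    (x : Perm (Fin r)) (hx : c ∘ x = c) : len (x * w) = len x + len w := by
  refine stab_induction hc (Q := fun x => len (x * w) = len x + len w) ?_ ?_ x hx
  · rw [one_mul, len_one, zero_add]
  · intro i x hci hx hasc ih
    have hx' := comp_inv hx
    have h2 : LeftAsc i (x * w) := by
      rw [LeftAsc, mul_inv_rev, Perm.mul_apply, Perm.mul_apply]
      refine hw _ _ hasc ?_
      exact (congrFun hx' _).trans (hci.trans (congrFun hx' _).symm)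
    rw [mul_assoc, len_simple_mul i _ h2, len_simple_mul i _ hasc, ih]
    omega

theorem len_mul_of_incrOn_right (hc : Monotone c) {w : Perm (Fin r)} (hw : IncrOn c w)
    (x : Perm (Fin r)) (hx : c ∘ x = c) : len (w * x) = len w + len x := by
  have := len_mul_of_incrOn hc (w := w⁻¹) (by rwa [inv_inv]) x⁻¹ (comp_inv hx)
  rw [← mul_inv_rev, len_inv, len_inv, len_inv] at this
  omega

/-- Uniqueness of the shortest element of a coset. A left descent `s_i` of `x` inside the stabilizer
shortens `s_i x w` by additivity of lengths, but lengthens it because `x w` increases along fibres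
too. -/
theorem eq_one_of_incrOn (hc : Monotone c) {x : Perm (Fin r)} (hx : c ∘ x = c)
    {w : Perm (Fin r)} (hw : IncrOn c w⁻¹) (hxw : IncrOn c (x * w)⁻¹) : x = 1 := by
  by_contra h1
  obtain ⟨i, hi', hci⟩ := exists_not_leftAsc hc hx h1
  have hasc : LeftAsc i (x * w) := hxw _ _ (lo_lt_hi i) hci
  have e1 := len_mul_of_incrOn hc hw x hx
  have e2 := len_mul_of_incrOn hc hw (simple i * x) (comp_mul (comp_simple hci) hx)
  have e3 := len_simple_mul i _ hasc
  have e4 := len_simple_mul_lt i x hi'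
  rw [mul_assoc] at e2
  omega

/-- Parabolic subgroups are lower sets. If `x t` preserves `c`, with `a < b` and `x a < x b`, then
`c b = c (x a) ≤ c (x b) = c a ≤ c b`, so `t` preserves `c` as well. -/
theorem comp_eq_of_bruhatLE (hc : Monotone c) {u w : Perm (Fin r)} (h : bruhatLE u w)
    (hw : c ∘ w = c) : c ∘ u = c := by
  induction h using Relation.ReflTransGen.head_induction_on with
  | refl => exact hw
  | @head x y hxy hyw ih =>
    obtain ⟨a, b, rfl, hl⟩ := hxy
    clear hw hyw
    wlog hab : a < b generalizing a b
    · rcases eq_or_lt_of_le (not_lt.1 hab) with rfl | hba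
      · exact absurd hl (by rw [Equiv.swap_self, ← Perm.one_def, mul_one]; exact lt_irrefl _)
      · rw [Equiv.swap_comm] at hl ih
        exact this b a ih hl hba
    have h1 := lt_of_len_lt_mul_swap x hab hl
    have ea := congrFun ih a
    have eb := congrFun ih b
    simp only [Function.comp_apply, Perm.mul_apply, Equiv.swap_apply_left,
      Equiv.swap_apply_right] at ea eb
    have hcab : c a = c b := le_antisymm (hc hab.le) (by rw [← ea, ← eb]; exact hc h1.le)
    ext k
    by_cases hka : k = a
    · rw [hka, Function.comp_apply, eb, hcab]
    · by_cases hkb : k = b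
      · rw [hkb, Function.comp_apply, ea, hcab]
      · have := congrFun ih k
        simpa [Equiv.swap_apply_of_ne_of_ne hka hkb] using this

end Coxeter

end QSuper

/-! ### Coefficients and the bar involution in the Hecke algebra -/

namespace QSuper

open Equiv (Perm)

theorem vpow_mul (a b : ℤ) : vpow a * vpow b = vpow (a + b) := (LaurentPolynomial.T_add a b).symm

theorem vpow_zero : vpow 0 = 1 := LaurentPolynomial.T_zero

theorem vpow_pow (a : ℤ) (k : ℕ) : vpow a ^ k = vpow (k * a) := LaurentPolynomial.T_pow a k

theorem qinv_mul_qq : vpow (-2) * qq = 1 := by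
  rw [qq, vpow_mul, neg_add_cancel, vpow_zero]

theorem qq_mul_qinv : qq * vpow (-2) = 1 := by
  rw [mul_comm, qinv_mul_qq]

theorem invert_vpow (k : ℤ) : LaurentPolynomial.invert (vpow k) = vpow (-k) :=
  LaurentPolynomial.invert_T k

theorem invert_invert (a : Zv) :
    LaurentPolynomial.invert (LaurentPolynomial.invert a) = a := by
  ext n
  simp [LaurentPolynomial.invert_apply]

theorem vpow_isUnit (k : ℤ) : IsUnit (vpow k) := LaurentPolynomial.isUnit_T k

theorem vpow_ne_zero (k : ℤ) : vpow k ≠ 0 := (vpow_isUnit k).ne_zero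

theorem negqPow_isUnit (k : ℕ) : IsUnit (negqPow k) := ((vpow_isUnit _).neg).pow k

theorem negqPow_succ (k : ℕ) : negqPow (k + 1) = -vpow (-2) * negqPow k := by
  rw [negqPow, pow_succ', negqPow]

namespace Hecke

variable {r : ℕ}

/-- The coefficient of `T_w`. -/
noncomputable def coeff (w : Perm (Fin r)) : Hecke r →ₗ[Zv] Zv := (basis r).coord w

theorem ext_coeff {a b : Hecke r} (h : ∀ w, coeff w a = coeff w b) : a = b :=
  (basis r).ext_elem h

open Classical in
theorem coeff_T (w u : Perm (Fin r)) : coeff w (T u) = if u = w then 1 else 0 := by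
  rw [coeff, T, Module.Basis.coord_apply, Module.Basis.repr_self, Finsupp.single_apply]

theorem sum_coeff (h : Hecke r) : ∑ w, coeff w h • T w = h := (basis r).sum_repr h

theorem mul_T_simple_eq (a : Hecke r) (i : Fin (r - 1)) : a * T (simple i) = opR i a := by
  classical
  have h1 : RightAsc i (1 : Perm (Fin r)) := lo_lt_hi i
  have h2 : opR i (T (1 : Perm (Fin r))) = T (simple i) := by
    rw [opR_T, if_pos h1, one_mul]
  have h3 := congrArg (fun f : Module.End Zv (Hecke r) => f (T 1)) (commute_ops (opMul_mem a) i).eq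
  simp only [Module.End.mul_apply, h2, opMul_one] at h3
  exact h3

theorem simple_mul_eq_opL (a : Hecke r) (i : Fin (r - 1)) : T (simple i) * a = opL i a := by
  rw [mul_def, opMul_T_simple]

-- The transpose of multiplication by `T_s`, for both sides at once: `σ` is multiplication of
-- permutations by `s`, and `A` singles out the ascents.
open Classical in
theorem coeff_constr (σ : Perm (Fin r) → Perm (Fin r)) (hσ : Function.Involutive σ)
    (A : Perm (Fin r) → Prop) (hA : ∀ w, A (σ w) ↔ ¬ A w) (h : Hecke r) (w : Perm (Fin r)) :
    coeff w ((basis r).constr Zv (fun w =>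
      if A w then T (σ w) else (qq - 1) • T w + qq • T (σ w)) h) =
      if A w then qq * coeff (σ w) h else coeff (σ w) h + (qq - 1) * coeff w h := by
  have hne : ∀ w, σ w ≠ w := fun w e => by
    have := hA w
    rw [e] at this
    tauto
  suffices H : (coeff w) ∘ₗ ((basis r).constr Zv (fun w =>
      if A w then T (σ w) else (qq - 1) • T w + qq • T (σ w))) =
      if A w then qq • coeff (σ w) else coeff (σ w) + (qq - 1) • coeff w by
    have := LinearMap.congr_fun H h
    rw [LinearMap.comp_apply] at this
    rw [this]
    split_ifs <;> simp
  refine (basis r).ext fun u => ?_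
  rw [LinearMap.comp_apply, Module.Basis.constr_basis]
  change _ = (if A w then qq • coeff (σ w) else coeff (σ w) + (qq - 1) • coeff w) (T u)
  by_cases h1 : u = w
  · subst h1
    by_cases hu : A u
    · simp [hu, coeff_T, hne, (hne u).symm]
    · simp [hu, coeff_T, hne, (hne u).symm]
  · by_cases h2 : u = σ w
    · subst h2
      by_cases hu : A w
      · have : ¬ A (σ w) := by rw [hA]; exact not_not.2 hu
        simp [hu, this, coeff_T, hne, hσ w]
      · have : A (σ w) := by rw [hA]; exact hu
        simp [hu, this, coeff_T, hne, hσ w]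
    · have h3 : σ u ≠ w := fun e => h2 (by rw [← e, hσ])
      by_cases hu : A w <;> by_cases hu' : A u <;> simp [hu, hu', coeff_T, h1, h2, h3]

open Classical in
theorem coeff_simple_mul (i : Fin (r - 1)) (h : Hecke r) (w : Perm (Fin r)) :
    coeff w (T (simple i) * h) = if LeftAsc i w then qq * coeff (simple i * w) h
      else coeff (simple i * w) h + (qq - 1) * coeff w h := by
  rw [simple_mul_eq_opL]
  exact coeff_constr (fun w => simple i * w) (simple_mul_simple_mul i) (LeftAsc i)
    (leftAsc_simple_mul i) h w

open Classical in
theorem coeff_mul_simple (i : Fin (r - 1)) (h : Hecke r) (w : Perm (Fin r)) :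
    coeff w (h * T (simple i)) = if RightAsc i w then qq * coeff (w * simple i) h
      else coeff (w * simple i) h + (qq - 1) * coeff w h := by
  rw [mul_T_simple_eq]
  exact coeff_constr (fun w => w * simple i) (mul_simple_mul_simple i) (RightAsc i)
    (rightAsc_mul_simple i) h w

/-! The bar involution. -/

theorem bar_add (a b : Hecke r) : bar (a + b) = bar a + bar b := by
  simp only [bar, map_add, Finsupp.add_apply, add_smul, Finset.sum_add_distrib]

theorem bar_smul (c : Zv) (a : Hecke r) : bar (c • a) = LaurentPolynomial.invert c • bar a := by
  simp only [bar, map_smul, Finsupp.smul_apply, smul_eq_mul, map_mul, mul_smul, Finset.smul_sum]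

/-- The bar involution as an additive map. -/
noncomputable def barAdd (r : ℕ) : Hecke r →+ Hecke r := AddMonoidHom.mk' bar bar_add

theorem bar_zero : bar (0 : Hecke r) = 0 := (barAdd r).map_zero

theorem bar_sum {ι : Type*} (s : Finset ι) (f : ι → Hecke r) :
    bar (∑ i ∈ s, f i) = ∑ i ∈ s, bar (f i) := map_sum (barAdd r) f s

theorem bar_T (w : Perm (Fin r)) : bar (T w) = Ring.inverse (T w⁻¹) := by
  classical
  rw [bar, Finset.sum_eq_single w]
  · rw [T, Module.Basis.repr_self, Finsupp.single_eq_same, map_one, one_smul]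
  · intro u _ hu
    rw [T, Module.Basis.repr_self, Finsupp.single_eq_of_ne hu, map_zero, zero_smul]
  · simp

theorem bar_one : bar (1 : Hecke r) = 1 := by
  rw [one_def, bar_T, inv_one, ← one_def, Ring.inverse_one]

/-- The inverse of `T_{s_i}`. -/
noncomputable def invT (i : Fin (r - 1)) : Hecke r :=
  vpow (-2) • T (simple i) + (vpow (-2) - 1) • (1 : Hecke r)

theorem T_mul_invT (i : Fin (r - 1)) : T (simple i) * invT i = 1 := by
  have hq' : vpow (-2) * (qq - 1) + (vpow (-2) - 1) = 0 := by
    rw [mul_sub, qinv_mul_qq]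
    ring
  rw [invT, mul_add, mul_smul_comm, mul_smul_comm, mul_one, T_simple_sq, smul_add, smul_smul,
    smul_smul, qinv_mul_qq, one_smul, add_right_comm, ← add_smul, hq', zero_smul, zero_add]

theorem invT_mul_T (i : Fin (r - 1)) : invT i * T (simple i) = 1 := by
  rw [← T_mul_invT i, invT, add_mul, mul_add, smul_mul_assoc, smul_mul_assoc, mul_smul_comm,
    mul_smul_comm, one_mul, mul_one]

theorem inverse_T_simple (i : Fin (r - 1)) : Ring.inverse (T (simple i)) = invT i :=
  Ring.inverse_unit (⟨T (simple i), invT i, T_mul_invT i, invT_mul_T i⟩ : (Hecke r)ˣ)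

theorem bar_T_simple (i : Fin (r - 1)) : bar (T (simple i)) = invT i := by
  rw [bar_T, simple_inv, inverse_T_simple]

theorem T_simple_mul_of_leftAsc (i : Fin (r - 1)) (w : Perm (Fin r)) (h : LeftAsc i w) :
    T (simple i * w) = T (simple i) * T w := by
  rw [T_simple_mul, if_pos h]

theorem bar_T_simple_mul (i : Fin (r - 1)) (w : Perm (Fin r)) (h : LeftAsc i w) :
    bar (T (simple i * w)) = invT i * bar (T w) := by
  have h1 : T (simple i * w)⁻¹ = T w⁻¹ * T (simple i) := by
    rw [mul_T_simple_eq, opR_T, if_pos (show RightAsc i w⁻¹ from h), mul_inv_rev, simple_inv]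
  obtain ⟨u, hu⟩ := isUnit_T w⁻¹
  rw [bar_T, bar_T, h1, ← hu, Ring.inverse_unit]
  exact Ring.inverse_unit (u * ⟨T (simple i), invT i, T_mul_invT i, invT_mul_T i⟩ : (Hecke r)ˣ)

theorem invT_sq (i : Fin (r - 1)) :
    invT i * invT i = (vpow (-2) - 1) • invT i + vpow (-2) • (1 : Hecke r) := by
  have : invT i * invT i = vpow (-2) • (T (simple i) * invT i) + (vpow (-2) - 1) • invT i := by
    conv_lhs => rw [invT, add_mul, smul_mul_assoc, smul_mul_assoc, one_mul, ← invT]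
  rw [this, T_mul_invT, add_comm]

/-- Multiplicativity of bar is checked one generator at a time. At a descent, the quadratic relation
`invT_sq` is what is needed, being that of `T_s` with `q` replaced by `q⁻¹`. -/
theorem bar_simple_mul (i : Fin (r - 1)) (h : Hecke r) :
    bar (T (simple i) * h) = invT i * bar h := by
  classical
  rw [← sum_coeff h, Finset.mul_sum, bar_sum, bar_sum, Finset.mul_sum]
  refine Finset.sum_congr rfl fun w _ => ?_
  rw [mul_smul_comm, bar_smul, bar_smul, mul_smul_comm]
  congr 1
  by_cases hw : LeftAsc i w
  · rw [← T_simple_mul_of_leftAsc i w hw, bar_T_simple_mul i w hw]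
  · have h1 := bar_T_simple_mul i (simple i * w) ((leftAsc_simple_mul i w).2 hw)
    rw [simple_mul_simple_mul] at h1
    rw [T_simple_mul, if_neg hw, bar_add, bar_smul, bar_smul, h1, ← mul_assoc, invT_sq, map_sub,
      map_one, invert_vpow, add_mul, smul_mul_assoc, smul_mul_assoc, one_mul]

theorem bar_T_mul (w : Perm (Fin r)) (h : Hecke r) : bar (T w * h) = bar (T w) * bar h := by
  refine stab_induction (c := fun _ : Fin r => (0 : ℕ)) monotone_const
    (Q := fun w => bar (T w * h) = bar (T w) * bar h) ?_ ?_ w rfl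
  · rw [← one_def, bar_one, one_mul, one_mul]
  · intro i w _ _ hw ih
    rw [T_simple_mul_of_leftAsc i w hw, mul_assoc, bar_simple_mul, bar_simple_mul, ih, mul_assoc]

theorem bar_mul (a b : Hecke r) : bar (a * b) = bar a * bar b := by
  rw [← sum_coeff a, Finset.sum_mul, bar_sum, bar_sum, Finset.sum_mul]
  refine Finset.sum_congr rfl fun w _ => ?_
  rw [smul_mul_assoc, bar_smul, bar_smul, bar_T_mul, smul_mul_assoc]

theorem bar_invT (i : Fin (r - 1)) : bar (invT i) = T (simple i) := by
  have h := bar_mul (T (simple i)) (invT i)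
  rw [T_mul_invT, bar_one, bar_T_simple] at h
  rw [← one_mul (bar (invT i)), ← T_mul_invT i, mul_assoc, ← h, mul_one]

theorem bar_bar (h : Hecke r) : bar (bar h) = h := by
  conv_rhs => rw [← sum_coeff h]
  conv_lhs => rw [← sum_coeff h]
  rw [bar_sum, bar_sum]
  refine Finset.sum_congr rfl fun w _ => ?_
  rw [bar_smul, bar_smul, invert_invert]
  congr 1
  refine stab_induction (c := fun _ : Fin r => (0 : ℕ)) monotone_const
    (Q := fun w => bar (bar (T w)) = T w) ?_ ?_ w rfl
  · rw [← one_def, bar_one, bar_one]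
  · intro i w _ _ hw ih
    rw [bar_T_simple_mul i w hw, bar_mul, ih, bar_invT, T_simple_mul_of_leftAsc i w hw]

theorem coeff_invT_mul (i : Fin (r - 1)) (h : Hecke r) (w : Perm (Fin r)) :
    coeff w (invT i * h) =
      vpow (-2) * coeff w (T (simple i) * h) + (vpow (-2) - 1) * coeff w h := by
  rw [invT, add_mul, smul_mul_assoc, smul_mul_assoc, one_mul, map_add, map_smul, map_smul,
    smul_eq_mul, smul_eq_mul]

/-- Along a reduced expression, multiplication by `T_s⁻¹` sends the coefficients at `y` and `s y`
only to each other; the lifting property of the Bruhat order keeps the support below `s w`. -/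
theorem bruhatLE_of_coeff_bar_T (w y : Perm (Fin r)) (h : coeff y (bar (T w)) ≠ 0) :
    bruhatLE y w := by
  classical
  refine stab_induction (c := fun _ : Fin r => (0 : ℕ)) monotone_const
    (Q := fun w => ∀ y, coeff y (bar (T w)) ≠ 0 → bruhatLE y w) ?_ ?_ w rfl y h
  · intro y hy
    rw [← one_def, bar_one, one_def, coeff_T] at hy
    obtain rfl : 1 = y := by by_contra h; simp [h] at hy
    exact .refl
  · intro i w _ _ hw ih y hy
    by_cases h1 : coeff y (bar (T w)) = 0
    · by_cases h2 : coeff (simple i * y) (bar (T w)) = 0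
      · rw [bar_T_simple_mul i w hw, coeff_invT_mul, coeff_simple_mul, h1, h2] at hy
        simp at hy
      · have := (ih _ h2).simple_mul i hw
        rwa [simple_mul_simple_mul] at this
    · exact Relation.ReflTransGen.trans (ih y h1) (bruhatLE_simple_mul i w hw)

/-- Each letter of a reduced expression contributes a factor `q⁻¹`: `bar T_w` has no term at the
longer element `s w`, so only the summand `q⁻¹ T_s` of `T_s⁻¹` reaches it. -/
theorem coeff_bar_T_self (w : Perm (Fin r)) :
    coeff w (bar (T w)) = vpow (-2 * (len w : ℤ)) := by
  classical
  refine stab_induction (c := fun _ : Fin r => (0 : ℕ)) monotone_const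
    (Q := fun w => coeff w (bar (T w)) = vpow (-2 * (len w : ℤ))) ?_ ?_ w rfl
  · rw [← one_def, bar_one, one_def, coeff_T, if_pos rfl, len_one]
    exact vpow_zero.symm
  · intro i w _ _ hw ih
    have h1 : coeff (simple i * w) (bar (T w)) = 0 := by
      by_contra h
      have := (bruhatLE_of_coeff_bar_T _ _ h).len_le
      rw [len_simple_mul i w hw] at this
      omega
    have h2 : ¬ LeftAsc i (simple i * w) := by
      rw [leftAsc_simple_mul]
      exact not_not.2 hw
    rw [bar_T_simple_mul i w hw, coeff_invT_mul, coeff_simple_mul, if_neg h2,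
      simple_mul_simple_mul, h1, ih, len_simple_mul i w hw, mul_zero, mul_zero, add_zero,
      add_zero, vpow_mul]
    congr 1
    push_cast
    ring

end Hecke

end QSuper

/-! ### Young subgroups, their even and odd factors, and double cosets -/

namespace QSuper

open Equiv (Perm)

section Combinatorics

variable {m n r : ℕ}

theorem parity_ne_add_one (p : ZMod 2) : p ≠ p + 1 := by
  revert p
  decide

theorem parity_eq_zero_or_one (p : ZMod 2) : p = 0 ∨ p = 1 := by
  revert p
  decide

theorem parity_eq_or_eq_add_one (p a : ZMod 2) : a = p ∨ a = p + 1 := by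
  revert p a
  decide

theorem mem_dcoset {H K : Subgroup (Perm (Fin r))} {d w : Perm (Fin r)} :
    w ∈ dcoset H K d ↔ ∃ x ∈ H, ∃ y ∈ K, w = x * d * y := by
  classical
  rw [dcoset, Finset.mem_filter]
  exact and_iff_right (Finset.mem_univ _)

theorem mem_elts {H : Subgroup (Perm (Fin r))} {w : Perm (Fin r)} : w ∈ elts H ↔ w ∈ H := by
  classical
  rw [elts, Finset.mem_filter]
  exact and_iff_right (Finset.mem_univ _)

theorem mem_minReps {K : Subgroup (Perm (Fin r))} {w : Perm (Fin r)} :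
    w ∈ minReps K ↔ ∀ z ∈ K, len w ≤ len (z * w) := by
  classical
  rw [minReps, Finset.mem_filter]
  exact and_iff_right (Finset.mem_univ _)

theorem idxParity_eq (k : Fin (m + n)) : idxParity k = 0 ∨ idxParity k = 1 := by
  rw [idxParity]
  split_ifs
  · exact Or.inl rfl
  · exact Or.inr rfl

theorem SComp.exists_rowOf (ν : SComp m n r) :
    ∃ f : Fin r → Fin (m + n), ∀ x k, x ∈ ν.row k ↔ f x = k := by
  obtain ⟨e, he⟩ := ν.exists_equiv (fun i => Fin (ν.1 i)) (fun i => Fintype.card_fin _)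
  refine ⟨fun x => (e.symm x).1, fun x k => ?_⟩
  rw [← he, Equiv.apply_symm_apply]

/-- The index of the row of a point. -/
noncomputable def SComp.rowOf (ν : SComp m n r) : Fin r → Fin (m + n) := ν.exists_rowOf.choose

theorem SComp.mem_row (ν : SComp m n r) (x : Fin r) (k : Fin (m + n)) :
    x ∈ ν.row k ↔ ν.rowOf x = k := ν.exists_rowOf.choose_spec x k

theorem SComp.rowOf_mono (ν : SComp m n r) : Monotone ν.rowOf := by
  intro x y hxy
  by_contra hlt
  rw [not_le] at hlt
  have hx := (ν.mem_row x _).2 rfl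
  have hy := (ν.mem_row y _).2 rfl
  rw [SComp.row, Finset.mem_filter] at hx hy
  have hmono : ν.before (ν.rowOf y) + ν.1 (ν.rowOf y) ≤ ν.before (ν.rowOf x) := by
    rw [SComp.before, SComp.before, add_comm, ← Finset.sum_insert (by simp)]
    refine Finset.sum_le_sum_of_subset fun k hk => ?_
    simp only [Finset.mem_insert, Finset.mem_filter, Finset.mem_univ, true_and] at hk ⊢
    rcases hk with rfl | hk
    · exact hlt
    · exact hk.trans hlt
  have := Fin.le_def.1 hxy
  omega

theorem SComp.mem_young (ν : SComp m n r) (w : Perm (Fin r)) :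
    w ∈ ν.young ↔ ν.rowOf ∘ w = ν.rowOf := by
  simp only [SComp.young, Subgroup.mem_iInf, MulAction.mem_stabilizer_set, Finset.mem_coe,
    Perm.smul_def, SComp.mem_row]
  constructor
  · intro h
    ext x
    rw [Function.comp_apply, (h _ x).2 rfl]
  · intro h k x
    rw [← Function.comp_apply (f := ν.rowOf) (g := w), h]

/-- A map whose stabilizer is the factor of parity `p` of a Young subgroup. -/
noncomputable def SComp.parityMap (p : ZMod 2) (ν : SComp m n r) (x : Fin r) :
    Fin (m + n) ×ₗ ℕ :=
  toLex (ν.rowOf x, if idxParity (ν.rowOf x) = p then 0 else (x : ℕ))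

/-- A row of parity `p` is one fibre, while the second coordinate separates the points of the other
rows. With the lexicographic order the map is monotone, so the results on stabilizers of monotone
maps apply to each factor. -/
theorem SComp.parityMap_mono (p : ZMod 2) (ν : SComp m n r) : Monotone (ν.parityMap p) := by
  intro x y hxy
  rw [SComp.parityMap, SComp.parityMap, Prod.Lex.toLex_le_toLex]
  rcases (ν.rowOf_mono hxy).lt_or_eq with h | h
  · exact Or.inl h
  · refine Or.inr ⟨h, ?_⟩
    dsimp only
    rw [h]
    split_ifs
    · exact le_rfl
    · exact hxy

theorem SComp.parityMap_eq (p : ZMod 2) (ν : SComp m n r) {x y : Fin r} :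
    ν.parityMap p x = ν.parityMap p y ↔
      ν.rowOf x = ν.rowOf y ∧ (idxParity (ν.rowOf y) ≠ p → x = y) := by
  rw [SComp.parityMap, SComp.parityMap, toLex_inj, Prod.mk.injEq]
  refine and_congr_right fun h => ?_
  rw [h]
  split_ifs with h1
  · simp [h1]
  · simp [h1, Fin.ext_iff]

theorem SComp.parityMap_simple (p : ZMod 2) (ν : SComp m n r) {i : Fin (r - 1)}
    (h : ν.parityMap p (lo i) = ν.parityMap p (hi i)) :
    ν.rowOf (lo i) = ν.rowOf (hi i) ∧ idxParity (ν.rowOf (lo i)) = p := by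
  rw [SComp.parityMap_eq] at h
  refine ⟨h.1, ?_⟩
  rw [h.1]
  by_contra hp
  exact (lo_lt_hi i).ne (h.2 hp)

/-- The factor of parity `p` of the Young subgroup. -/
noncomputable def SComp.factor (ν : SComp m n r) (p : ZMod 2) : Subgroup (Perm (Fin r)) :=
  if p = 0 then ν.evenYoung else ν.oddYoung

theorem SComp.factor_zero (ν : SComp m n r) : ν.factor 0 = ν.evenYoung := if_pos rfl

theorem SComp.factor_one (ν : SComp m n r) : ν.factor 1 = ν.oddYoung := if_neg one_ne_zero

theorem SComp.mem_factor_iff (ν : SComp m n r) (p : ZMod 2) (w : Perm (Fin r)) :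
    w ∈ ν.factor p ↔ w ∈ ν.young ∧ ∀ x, idxParity (ν.rowOf x) ≠ p → w x = x := by
  have hp := parity_eq_zero_or_one p
  have e1 : ∀ k : Fin (m + n), idxParity k ≠ 0 ↔ idxParity k = 1 := fun k => by
    rcases idxParity_eq k with h | h <;> simp [h]
  have e2 : ∀ k : Fin (m + n), idxParity k ≠ 1 ↔ idxParity k = 0 := fun k => by
    rcases idxParity_eq k with h | h <;> simp [h]
  rcases hp with rfl | rfl
  · rw [SComp.factor_zero, SComp.evenYoung, Subgroup.mem_inf, mem_fixingSubgroup_iff]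
    simp [SComp.mem_row, e1]
  · rw [SComp.factor_one, SComp.oddYoung, Subgroup.mem_inf, mem_fixingSubgroup_iff]
    simp [SComp.mem_row, e2]

theorem SComp.mem_factor (ν : SComp m n r) (p : ZMod 2) (w : Perm (Fin r)) :
    w ∈ ν.factor p ↔ ν.parityMap p ∘ w = ν.parityMap p := by
  rw [ν.mem_factor_iff, ν.mem_young, funext_iff, funext_iff, ← forall_and]
  simp only [Function.comp_apply, SComp.parityMap_eq]

theorem SComp.simple_mem_young (ν : SComp m n r) {i : Fin (r - 1)}
    (h : ν.rowOf (lo i) = ν.rowOf (hi i)) : simple i ∈ ν.young :=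
  (ν.mem_young _).2 (comp_simple h)

theorem SComp.simple_mem_factor (ν : SComp m n r) {i : Fin (r - 1)}
    (h : ν.rowOf (lo i) = ν.rowOf (hi i)) : simple i ∈ ν.factor (idxParity (ν.rowOf (lo i))) := by
  rw [ν.mem_factor]
  refine comp_simple ?_
  rw [SComp.parityMap_eq]
  exact ⟨h, fun h' => absurd (by rw [h]) h'⟩

theorem SComp.factor_le (ν : SComp m n r) (p : ZMod 2) : ν.factor p ≤ ν.young :=
  fun _ hw => ((ν.mem_factor_iff p _).1 hw).1

theorem SComp.factor_commute (ν : SComp m n r) (p : ZMod 2) {u v : Perm (Fin r)}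
    (hu : u ∈ ν.factor p) (hv : v ∈ ν.factor (p + 1)) : u * v = v * u := by
  have hu' := (ν.mem_factor_iff p u).1 hu
  have hv' := (ν.mem_factor_iff (p + 1) v).1 hv
  have eu := fun x => congrFun ((ν.mem_young u).1 hu'.1) x
  have ev := fun x => congrFun ((ν.mem_young v).1 hv'.1) x
  simp only [Function.comp_apply] at eu ev
  ext x
  rw [Perm.mul_apply, Perm.mul_apply]
  by_cases h : idxParity (ν.rowOf x) = p
  · have hne := parity_ne_add_one p
    rw [hv'.2 x (by rw [h]; exact hne), hv'.2 (u x) (by rw [eu, h]; exact hne)]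
  · rw [hu'.2 x h, hu'.2 (v x) (by rwa [ev])]

theorem SComp.factor_disjoint (ν : SComp m n r) (p : ZMod 2) {u : Perm (Fin r)}
    (hu : u ∈ ν.factor p) (hv : u ∈ ν.factor (p + 1)) : u = 1 := by
  ext x
  by_cases h : idxParity (ν.rowOf x) = p
  · have hne := parity_ne_add_one p
    rw [((ν.mem_factor_iff (p + 1) u).1 hv).2 x (by rw [h]; exact hne), Perm.one_apply]
  · rw [((ν.mem_factor_iff p u).1 hu).2 x h, Perm.one_apply]

/-- Each simple transposition of the Young subgroup lies in one of the two factors, and these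
commute. -/
theorem SComp.exists_factor (ν : SComp m n r) (p : ZMod 2) {x : Perm (Fin r)} (hx : x ∈ ν.young) :
    ∃ u ∈ ν.factor p, ∃ v ∈ ν.factor (p + 1), x = u * v := by
  refine stab_induction ν.rowOf_mono
    (Q := fun x => ∃ u ∈ ν.factor p, ∃ v ∈ ν.factor (p + 1), x = u * v) ?_ ?_ x
    ((ν.mem_young x).1 hx)
  · exact ⟨1, one_mem _, 1, one_mem _, (mul_one 1).symm⟩
  · rintro i x hi' - - ⟨u, hu, v, hv, rfl⟩
    have hs := ν.simple_mem_factor hi'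
    rcases parity_eq_or_eq_add_one p (idxParity (ν.rowOf (lo i))) with h | h <;> rw [h] at hs
    · exact ⟨simple i * u, mul_mem hs hu, v, hv, (mul_assoc _ _ _).symm⟩
    · refine ⟨u, hu, simple i * v, mul_mem hs hv, ?_⟩
      rw [← mul_assoc, ← mul_assoc, ν.factor_commute p hu hs]

/-- An element of the other factor fixes the rows of parity `p` pointwise. This makes lengths
additive across the two factors. -/
theorem SComp.incrOn_factor (ν : SComp m n r) (p : ZMod 2) {v : Perm (Fin r)}
    (hv : v ∈ ν.factor (p + 1)) : IncrOn (ν.parityMap p) v := by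
  intro a b hab h
  rw [SComp.parityMap_eq] at h
  have hp : idxParity (ν.rowOf b) = p := by
    by_contra hp
    exact hab.ne (h.2 hp)
  have hne := parity_ne_add_one p
  have hv' := ((ν.mem_factor_iff (p + 1) v).1 hv).2
  rwa [hv' a (by rw [h.1, hp]; exact hne), hv' b (by rw [hp]; exact hne)]

/-! Matrices and double cosets. -/

/-- The matrix of a double coset. -/
def matOf (ν ξ : SComp m n r) (w : Perm (Fin r)) (i j : Fin (m + n)) : ℕ :=
  (ν.row i ∩ (ξ.row j).map w.toEmbedding).card

open Classical in
theorem matOf_eq (ν ξ : SComp m n r) (w : Perm (Fin r)) (i j : Fin (m + n)) :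
    matOf ν ξ w i j =
      (Finset.univ.filter fun k => (ν.rowOf (w k), ξ.rowOf k) = (i, j)).card := by
  rw [matOf]
  refine Eq.trans ?_ (Finset.card_map w.toEmbedding)
  congr 1
  ext x
  simp only [Finset.mem_inter, SComp.mem_row, Finset.mem_map, Equiv.coe_toEmbedding,
    Finset.mem_filter, Finset.mem_univ, true_and, Prod.mk.injEq]
  constructor
  · rintro ⟨h, y, hy, he⟩
    exact ⟨y, ⟨by rw [he, h], hy⟩, he⟩
  · rintro ⟨y, ⟨h, hy⟩, he⟩
    exact ⟨by rw [← he, h], y, hy, he⟩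

theorem SMat.mem_perms (A : SMat m n r) (w : Perm (Fin r)) :
    w ∈ A.perms ↔ ∀ i j, matOf A.ro A.co w i j = A.1 i j := by
  rw [SMat.perms, Finset.mem_filter]
  exact and_iff_right (Finset.mem_univ _)

theorem exists_perm_comp_eq {β : Type*} [DecidableEq β] (f g : Fin r → β)
    (h : ∀ b, (Finset.univ.filter fun k => f k = b).card =
      (Finset.univ.filter fun k => g k = b).card) : ∃ σ : Perm (Fin r), g ∘ σ = f := by
  have e : ∀ b, Nonempty ({k // f k = b} ≃ {k // g k = b}) := fun b =>
    ⟨Fintype.equivOfCardEq (by rw [Fintype.card_subtype, Fintype.card_subtype, h b])⟩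
  refine ⟨((Equiv.sigmaFiberEquiv f).symm.trans (Equiv.sigmaCongrRight fun b => (e b).some)).trans
    (Equiv.sigmaFiberEquiv g), ?_⟩
  exact funext fun k => ((e (f k)).some ⟨k, rfl⟩).2

/-- The matrix counts the fibres of `k ↦ (row of w k, column of k)`. When the counts agree, a
permutation `σ` carries the map of `w'` to that of `w`; it preserves the columns, and `w' (w σ)⁻¹`
preserves the rows. -/
theorem matOf_eq_iff (ν ξ : SComp m n r) (w w' : Perm (Fin r)) :
    matOf ν ξ w = matOf ν ξ w' ↔ ∃ x ∈ ν.young, ∃ y ∈ ξ.young, w' = x * w * y := by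
  classical
  constructor
  · intro h
    obtain ⟨σ, hσ⟩ := exists_perm_comp_eq (fun k => (ν.rowOf (w' k), ξ.rowOf k))
      (fun k => (ν.rowOf (w k), ξ.rowOf k)) (fun ⟨i, j⟩ => by
        rw [← matOf_eq, ← matOf_eq, h])
    have h1 : ∀ k, ν.rowOf (w (σ k)) = ν.rowOf (w' k) := fun k =>
      congrArg Prod.fst (congrFun hσ k)
    have h2 : ∀ k, ξ.rowOf (σ k) = ξ.rowOf k := fun k => congrArg Prod.snd (congrFun hσ k)
    refine ⟨w' * (w * σ)⁻¹, (ν.mem_young _).2 ?_, σ, (ξ.mem_young _).2 (funext h2), by group⟩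
    ext k
    have := h1 ((w * σ)⁻¹ k)
    rw [← Perm.mul_apply, ← Perm.mul_apply, mul_inv_cancel, Perm.one_apply] at this
    rw [this]
    rfl
  · rintro ⟨x, hx, y, hy, rfl⟩
    rw [SComp.mem_young] at hx hy
    funext i j
    rw [matOf_eq, matOf_eq, ← Finset.card_map y.symm.toEmbedding]
    congr 1
    ext k
    have hx' := fun k => congrFun hx k
    have hy' := fun k => congrFun hy k
    simp only [Function.comp_apply] at hx' hy'
    simp only [Finset.mem_map, Equiv.coe_toEmbedding,
      Finset.mem_filter, Finset.mem_univ, true_and, Prod.mk.injEq, Perm.mul_apply, hx']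
    constructor
    · rintro ⟨k, ⟨rfl, rfl⟩, rfl⟩
      refine ⟨by simp, ?_⟩
      rw [← hy']
      simp
    · rintro ⟨rfl, rfl⟩
      exact ⟨y k, ⟨rfl, hy' k⟩, by simp⟩

theorem SMat.mem_perms_iff (A : SMat m n r) {w : Perm (Fin r)} (hw : w ∈ A.perms)
    (w' : Perm (Fin r)) :
    w' ∈ A.perms ↔ ∃ x ∈ A.ro.young, ∃ y ∈ A.co.young, w' = x * w * y := by
  rw [← matOf_eq_iff, A.mem_perms]
  rw [A.mem_perms] at hw
  constructor
  · intro h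
    funext i j
    rw [h, hw]
  · intro h i j
    rw [← h, hw]

theorem SMat.d_mem (A : SMat m n r) : A.d ∈ A.perms :=
  (A.perms.exists_min_image len A.perms_nonempty).choose_spec.1

theorem SMat.len_d_le (A : SMat m n r) {w : Perm (Fin r)} (hw : w ∈ A.perms) :
    len A.d ≤ len w :=
  (A.perms.exists_min_image len A.perms_nonempty).choose_spec.2 w hw

theorem SMat.dcoset_eq (A : SMat m n r) : dcoset A.ro.young A.co.young A.d = A.perms := by
  ext w
  rw [A.mem_perms_iff A.d_mem, mem_dcoset]

theorem SMat.wPlus_mem (A : SMat m n r) : A.wPlus ∈ A.perms := by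
  rw [← A.dcoset_eq]
  exact ((dcoset A.ro.young A.co.young A.d).exists_max_image len
    (dcoset_nonempty _ _ _)).choose_spec.1

theorem SMat.len_le_wPlus (A : SMat m n r) {w : Perm (Fin r)} (hw : w ∈ A.perms) :
    len w ≤ len A.wPlus := by
  rw [← A.dcoset_eq] at hw
  exact ((dcoset A.ro.young A.co.young A.d).exists_max_image len
    (dcoset_nonempty _ _ _)).choose_spec.2 w hw

theorem SMat.mul_mem_perms (A : SMat m n r) {w x : Perm (Fin r)} (hx : x ∈ A.ro.young) :
    x * w ∈ A.perms ↔ w ∈ A.perms := by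
  constructor
  · intro h
    exact (A.mem_perms_iff h _).2 ⟨x⁻¹, inv_mem hx, 1, one_mem _, by group⟩
  · intro h
    exact (A.mem_perms_iff h _).2 ⟨x, hx, 1, one_mem _, by group⟩

theorem SMat.mem_perms_mul (A : SMat m n r) {w y : Perm (Fin r)} (hy : y ∈ A.co.young) :
    w * y ∈ A.perms ↔ w ∈ A.perms := by
  constructor
  · intro h
    exact (A.mem_perms_iff h _).2 ⟨1, one_mem _, y⁻¹, inv_mem hy, by group⟩
  · intro h
    exact (A.mem_perms_iff h _).2 ⟨1, one_mem _, y, hy, by group⟩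

theorem SMat.eq_of_mem_perms {A B : SMat m n r} (h1 : A.ro = B.ro) (h2 : A.co = B.co)
    {w : Perm (Fin r)} (hA : w ∈ A.perms) (hB : w ∈ B.perms) : A = B := by
  rw [SMat.mem_perms] at hA hB
  rw [← h1, ← h2] at hB
  ext i j
  rw [← hA, hB]

/-- Two points in a common row and a common column give an entry of at least `2`, which the bound on
the off-diagonal blocks forbids when the parities differ. -/
theorem SMat.parity_eq (A : SMat m n r) {w : Perm (Fin r)} (hw : w ∈ A.perms) {a b : Fin r}
    (hab : a ≠ b) (h1 : A.co.rowOf a = A.co.rowOf b) (h2 : A.ro.rowOf (w a) = A.ro.rowOf (w b)) :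
    idxParity (A.co.rowOf a) = idxParity (A.ro.rowOf (w a)) := by
  classical
  by_contra hne
  have hs : idxParity (A.ro.rowOf (w a)) + idxParity (A.co.rowOf a) = 1 := by
    generalize idxParity (A.ro.rowOf (w a)) = x at *
    generalize idxParity (A.co.rowOf a) = y at *
    revert x y
    decide
  have h := A.2.2 _ _ hs
  rw [← (A.mem_perms w).1 hw, matOf_eq, Finset.card_le_one] at h
  exact hab (h a (by simp) b (by simp [h1, h2]))

/-! Ascents and the shortest and longest elements. -/

theorem SMat.d_rightAsc (A : SMat m n r) {i : Fin (r - 1)}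
    (h : A.co.rowOf (lo i) = A.co.rowOf (hi i)) : RightAsc i A.d := by
  by_contra hc
  have h1 := A.len_d_le ((A.mem_perms_mul (A.co.simple_mem_young h)).2 A.d_mem)
  have h2 := len_mul_simple i _ ((rightAsc_mul_simple i A.d).2 hc)
  rw [mul_simple_mul_simple] at h2
  omega

theorem SMat.d_leftAsc (A : SMat m n r) {i : Fin (r - 1)}
    (h : A.ro.rowOf (lo i) = A.ro.rowOf (hi i)) : LeftAsc i A.d := by
  by_contra hc
  have h1 := A.len_d_le ((A.mul_mem_perms (A.ro.simple_mem_young h)).2 A.d_mem)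
  have h2 := len_simple_mul_lt i _ hc
  omega

theorem SMat.d_incrOn (A : SMat m n r) : IncrOn A.co.rowOf A.d :=
  incrOn_of_simple A.co.rowOf_mono fun _ h => A.d_rightAsc h

theorem SMat.d_inv_incrOn (A : SMat m n r) : IncrOn A.ro.rowOf A.d⁻¹ :=
  incrOn_of_simple A.ro.rowOf_mono fun _ h => A.d_leftAsc h

/-- The absence of ascents in the directions of two Young subgroups. -/
def IsTop (ν ξ : SComp m n r) (w : Perm (Fin r)) : Prop :=
  (∀ i, ν.rowOf (lo i) = ν.rowOf (hi i) → ¬ LeftAsc i w) ∧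
    ∀ i, ξ.rowOf (lo i) = ξ.rowOf (hi i) → ¬ RightAsc i w

theorem decr_of_simple {α : Type*} [LinearOrder α] {c : Fin r → α} (hc : Monotone c)
    {w : Perm (Fin r)} (h : ∀ i, c (lo i) = c (hi i) → ¬ RightAsc i w) {a b : Fin r}
    (hab : a < b) (hcab : c a = c b) : w b < w a := by
  have : IncrOn c (Fin.revPerm * w) := incrOn_of_simple hc fun i hi' => by
    rw [RightAsc, Perm.mul_apply, Perm.mul_apply, Fin.revPerm_apply, Fin.revPerm_apply,
      Fin.rev_lt_rev]
    exact (not_rightAsc i w).1 (h i hi')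
  have := this a b hab hcab
  rwa [Perm.mul_apply, Perm.mul_apply, Fin.revPerm_apply, Fin.revPerm_apply,
    Fin.rev_lt_rev] at this

theorem IsTop.monotone_col {ν ξ : SComp m n r} {w : Perm (Fin r)} (hw : IsTop ν ξ w) :
    Monotone fun k => toLex (ξ.rowOf k, OrderDual.toDual (ν.rowOf (w k))) := by
  intro a b hab
  rcases hab.eq_or_lt with rfl | hlt
  · exact le_rfl
  · rw [Prod.Lex.toLex_le_toLex]
    rcases (ξ.rowOf_mono hab).lt_or_eq with h | h
    · exact Or.inl h
    · exact Or.inr ⟨h, OrderDual.toDual_le_toDual.2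
        (ν.rowOf_mono (decr_of_simple ξ.rowOf_mono hw.2 hlt h).le)⟩

theorem IsTop.monotone_row {ν ξ : SComp m n r} {w : Perm (Fin r)} (hw : IsTop ν ξ w) :
    Monotone fun k => toLex (ν.rowOf k, OrderDual.toDual (w⁻¹ k)) := by
  intro a b hab
  rcases hab.eq_or_lt with rfl | hlt
  · exact le_rfl
  · rw [Prod.Lex.toLex_le_toLex]
    rcases (ν.rowOf_mono hab).lt_or_eq with h | h
    · exact Or.inl h
    · exact Or.inr ⟨h, OrderDual.toDual_le_toDual.2
        (decr_of_simple (w := w⁻¹) ν.rowOf_mono hw.1 hlt h).le⟩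

/-- Uniqueness of a sorted rearrangement, used twice. Without ascents, the rows of the `w k` are
sorted decreasingly within each column, so the matrix determines the row of every `w k`; then `w⁻¹`
is sorted decreasingly within each row, which determines it. -/
theorem IsTop.eq {ν ξ : SComp m n r} {w w' : Perm (Fin r)} (hw : IsTop ν ξ w)
    (hw' : IsTop ν ξ w') (h : matOf ν ξ w = matOf ν ξ w') : w = w' := by
  obtain ⟨x, hx, y, hy, hxy⟩ := (matOf_eq_iff ν ξ w w').1 h
  rw [SComp.mem_young] at hx hy
  have hx' := fun k => congrFun hx k
  have hy' := fun k => congrFun hy k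
  simp only [Function.comp_apply] at hx' hy'
  have e1 := hw'.monotone_col
  simp only [hxy, Perm.mul_apply, hx'] at e1
  have h1 := Tuple.unique_monotone (f := fun k => toLex (ξ.rowOf k,
    OrderDual.toDual (ν.rowOf (w k)))) (σ := 1) (τ := y) hw.monotone_col
    (by simpa [Function.comp_def, hy'] using e1)
  have h2 : ∀ k, ν.rowOf (w k) = ν.rowOf (w' k) := fun k => by
    have := congrFun h1 k
    simp only [Function.comp_apply, Perm.one_apply, toLex_inj, Prod.mk.injEq,
      OrderDual.toDual_inj] at this
    rw [this.2, hxy, Perm.mul_apply, Perm.mul_apply, hx']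
  have e2 := hw'.monotone_row
  have h3 := Tuple.unique_monotone (f := fun k => toLex (ν.rowOf k,
    OrderDual.toDual (w⁻¹ k))) (σ := 1) (τ := w * w'⁻¹) hw.monotone_row
    (by simpa [Function.comp_def, h2] using e2)
  refine inv_injective (Equiv.ext fun k => ?_)
  have := congrFun h3 k
  simp only [Function.comp_apply, Perm.one_apply, toLex_inj, Prod.mk.injEq,
    OrderDual.toDual_inj] at this
  rw [this.2]
  simp

theorem SMat.wPlus_isTop (A : SMat m n r) : IsTop A.ro A.co A.wPlus := by
  constructor
  · intro i h hc
    have h1 := A.len_le_wPlus ((A.mul_mem_perms (A.ro.simple_mem_young h)).2 A.wPlus_mem)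
    rw [len_simple_mul i _ hc] at h1
    omega
  · intro i h hc
    have h1 := A.len_le_wPlus ((A.mem_perms_mul (A.co.simple_mem_young h)).2 A.wPlus_mem)
    rw [len_mul_simple i _ hc] at h1
    omega

/-- A property preserved by ascending steps in a double coset passes to its longest element. -/
theorem SMat.climb (A : SMat m n r) {Q : Perm (Fin r) → Prop} {w : Perm (Fin r)}
    (hw : w ∈ A.perms) (h : Q w)
    (left : ∀ i w, w ∈ A.perms → A.ro.rowOf (lo i) = A.ro.rowOf (hi i) → LeftAsc i w → Q w →
      Q (simple i * w))
    (right : ∀ i w, w ∈ A.perms → A.co.rowOf (lo i) = A.co.rowOf (hi i) → RightAsc i w → Q w →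
      Q (w * simple i)) : Q A.wPlus := by
  classical
  -- An element of maximal length among those with `Q` admits no ascending step inside the double
  -- coset, and the element without ascents is unique.
  obtain ⟨u, hu, hmax⟩ := (A.perms.filter Q).exists_max_image len
    ⟨w, Finset.mem_filter.2 ⟨hw, h⟩⟩
  rw [Finset.mem_filter] at hu
  have htop : IsTop A.ro A.co u := by
    constructor
    · intro i hi' hc
      have := hmax (simple i * u) (Finset.mem_filter.2
        ⟨(A.mul_mem_perms (A.ro.simple_mem_young hi')).2 hu.1, left i u hu.1 hi' hc hu.2⟩)
      rw [len_simple_mul i _ hc] at this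
      omega
    · intro i hi' hc
      have := hmax (u * simple i) (Finset.mem_filter.2
        ⟨(A.mem_perms_mul (A.co.simple_mem_young hi')).2 hu.1, right i u hu.1 hi' hc hu.2⟩)
      rw [len_mul_simple i _ hc] at this
      omega
  have : u = A.wPlus := by
    refine htop.eq A.wPlus_isTop ?_
    funext i j
    rw [(A.mem_perms u).1 hu.1, (A.mem_perms _).1 A.wPlus_mem]
  exact this ▸ hu.2

theorem SMat.bruhatLE_wPlus (A : SMat m n r) {w : Perm (Fin r)} (hw : w ∈ A.perms) :
    bruhatLE w A.wPlus := by
  refine A.climb (Q := fun u => bruhatLE w u) hw .refl ?_ ?_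
  · intro i u _ _ h hu
    exact Relation.ReflTransGen.trans hu (bruhatLE_simple_mul i u h)
  · intro i u _ _ h hu
    exact Relation.ReflTransGen.trans hu (bruhatLE_mul_simple i u h)

/-! Inversions by kind. -/

open Classical in
/-- The kind of a pair of points: the parity of a common column, or of a common row. -/
noncomputable def kind (ν ξ : SComp m n r) (a b x y : Fin r) : Option (ZMod 2) :=
  if ξ.rowOf a = ξ.rowOf b then some (idxParity (ξ.rowOf a))
  else if ν.rowOf x = ν.rowOf y then some (idxParity (ν.rowOf x)) else none

/-- The number of inversions of a given kind. -/
noncomputable def kindCount (ν ξ : SComp m n r) (t : Option (ZMod 2)) (w : Perm (Fin r)) : ℕ :=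
  invCount (fun a b x y => kind ν ξ a b x y = t) w

theorem len_eq_kindCount (ν ξ : SComp m n r) (w : Perm (Fin r)) :
    len w = kindCount ν ξ none w + kindCount ν ξ (some 0) w + kindCount ν ξ (some 1) w := by
  classical
  rw [len, Finset.card_eq_sum_card_fiberwise
    (f := fun p : Fin r × Fin r => kind ν ξ p.1 p.2 (w p.1) (w p.2)) (t := Finset.univ)
    (fun _ _ => Finset.mem_coe.2 (Finset.mem_univ _)), Fintype.sum_option,
    show (Finset.univ : Finset (ZMod 2)) = {0, 1} from rfl, Finset.sum_pair (by decide),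
    ← add_assoc]
  simp only [kindCount, invCount, Finset.filter_filter, and_assoc]

-- `s_i` preserves the columns, so the other pairs keep their kind, and the one new inversion lies
-- inside the column of `i`.
open Classical in
theorem kindCount_mul_simple (ν ξ : SComp m n r) (t : Option (ZMod 2)) (w : Perm (Fin r))
    (i : Fin (r - 1)) (hi' : ξ.rowOf (lo i) = ξ.rowOf (hi i)) (h : RightAsc i w) :
    kindCount ν ξ t (w * simple i) =
      kindCount ν ξ t w + if some (idxParity (ξ.rowOf (lo i))) = t then 1 else 0 := by
  have hs := fun k => congrFun (comp_simple hi') k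
  simp only [Function.comp_apply] at hs
  rw [kindCount, invCount_mul_simple _ _ _ h (by simp [kind, hs]), kindCount]
  simp only [kind, hi', if_true]

-- The new inversion has both values in one row. Should its two points share a column as well, its
-- kind is defined by the column, and `SMat.parity_eq` identifies the parities.
open Classical in
theorem SMat.kindCount_simple_mul (A : SMat m n r) (t : Option (ZMod 2)) {w : Perm (Fin r)}
    (hw : w ∈ A.perms) (i : Fin (r - 1)) (hi' : A.ro.rowOf (lo i) = A.ro.rowOf (hi i))
    (h : LeftAsc i w) :
    kindCount A.ro A.co t (simple i * w) =
      kindCount A.ro A.co t w + if some (idxParity (A.ro.rowOf (lo i))) = t then 1 else 0 := by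
  have hs := fun k => congrFun (comp_simple hi') k
  simp only [Function.comp_apply] at hs
  rw [kindCount, invCount_simple_mul _ _ _ h (by simp [kind, hs]), kindCount]
  congr 2
  rw [kind]
  split_ifs with h1
  · rw [A.parity_eq hw (by simpa using (lo_lt_hi i).ne) h1 (by simpa using hi')]
    simp
  · rw [hi']
  · exact absurd hi'.symm ‹_›

theorem SMat.kindCount_simple_mul_of_ne (A : SMat m n r) {t : Option (ZMod 2)}
    {w : Perm (Fin r)} (hw : w ∈ A.perms) {i : Fin (r - 1)}
    (hi' : A.ro.rowOf (lo i) = A.ro.rowOf (hi i)) (ht : some (idxParity (A.ro.rowOf (lo i))) ≠ t) :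
    kindCount A.ro A.co t (simple i * w) = kindCount A.ro A.co t w := by
  by_cases h : LeftAsc i w
  · rw [A.kindCount_simple_mul t hw i hi' h, if_neg ht, add_zero]
  · have := A.kindCount_simple_mul t ((A.mul_mem_perms (A.ro.simple_mem_young hi')).2 hw) i hi'
      ((leftAsc_simple_mul i w).2 h)
    rw [simple_mul_simple_mul, if_neg ht, add_zero] at this
    exact this.symm

theorem kindCount_mul_simple_of_ne {ν ξ : SComp m n r} {t : Option (ZMod 2)}
    {w : Perm (Fin r)} {i : Fin (r - 1)}
    (hi' : ξ.rowOf (lo i) = ξ.rowOf (hi i)) (ht : some (idxParity (ξ.rowOf (lo i))) ≠ t) :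
    kindCount ν ξ t (w * simple i) = kindCount ν ξ t w := by
  by_cases h : RightAsc i w
  · rw [kindCount_mul_simple ν ξ t w i hi' h, if_neg ht, add_zero]
  · have := kindCount_mul_simple ν ξ t (w * simple i) i hi' ((rightAsc_mul_simple i w).2 h)
    rw [mul_simple_mul_simple, if_neg ht, add_zero] at this
    exact this.symm

theorem SMat.kindCount_factor_mul (A : SMat m n r) {p : ZMod 2} {t : Option (ZMod 2)}
    (ht : some p ≠ t) {w x : Perm (Fin r)} (hw : w ∈ A.perms) (hx : x ∈ A.ro.factor p) :
    kindCount A.ro A.co t (x * w) = kindCount A.ro A.co t w := by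
  refine stab_induction (A.ro.parityMap_mono p)
    (Q := fun x => kindCount A.ro A.co t (x * w) = kindCount A.ro A.co t w) ?_ ?_ x
    ((A.ro.mem_factor p x).1 hx)
  · rw [one_mul]
  · intro i x hi' hx _ ih
    obtain ⟨h1, h2⟩ := A.ro.parityMap_simple p hi'
    rw [mul_assoc, A.kindCount_simple_mul_of_ne _ h1 (by rwa [h2]), ih]
    exact (A.mul_mem_perms (A.ro.factor_le p ((A.ro.mem_factor p x).2 hx))).2 hw

theorem kindCount_mul_factor {ν ξ : SComp m n r} {p : ZMod 2} {t : Option (ZMod 2)}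
    (ht : some p ≠ t) (w : Perm (Fin r)) {y : Perm (Fin r)} (hy : y ∈ ξ.factor p) :
    kindCount ν ξ t (w * y) = kindCount ν ξ t w := by
  refine stab_induction (ξ.parityMap_mono p)
    (Q := fun y => ∀ w, kindCount ν ξ t (w * y) = kindCount ν ξ t w) ?_ ?_ y
    ((ξ.mem_factor p y).1 hy) w
  · simp
  · intro i x hi' hx _ ih w
    obtain ⟨h1, h2⟩ := ξ.parityMap_simple p hi'
    rw [← mul_assoc, ih, kindCount_mul_simple_of_ne h1 (by rwa [h2])]

theorem SMat.kindCount_none (A : SMat m n r) {w x y : Perm (Fin r)} (hw : w ∈ A.perms)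
    (hx : x ∈ A.ro.young) (hy : y ∈ A.co.young) :
    kindCount A.ro A.co none (x * w * y) = kindCount A.ro A.co none w := by
  obtain ⟨u, hu, v, hv, rfl⟩ := A.ro.exists_factor 0 hx
  obtain ⟨u', hu', v', hv', rfl⟩ := A.co.exists_factor 0 hy
  rw [← mul_assoc, kindCount_mul_factor (by simp) _ hv', kindCount_mul_factor (by simp) _ hu',
    mul_assoc, A.kindCount_factor_mul (by simp) _ hu, A.kindCount_factor_mul (by simp) hw hv]
  exact (A.mul_mem_perms (A.ro.factor_le _ hv)).2 hw

theorem SMat.kindCount_some_d (A : SMat m n r) (p : ZMod 2) :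
    kindCount A.ro A.co (some p) A.d = 0 := by
  rw [kindCount, invCount, Finset.card_eq_zero, Finset.eq_empty_iff_forall_notMem]
  rintro ⟨a, b⟩ h
  simp only [Finset.mem_filter, Finset.mem_univ, true_and] at h
  obtain ⟨h1, h2, h3⟩ := h
  rw [kind] at h3
  split_ifs at h3 with h4 h5
  · exact absurd h2 (not_lt.2 (A.d_incrOn a b h1 h4).le)
  · have := A.d_inv_incrOn _ _ h2 h5.symm
    exact absurd h1 (not_lt.2 (by simpa using this.le))

theorem SMat.kindCount_none_d (A : SMat m n r) : kindCount A.ro A.co none A.d = len A.d := by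
  rw [len_eq_kindCount A.ro A.co, A.kindCount_some_d, A.kindCount_some_d, add_zero, add_zero]

/-- The number of inversions of kind `none` is constant on the double coset, and the shortest
element has no others. -/
theorem SMat.len_eq (A : SMat m n r) {w : Perm (Fin r)} (hw : w ∈ A.perms) :
    len w = len A.d + kindCount A.ro A.co (some 0) w + kindCount A.ro A.co (some 1) w := by
  obtain ⟨x, hx, y, hy, rfl⟩ := (A.mem_perms_iff A.d_mem w).1 hw
  rw [len_eq_kindCount A.ro A.co, A.kindCount_none A.d_mem hx hy, A.kindCount_none_d]

theorem SMat.kindCount_le_wPlus (A : SMat m n r) (t : Option (ZMod 2)) {w : Perm (Fin r)}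
    (hw : w ∈ A.perms) : kindCount A.ro A.co t w ≤ kindCount A.ro A.co t A.wPlus := by
  refine A.climb (Q := fun u => kindCount A.ro A.co t w ≤ kindCount A.ro A.co t u) hw le_rfl ?_ ?_
  · intro i u hu hi' h hle
    rw [A.kindCount_simple_mul t hu i hi' h]
    omega
  · intro i u hu hi' h hle
    rw [kindCount_mul_simple _ _ t u i hi' h]
    omega

/-- Multiplying `d` by elements of the factors of parity `p` creates no inversion of the other
parity, so length measures kind `p` alone. Splitting `w⁺ = v (u d u') v'` into parities shows that
`u d u'` has as many inversions of kind `p` as `w⁺`. -/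
theorem SMat.maxLen_dcoset (A : SMat m n r) (p : ZMod 2) :
    maxLen (dcoset (A.ro.factor p) (A.co.factor p) A.d) =
      len A.d + kindCount A.ro A.co (some p) A.wPlus := by
  have hne := (parity_ne_add_one p).symm
  have key : ∀ x ∈ A.ro.factor p, ∀ y ∈ A.co.factor p, x * A.d * y ∈ A.perms ∧
      len (x * A.d * y) = len A.d + kindCount A.ro A.co (some p) (x * A.d * y) := by
    intro x hx y hy
    have h1 : x * A.d ∈ A.perms := (A.mul_mem_perms (A.ro.factor_le p hx)).2 A.d_mem
    have h2 : x * A.d * y ∈ A.perms := (A.mem_perms_mul (A.co.factor_le p hy)).2 h1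
    have h3 : kindCount A.ro A.co (some (p + 1)) (x * A.d * y) = 0 := by
      rw [kindCount_mul_factor (by simp) _ hy,
        A.kindCount_factor_mul (by simp) A.d_mem hx, A.kindCount_some_d]
    refine ⟨h2, ?_⟩
    rw [A.len_eq h2]
    rcases parity_eq_zero_or_one p with rfl | rfl
    · rw [zero_add] at h3
      rw [h3, add_zero]
    · rw [show (1 + 1 : ZMod 2) = 0 from rfl] at h3
      rw [h3, add_zero]
  apply le_antisymm
  · refine Finset.sup_le fun w hw => ?_
    obtain ⟨x, hx, y, hy, rfl⟩ := mem_dcoset.1 hw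
    obtain ⟨h1, h2⟩ := key x hx y hy
    rw [h2]
    exact Nat.add_le_add_left (A.kindCount_le_wPlus _ h1) _
  · obtain ⟨x, hx, y, hy, hxy⟩ := (A.mem_perms_iff A.d_mem A.wPlus).1 A.wPlus_mem
    obtain ⟨u, hu, v, hv, rfl⟩ := A.ro.exists_factor p hx
    obtain ⟨u', hu', v', hv', rfl⟩ := A.co.exists_factor p hy
    obtain ⟨h1, h2⟩ := key u hu u' hu'
    have h3 : A.wPlus = v * (u * A.d * u') * v' := by
      rw [hxy, A.ro.factor_commute p hu hv]
      group
    have h4 : kindCount A.ro A.co (some p) A.wPlus =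
        kindCount A.ro A.co (some p) (u * A.d * u') := by
      rw [h3, kindCount_mul_factor (by simp) _ hv',
        A.kindCount_factor_mul (by simp) h1 hv]
    rw [h4, ← h2]
    exact Finset.le_sup (f := len) (mem_dcoset.2 ⟨u, hu, u', hu', rfl⟩)

/-- With `k` the odd count of `w⁺`, the factor `(-q)^{-k}` of its coefficient cancels `v^{2k}` up to
sign, leaving `± v^{-l(w⁺)}`. -/
theorem SMat.exponent_eq (A : SMat m n r) :
    -(A.lenEven : ℤ) + A.lenOdd - len A.d =
      2 * kindCount A.ro A.co (some 1) A.wPlus - len A.wPlus := by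
  have h0 := A.maxLen_dcoset 0
  have h1 := A.maxLen_dcoset 1
  rw [SComp.factor_zero, SComp.factor_zero] at h0
  rw [SComp.factor_one, SComp.factor_one] at h1
  have h2 := A.len_eq A.wPlus_mem
  rw [SMat.lenEven, SMat.lenOdd, h0, h1]
  push_cast [h2]
  ring

/-! Shortest representatives. -/

theorem SMat.mem_stab (A : SMat m n r) (z : Perm (Fin r)) :
    z ∈ A.stab ↔ (∀ k, A.ro.rowOf (A.d (z k)) = A.ro.rowOf (A.d k)) ∧ z ∈ A.co.young := by
  rw [SMat.stab, Subgroup.mem_inf, Subgroup.mem_comap, SComp.mem_young]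
  refine and_congr_left fun _ => ?_
  rw [funext_iff]
  constructor
  · intro h k
    simpa using h (A.d k)
  · intro h k
    simpa using h (A.d⁻¹ k)

/-- `A.stab` is the stabilizer of `k ↦ (column of k, row of d k)`, which is monotone since `d`
increases along columns; so `y⁻¹` increases on its fibres. Points in different columns keep their
order under `y⁻¹`, which preserves the columns. Hence `d y` is shortest in its coset. -/
theorem SMat.incrOn_of_minReps (A : SMat m n r) {y : Perm (Fin r)} (hy : y ∈ A.co.young)
    (h : y ∈ minReps A.stab) : IncrOn A.ro.rowOf (A.d * y)⁻¹ := by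
  rw [mem_minReps] at h
  have hmono : Monotone fun k => toLex (A.co.rowOf k, A.ro.rowOf (A.d k)) := by
    intro a b hab
    rcases hab.eq_or_lt with rfl | hlt
    · exact le_rfl
    · rw [Prod.Lex.toLex_le_toLex]
      rcases (A.co.rowOf_mono hab).lt_or_eq with h | h
      · exact Or.inl h
      · exact Or.inr ⟨h, A.ro.rowOf_mono (A.d_incrOn a b hlt h).le⟩
  have hincr : IncrOn (fun k => toLex (A.co.rowOf k, A.ro.rowOf (A.d k))) y⁻¹ := by
    refine incrOn_of_simple hmono fun i hi' => ?_
    by_contra hc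
    have h1 := comp_simple (c := fun k => toLex (A.co.rowOf k, A.ro.rowOf (A.d k))) hi'
    have h2 : simple i ∈ A.stab := by
      rw [A.mem_stab, SComp.mem_young, funext_iff, ← forall_and]
      intro k
      have := congrFun h1 k
      simp only [Function.comp_apply, toLex_inj, Prod.mk.injEq] at this
      exact ⟨this.2, this.1⟩
    have h3 := h _ h2
    have h4 := len_simple_mul_lt i y (by rwa [← leftAsc_inv, inv_inv] at hc)
    omega
  intro a b hab hrow
  have h1 := A.d_inv_incrOn a b hab hrow
  rw [mul_inv_rev, Perm.mul_apply, Perm.mul_apply]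
  by_cases h2 : A.co.rowOf (A.d⁻¹ a) = A.co.rowOf (A.d⁻¹ b)
  · refine hincr _ _ h1 ?_
    simpa [hrow] using h2
  · have hy' := fun k => congrFun (comp_inv ((A.co.mem_young y).1 hy)) k
    simp only [Function.comp_apply] at hy'
    by_contra hc
    have h3 := A.co.rowOf_mono (not_lt.1 hc)
    rw [hy', hy'] at h3
    exact h2 (le_antisymm (A.co.rowOf_mono h1.le) h3)

/-- Write `w = x d y`. Replacing `y` by the shortest element of its coset of `A.stab` changes only
the left factor, which is then trivial because both `w` and `d y` are shortest. -/
theorem SMat.exists_minReps (A : SMat m n r) {w : Perm (Fin r)} (hw : w ∈ A.perms)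
    (hincr : IncrOn A.ro.rowOf w⁻¹) :
    ∃ y ∈ A.co.young, y ∈ minReps A.stab ∧ w = A.d * y := by
  obtain ⟨x, hx, y, hy, hxy⟩ := (A.mem_perms_iff A.d_mem w).1 hw
  obtain ⟨z, hz, hmin⟩ := (elts A.stab).exists_min_image (fun z => len (z * y))
    ⟨1, mem_elts.2 (one_mem _)⟩
  rw [mem_elts] at hz
  have hzy : z * y ∈ A.co.young := mul_mem ((A.mem_stab z).1 hz).2 hy
  have hrep : z * y ∈ minReps A.stab := by
    rw [mem_minReps]
    intro z' hz'
    rw [← mul_assoc]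
    exact hmin (z' * z) (mem_elts.2 (mul_mem hz' hz))
  refine ⟨z * y, hzy, hrep, ?_⟩
  have h1 : w = (x * (A.d * z⁻¹ * A.d⁻¹)) * (A.d * (z * y)) := by
    rw [hxy]
    group
  have h2 : x * (A.d * z⁻¹ * A.d⁻¹) ∈ A.ro.young := by
    refine mul_mem hx ?_
    have h := ((A.mem_stab _).1 (inv_mem hz)).1
    rw [SComp.mem_young]
    ext k
    have := h (A.d⁻¹ k)
    simp only [Function.comp_apply, Perm.mul_apply]
    rw [this]
    simp
  have h3 := eq_one_of_incrOn A.ro.rowOf_mono ((A.ro.mem_young _).1 h2)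
    (A.incrOn_of_minReps hzy hrep) (by rwa [← h1])
  rwa [h3, one_mul] at h1

end Combinatorics

end QSuper

/-! ### Eigenvectors for the simple transpositions of Young subgroups -/

namespace QSuper

open Equiv (Perm)
open Hecke (coeff)

variable {m n r : ℕ}

/-- The eigenvalue of `T_s`, for `s` of parity `p`. -/
noncomputable def eigval (p : ZMod 2) : Zv := if p = 0 then qq else -1

theorem eigval_zero : eigval 0 = qq := if_pos rfl

theorem eigval_one : eigval 1 = -1 := if_neg one_ne_zero

theorem eigval_sq (p : ZMod 2) : eigval p * eigval p = (qq - 1) * eigval p + qq := by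
  rcases parity_eq_zero_or_one p with rfl | rfl
  · rw [eigval_zero]
    ring
  · rw [eigval_one]
    ring

theorem eigval_ne_zero (p : ZMod 2) : eigval p ≠ 0 := by
  rcases parity_eq_zero_or_one p with rfl | rfl
  · rw [eigval_zero]
    exact vpow_ne_zero _
  · rw [eigval_one]
    exact neg_ne_zero.2 one_ne_zero

theorem eig_step_ne_zero (p : ZMod 2) : vpow (-2) * eigval p ≠ 0 :=
  mul_ne_zero (vpow_ne_zero _) (eigval_ne_zero p)

/-- The two ratios are `1` and `-v⁻²`, and `1 + v⁻² ≠ 0`. -/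
theorem eig_step_sub_ne_zero {p p' : ZMod 2} (h : p + p' = 1) :
    vpow (-2) * eigval p - vpow (-2) * eigval p' ≠ 0 := by
  have key : (1 + vpow (-2) : Zv) ≠ 0 := by
    intro h
    have := congrArg (fun f : Zv => f.coeff 0) h
    rw [← vpow_zero] at this
    simp [LaurentPolynomial.T_apply] at this
  rcases parity_eq_zero_or_one p with rfl | rfl <;>
    rcases parity_eq_zero_or_one p' with rfl | rfl
  · exact absurd h (by decide)
  · rw [eigval_zero, eigval_one, qinv_mul_qq]
    simpa using key
  · rw [eigval_zero, eigval_one, qinv_mul_qq]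
    rw [← neg_ne_zero]
    simpa [sub_eq_add_neg, add_comm] using key
  · exact absurd h (by decide)

theorem negqPow_step (k : ℕ) (p : ZMod 2) :
    negqPow (k + if some p = some 1 then 1 else 0) = vpow (-2) * eigval p * negqPow k := by
  rcases parity_eq_zero_or_one p with rfl | rfl
  · rw [eigval_zero, qinv_mul_qq, one_mul, if_neg (by decide), add_zero]
  · rw [eigval_one, if_pos rfl, negqPow_succ, mul_neg_one]

-- On each pair `{w, σ w}` the eigenvector equation amounts to a fixed ratio of the two
-- coefficients. The equation at the descent follows from that at the ascent, because the eigenvalue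
-- is a root of `X² = (q - 1) X + q`.
open Classical in
theorem eig_coeff_iff {σ : Perm (Fin r) → Perm (Fin r)} (hσ : Function.Involutive σ)
    {A : Perm (Fin r) → Prop} (hA : ∀ w, A (σ w) ↔ ¬ A w) (p : ZMod 2) (c : Perm (Fin r) → Zv) :
    (∀ w, (if A w then qq * c (σ w) else c (σ w) + (qq - 1) * c w) = eigval p * c w) ↔
      ∀ w, A w → c (σ w) = vpow (-2) * eigval p * c w := by
  constructor
  · intro h w hw
    have := h w
    rw [if_pos hw] at this
    rw [mul_assoc, ← this, ← mul_assoc, qinv_mul_qq, one_mul]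
  · intro h w
    split_ifs with hw
    · rw [h w hw, ← mul_assoc, ← mul_assoc, qq_mul_qinv, one_mul]
    · have h1 := h (σ w) ((hA w).2 hw)
      rw [hσ] at h1
      have h2 : c (σ w) = (eigval p * eigval p - (qq - 1) * eigval p) * vpow (-2) * c (σ w) := by
        rw [eigval_sq, add_sub_cancel_left, qq_mul_qinv, one_mul]
      rw [h1]
      linear_combination h2

theorem simple_mul_eq_iff (i : Fin (r - 1)) (p : ZMod 2) (z : Hecke r) :
    Hecke.T (simple i) * z = eigval p • z ↔
      ∀ w, LeftAsc i w → coeff (simple i * w) z = vpow (-2) * eigval p * coeff w z := by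
  classical
  rw [← eig_coeff_iff (σ := fun w => simple i * w) (simple_mul_simple_mul i)
    (leftAsc_simple_mul i) p (fun w => coeff w z)]
  simp only [← Hecke.coeff_simple_mul]
  constructor
  · intro h w
    rw [h, map_smul, smul_eq_mul]
  · intro h
    refine Hecke.ext_coeff fun w => ?_
    rw [h, map_smul, smul_eq_mul]

theorem mul_simple_eq_iff (i : Fin (r - 1)) (p : ZMod 2) (z : Hecke r) :
    z * Hecke.T (simple i) = eigval p • z ↔
      ∀ w, RightAsc i w → coeff (w * simple i) z = vpow (-2) * eigval p * coeff w z := by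
  classical
  rw [← eig_coeff_iff (σ := fun w => w * simple i) (mul_simple_mul_simple i)
    (rightAsc_mul_simple i) p (fun w => coeff w z)]
  simp only [← Hecke.coeff_mul_simple]
  constructor
  · intro h w
    rw [h, map_smul, smul_eq_mul]
  · intro h
    refine Hecke.ext_coeff fun w => ?_
    rw [h, map_smul, smul_eq_mul]

/-- Left eigenvectors for the simple transpositions of a Young subgroup. -/
noncomputable def leftEig (ν : SComp m n r) : Submodule Zv (Hecke r) where
  carrier := {z | ∀ i, ν.rowOf (lo i) = ν.rowOf (hi i) →
    Hecke.T (simple i) * z = eigval (idxParity (ν.rowOf (lo i))) • z}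
  zero_mem' i _ := by rw [mul_zero, smul_zero]
  add_mem' h1 h2 i hi' := by rw [mul_add, h1 i hi', h2 i hi', smul_add]
  smul_mem' c z h i hi' := by rw [mul_smul_comm, h i hi', smul_comm]

/-- Right eigenvectors for the simple transpositions of a Young subgroup. -/
noncomputable def rightEig (ξ : SComp m n r) : Submodule Zv (Hecke r) where
  carrier := {z | ∀ i, ξ.rowOf (lo i) = ξ.rowOf (hi i) →
    z * Hecke.T (simple i) = eigval (idxParity (ξ.rowOf (lo i))) • z}
  zero_mem' i _ := by rw [zero_mul, smul_zero]
  add_mem' h1 h2 i hi' := by rw [add_mul, h1 i hi', h2 i hi', smul_add]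
  smul_mem' c z h i hi' := by rw [smul_mul_assoc, h i hi', smul_comm]

theorem mul_mem_leftEig {ν : SComp m n r} {z : Hecke r} (hz : z ∈ leftEig ν) (h : Hecke r) :
    z * h ∈ leftEig ν := fun i hi' => by
  rw [← mul_assoc, hz i hi', smul_mul_assoc]

/-- Neighbouring coefficients have a nonzero ratio in a domain, so a zero spreads over the whole
coset. -/
theorem coeff_eq_zero_of_leftEig {ν : SComp m n r} {z : Hecke r} (hz : z ∈ leftEig ν)
    {w x : Perm (Fin r)} (hx : x ∈ ν.young) (hw : coeff w z = 0) : coeff (x * w) z = 0 := by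
  refine stab_induction ν.rowOf_mono (Q := fun x => coeff (x * w) z = 0) ?_ ?_ x
    ((ν.mem_young x).1 hx)
  · rwa [one_mul]
  · intro i x hi' _ _ ih
    have h := (simple_mul_eq_iff i _ z).1 (hz i hi')
    rw [mul_assoc]
    by_cases ha : LeftAsc i (x * w)
    · rw [h _ ha, ih, mul_zero]
    · have := h _ ((leftAsc_simple_mul i _).2 ha)
      rw [simple_mul_simple_mul, ih] at this
      exact (mul_eq_zero.1 this.symm).resolve_left (eig_step_ne_zero _)

theorem coeff_eq_zero_of_rightEig {ξ : SComp m n r} {z : Hecke r} (hz : z ∈ rightEig ξ)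
    {w y : Perm (Fin r)} (hy : y ∈ ξ.young) (hw : coeff w z = 0) : coeff (w * y) z = 0 := by
  refine stab_induction ξ.rowOf_mono (Q := fun y => ∀ w, coeff w z = 0 → coeff (w * y) z = 0)
    ?_ ?_ y ((ξ.mem_young y).1 hy) w hw
  · simp
  · intro i y hi' _ _ ih w hw
    have h := (mul_simple_eq_iff i _ z).1 (hz i hi')
    rw [← mul_assoc]
    refine ih _ ?_
    by_cases ha : RightAsc i w
    · rw [h _ ha, hw, mul_zero]
    · have := h _ ((rightAsc_mul_simple i _).2 ha)
      rw [mul_simple_mul_simple, hw] at this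
      exact (mul_eq_zero.1 this.symm).resolve_left (eig_step_ne_zero _)

/-! The eigenvector supported on a double coset. -/

/-- The two-sided eigenvector supported on the double coset of a matrix. -/
noncomputable def SMat.eigvec (D : SMat m n r) : Hecke r :=
  ∑ w ∈ D.perms, negqPow (kindCount D.ro D.co (some 1) w) • Hecke.T w

open Classical in
theorem coeff_sum_smul_T (s : Finset (Perm (Fin r))) (f : Perm (Fin r) → Zv) (w : Perm (Fin r)) :
    coeff w (∑ u ∈ s, f u • Hecke.T u) = if w ∈ s then f w else 0 := by
  simp only [map_sum, map_smul, Hecke.coeff_T, smul_eq_mul, mul_ite, mul_one, mul_zero,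
    Finset.sum_ite_eq']

open Classical in
theorem SMat.coeff_eigvec (D : SMat m n r) (w : Perm (Fin r)) : coeff w D.eigvec =
    if w ∈ D.perms then negqPow (kindCount D.ro D.co (some 1) w) else 0 :=
  coeff_sum_smul_T _ _ _

/-- An ascending even step leaves the odd count unchanged and an odd one raises it by one, matching
the ratios `1` and `-q⁻¹`. -/
theorem SMat.eigvec_mem_leftEig (D : SMat m n r) : D.eigvec ∈ leftEig D.ro := by
  classical
  intro i hi'
  rw [simple_mul_eq_iff]
  intro w hw
  simp only [D.coeff_eigvec, D.mul_mem_perms (D.ro.simple_mem_young hi')]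
  split_ifs with h
  · rw [D.kindCount_simple_mul _ h i hi' hw, negqPow_step]
  · rw [mul_zero]

theorem SMat.eigvec_mem_rightEig (D : SMat m n r) : D.eigvec ∈ rightEig D.co := by
  classical
  intro i hi'
  rw [mul_simple_eq_iff]
  intro w hw
  simp only [D.coeff_eigvec, D.mem_perms_mul (D.co.simple_mem_young hi')]
  split_ifs with h
  · rw [kindCount_mul_simple _ _ _ _ i hi' hw, negqPow_step]
  · rw [mul_zero]

theorem SMat.coeff_eigvec_d (D : SMat m n r) : coeff D.d D.eigvec = 1 := by
  classical
  rw [D.coeff_eigvec, if_pos D.d_mem, D.kindCount_some_d, negqPow, pow_zero]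

theorem SComp.card_row (ν : SComp m n r) (k : Fin (m + n)) : (ν.row k).card = ν.1 k := by
  obtain ⟨e, he⟩ := ν.exists_equiv (fun i => Fin (ν.1 i)) (fun i => Fintype.card_fin _)
  have : ν.row k = (Finset.univ : Finset (Fin (ν.1 k))).map
      ⟨fun x => e ⟨k, x⟩, fun a b h => by simpa using h⟩ := by
    ext y
    obtain ⟨⟨j, x⟩, rfl⟩ := e.surjective y
    rw [he, Finset.mem_map]
    constructor
    · rintro rfl
      exact ⟨x, Finset.mem_univ _, rfl⟩
    · rintro ⟨z, -, hz⟩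
      have : (⟨k, z⟩ : Σ i, Fin (ν.1 i)) = ⟨j, x⟩ := e.injective hz
      exact (congrArg Sigma.fst this).symm
  rw [this, Finset.card_map, Finset.card_univ, Fintype.card_fin]

theorem SComp.card_rowOf (ν : SComp m n r) (k : Fin (m + n)) :
    (Finset.univ.filter fun x => ν.rowOf x = k).card = ν.1 k := by
  rw [← ν.card_row]
  congr 1
  ext x
  simp [SComp.mem_row]

theorem sum_matOf_row (ν ξ : SComp m n r) (w : Perm (Fin r)) (i : Fin (m + n)) :
    ∑ j, matOf ν ξ w i j = ν.1 i := by
  classical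
  rw [← ν.card_rowOf, ← Finset.card_map w.symm.toEmbedding,
    Finset.card_eq_sum_card_fiberwise (f := ξ.rowOf) (t := Finset.univ)
      (fun _ _ => Finset.mem_coe.2 (Finset.mem_univ _))]
  refine Finset.sum_congr rfl fun j _ => ?_
  rw [matOf_eq]
  congr 1
  ext k
  simp only [Finset.mem_filter, Finset.mem_univ, true_and, Prod.mk.injEq, Finset.mem_map_equiv,
    Equiv.symm_symm]

theorem sum_matOf_col (ν ξ : SComp m n r) (w : Perm (Fin r)) (j : Fin (m + n)) :
    ∑ i, matOf ν ξ w i j = ξ.1 j := by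
  classical
  rw [← ξ.card_rowOf,
    Finset.card_eq_sum_card_fiberwise (f := fun k => ν.rowOf (w k)) (t := Finset.univ)
      (fun _ _ => Finset.mem_coe.2 (Finset.mem_univ _))]
  refine Finset.sum_congr rfl fun i _ => ?_
  rw [matOf_eq]
  congr 1
  ext k
  simp only [Finset.mem_filter, Finset.mem_univ, true_and, Prod.mk.injEq, and_comm]

theorem exists_mem_perms (ν ξ : SComp m n r) (w : Perm (Fin r))
    (h : ∀ i j, idxParity i + idxParity j = 1 → matOf ν ξ w i j ≤ 1) :
    ∃ D : SMat m n r, D.ro = ν ∧ D.co = ξ ∧ w ∈ D.perms := by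
  let D : SMat m n r := ⟨matOf ν ξ w, by simp only [sum_matOf_row]; exact ν.2, h⟩
  have h1 : D.ro = ν := Subtype.ext (funext fun i => sum_matOf_row ν ξ w i)
  have h2 : D.co = ξ := Subtype.ext (funext fun j => sum_matOf_col ν ξ w j)
  refine ⟨D, h1, h2, ?_⟩
  rw [D.mem_perms, h1, h2]
  exact fun _ _ => rfl

/-- In a double coset with a large entry of odd parity there is an element conjugating a simple
transposition to one of the other parity. -/
theorem exists_simple_mul_eq_mul_simple {ν ξ : SComp m n r} {w : Perm (Fin r)}
    {k l : Fin (m + n)} (h : 1 < matOf ν ξ w k l) :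
    ∃ x ∈ ν.young, ∃ y ∈ ξ.young, ∃ i j, LeftAsc i (x * w * y) ∧ RightAsc j (x * w * y) ∧
      ν.rowOf (lo i) = k ∧ ν.rowOf (hi i) = k ∧ ξ.rowOf (lo j) = l ∧ ξ.rowOf (hi j) = l ∧
        simple i * (x * w * y) = x * w * y * simple j := by
  classical
  -- The witness is a shortest element, which increases along columns and whose inverse increases
  -- along rows.
  obtain ⟨d, hd, hmin⟩ := (dcoset ν.young ξ.young w).exists_min_image len (dcoset_nonempty _ _ _)
  obtain ⟨x, hx, y, hy, hxy⟩ := mem_dcoset.1 hd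
  have hmat := (matOf_eq_iff ν ξ w d).2 ⟨x, hx, y, hy, hxy⟩
  refine ⟨x, hx, y, hy, ?_⟩
  rw [← hxy]
  have hl : IncrOn ν.rowOf d⁻¹ := incrOn_of_simple ν.rowOf_mono fun i hi' => by
    by_contra hc
    have h1 := hmin (simple i * d) (mem_dcoset.2 ⟨simple i * x,
      mul_mem (ν.simple_mem_young hi') hx, y, hy, by rw [hxy]; group⟩)
    have h2 := len_simple_mul_lt i d (by rwa [← leftAsc_inv, inv_inv] at hc)
    omega
  have hr : IncrOn ξ.rowOf d := incrOn_of_simple ξ.rowOf_mono fun i hi' => by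
    by_contra hc
    have h1 := hmin (d * simple i) (mem_dcoset.2 ⟨x, hx, y * simple i,
      mul_mem hy (ξ.simple_mem_young hi'), by rw [hxy]; group⟩)
    have h2 := len_mul_simple i _ ((rightAsc_mul_simple i d).2 hc)
    rw [mul_simple_mul_simple] at h2
    omega
  rw [hmat, matOf_eq, Finset.one_lt_card] at h
  obtain ⟨a, ha, b, hb, hab⟩ := h
  simp only [Finset.mem_filter, Finset.mem_univ, true_and, Prod.mk.injEq] at ha hb
  wlog hlt : a < b generalizing a b
  · exact this b a hab.symm hb ha (lt_of_le_of_ne (not_lt.1 hlt) hab.symm)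
  have ha' : (a : ℕ) < r - 1 := by
    have := Fin.lt_def.1 hlt
    omega
  obtain ⟨j, hj⟩ : ∃ j : Fin (r - 1), a = lo j := ⟨⟨a, ha'⟩, rfl⟩
  subst hj
  have hjb : hi j ≤ b := by
    rw [Fin.le_def]
    exact Fin.lt_def.1 hlt
  have hj1 : ξ.rowOf (hi j) = l := le_antisymm (hb.2 ▸ ξ.rowOf_mono hjb)
    (ha.2 ▸ ξ.rowOf_mono (lo_lt_hi j).le)
  have hasc : RightAsc j d := hr _ _ (lo_lt_hi j) (ha.2.trans hj1.symm)
  have hdb : d (hi j) ≤ d b := by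
    rcases hjb.eq_or_lt with h | h
    · rw [h]
    · exact (hr _ _ h (hj1.trans hb.2.symm)).le
  have hj2 : ν.rowOf (d (hi j)) = k := le_antisymm (hb.1 ▸ ν.rowOf_mono hdb)
    (ha.1 ▸ ν.rowOf_mono (le_of_lt hasc))
  have ha2 : (d (lo j) : ℕ) < r - 1 := by
    have : (d (lo j) : ℕ) < d (hi j) := Fin.lt_def.1 hasc
    omega
  obtain ⟨i, hi'⟩ : ∃ i : Fin (r - 1), d (lo j) = lo i := ⟨⟨_, ha2⟩, rfl⟩
  have hle : hi i ≤ d (hi j) := by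
    have := Fin.lt_def.1 hasc
    rw [hi'] at this
    rw [Fin.le_def]
    exact this
  have hi1 : ν.rowOf (lo i) = k := by rw [← hi', ha.1]
  have hi2 : ν.rowOf (hi i) = k := le_antisymm (hj2 ▸ ν.rowOf_mono hle)
    (hi1 ▸ ν.rowOf_mono (lo_lt_hi i).le)
  -- A value strictly between `d j` and `d (j+1)` would be the image of a point strictly between `j`
  -- and `j+1`.
  have hi3 : hi i = d (hi j) := by
    by_contra hne
    have h1 := hl _ _ (lo_lt_hi i) (hi1.trans hi2.symm)
    have h2 := hl _ _ (lt_of_le_of_ne hle hne) (hi2.trans hj2.symm)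
    rw [← hi'] at h1
    simp only [Perm.inv_def, Equiv.symm_apply_apply] at h1 h2
    have h1' := Fin.lt_def.1 h1
    have h2' := Fin.lt_def.1 h2
    simp only [lo, hi] at h1' h2'
    omega
  refine ⟨i, j, hl _ _ (lo_lt_hi i) (hi1.trans hi2.symm), hasc, hi1, hi2, ha.2, hj1, ?_⟩
  rw [simple, ← hi', hi3, simple, Equiv.mul_swap_eq_swap_mul]

/-- At an element with `s w = w s'` and `s`, `s'` of opposite parity, the left and right equations
give the same coefficient two different ratios. -/
theorem coeff_eq_zero_of_matOf {ν ξ : SComp m n r} {z : Hecke r} (hl : z ∈ leftEig ν)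
    (hr : z ∈ rightEig ξ) {w : Perm (Fin r)} {k l : Fin (m + n)}
    (hkl : idxParity k + idxParity l = 1) (h : 1 < matOf ν ξ w k l) : coeff w z = 0 := by
  obtain ⟨x, hx, y, hy, i, j, hi', hj, h1, h2, h3, h4, h5⟩ := exists_simple_mul_eq_mul_simple h
  have e1 := (simple_mul_eq_iff i _ z).1 (hl i (h1.trans h2.symm)) _ hi'
  have e2 := (mul_simple_eq_iff j _ z).1 (hr j (h3.trans h4.symm)) _ hj
  rw [h5, e2, h1, h3, ← sub_eq_zero, ← sub_mul] at e1
  have e3 := (mul_eq_zero.1 e1).resolve_left (eig_step_sub_ne_zero (by rw [add_comm, hkl]))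
  have e4 := coeff_eq_zero_of_rightEig hr (inv_mem hy)
    (coeff_eq_zero_of_leftEig hl (inv_mem hx) e3)
  rwa [show x⁻¹ * (x * w * y) * y⁻¹ = w by group] at e4

open Classical in
/-- The eigenvectors of the double cosets span the two-sided eigenvectors. -/
theorem eq_sum_eigvec {ν ξ : SComp m n r} {z : Hecke r} (hl : z ∈ leftEig ν)
    (hr : z ∈ rightEig ξ) :
    z = ∑ D : SMat m n r with D.ro = ν ∧ D.co = ξ, coeff D.d z • D.eigvec := by
  refine Hecke.ext_coeff fun w => ?_
  rw [map_sum]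
  by_cases hw : ∀ i j, idxParity i + idxParity j = 1 → matOf ν ξ w i j ≤ 1
  · obtain ⟨D, rfl, rfl, hD⟩ := exists_mem_perms ν ξ w hw
    rw [Finset.sum_eq_single D]
    · have h1 : z - coeff D.d z • D.eigvec ∈ leftEig D.ro :=
        sub_mem hl (Submodule.smul_mem _ _ D.eigvec_mem_leftEig)
      have h2 : z - coeff D.d z • D.eigvec ∈ rightEig D.co :=
        sub_mem hr (Submodule.smul_mem _ _ D.eigvec_mem_rightEig)
      have h3 : coeff D.d (z - coeff D.d z • D.eigvec) = 0 := by
        rw [map_sub, map_smul, D.coeff_eigvec_d, smul_eq_mul, mul_one, sub_self]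
      obtain ⟨x, hx, y, hy, rfl⟩ := (D.mem_perms_iff D.d_mem w).1 hD
      have h4 := coeff_eq_zero_of_rightEig h2 hy (coeff_eq_zero_of_leftEig h1 hx h3)
      rwa [map_sub, sub_eq_zero] at h4
    · intro C hC hne
      rw [Finset.mem_filter] at hC
      rw [map_smul, C.coeff_eigvec, if_neg, smul_zero]
      exact fun h => hne (SMat.eq_of_mem_perms hC.2.1 hC.2.2 h hD)
    · intro h
      exact absurd (Finset.mem_filter.2 ⟨Finset.mem_univ _, rfl, rfl⟩) h
  · push Not at hw
    obtain ⟨i, j, hij, h⟩ := hw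
    rw [coeff_eq_zero_of_matOf hl hr hij h, Finset.sum_eq_zero]
    intro C hC
    obtain ⟨-, rfl, rfl⟩ := Finset.mem_filter.1 hC
    rw [map_smul, C.coeff_eigvec, if_neg, smul_zero]
    intro hw
    rw [(C.mem_perms w).1 hw] at h
    exact absurd (C.2.2 i j hij) (not_le.2 h)

end QSuper

/-! ### The elements `T_D` as eigenvectors -/

namespace QSuper

open Equiv (Perm)
open Hecke (coeff)

variable {m n r : ℕ}

theorem SComp.mem_elts_even (ν : SComp m n r) {w : Perm (Fin r)} :
    w ∈ elts ν.evenYoung ↔ w ∈ ν.factor 0 := by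
  rw [mem_elts, ν.factor_zero]

theorem SComp.mem_elts_odd (ν : SComp m n r) {w : Perm (Fin r)} :
    w ∈ elts ν.oddYoung ↔ w ∈ ν.factor 1 := by
  rw [mem_elts, ν.factor_one]

theorem T_mul_T_factor (ν : SComp m n r) (p : ZMod 2) {u v : Perm (Fin r)}
    (hu : u ∈ ν.factor p) (hv : v ∈ ν.factor (p + 1)) :
    Hecke.T u * Hecke.T v = Hecke.T (u * v) :=
  Hecke.T_mul_T u v (len_mul_of_incrOn (ν.parityMap_mono p)
    (ν.incrOn_factor p (inv_mem hv)) u ((ν.mem_factor p u).1 hu))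

theorem T_mul_T_factor_comm (ν : SComp m n r) (p : ZMod 2) {u v : Perm (Fin r)}
    (hu : u ∈ ν.factor p) (hv : v ∈ ν.factor (p + 1)) :
    Hecke.T u * Hecke.T v = Hecke.T v * Hecke.T u := by
  have hp : p + 1 + 1 = p := by rw [add_assoc, CharTwo.add_self_eq_zero, add_zero]
  rw [T_mul_T_factor ν p hu hv, T_mul_T_factor ν (p + 1) hv (hp.symm ▸ hu),
    ν.factor_commute p hu hv]

theorem SComp.x_mul_y_comm (ν : SComp m n r) : ν.x * ν.y = ν.y * ν.x := by
  simp only [SComp.x, SComp.y, Finset.sum_mul, Finset.mul_sum]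
  rw [Finset.sum_comm]
  refine Finset.sum_congr rfl fun u hu => Finset.sum_congr rfl fun v hv => ?_
  rw [mul_smul_comm, smul_mul_assoc, T_mul_T_factor_comm ν 0 (ν.mem_elts_even.1 hu)
    (ν.mem_elts_odd.1 hv)]

open Classical in
theorem SComp.coeff_x (ν : SComp m n r) (w : Perm (Fin r)) :
    coeff w ν.x = if w ∈ ν.factor 0 then 1 else 0 := by
  have h := coeff_sum_smul_T (elts ν.evenYoung) (fun _ => 1) w
  simp only [one_smul, ν.mem_elts_even] at h
  exact h

open Classical in
theorem SComp.coeff_y (ν : SComp m n r) (w : Perm (Fin r)) :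
    coeff w ν.y = if w ∈ ν.factor 1 then negqPow (len w) else 0 := by
  have h := coeff_sum_smul_T (elts ν.oddYoung) (fun w => negqPow (len w)) w
  simp only [ν.mem_elts_odd] at h
  exact h

theorem SComp.simple_mul_x (ν : SComp m n r) {i : Fin (r - 1)} (h : simple i ∈ ν.factor 0) :
    Hecke.T (simple i) * ν.x = eigval 0 • ν.x := by
  classical
  rw [simple_mul_eq_iff]
  intro w _
  simp only [ν.coeff_x, Subgroup.mul_mem_cancel_left _ h, eigval_zero, qinv_mul_qq, one_mul]

theorem SComp.x_mul_simple (ν : SComp m n r) {i : Fin (r - 1)} (h : simple i ∈ ν.factor 0) :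
    ν.x * Hecke.T (simple i) = eigval 0 • ν.x := by
  classical
  rw [mul_simple_eq_iff]
  intro w _
  simp only [ν.coeff_x, Subgroup.mul_mem_cancel_right _ h, eigval_zero, qinv_mul_qq, one_mul]

theorem SComp.simple_mul_y (ν : SComp m n r) {i : Fin (r - 1)} (h : simple i ∈ ν.factor 1) :
    Hecke.T (simple i) * ν.y = eigval 1 • ν.y := by
  classical
  rw [simple_mul_eq_iff]
  intro w hw
  simp only [ν.coeff_y, Subgroup.mul_mem_cancel_left _ h, len_simple_mul i w hw, negqPow_succ,
    eigval_one, mul_neg_one, mul_ite, mul_zero]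

theorem SComp.y_mul_simple (ν : SComp m n r) {i : Fin (r - 1)} (h : simple i ∈ ν.factor 1) :
    ν.y * Hecke.T (simple i) = eigval 1 • ν.y := by
  classical
  rw [mul_simple_eq_iff]
  intro w hw
  simp only [ν.coeff_y, Subgroup.mul_mem_cancel_right _ h, len_mul_simple i w hw, negqPow_succ,
    eigval_one, mul_neg_one, mul_ite, mul_zero]

theorem SComp.xy_mem_leftEig (ν : SComp m n r) : ν.x * ν.y ∈ leftEig ν := by
  intro i hi'
  have h := ν.simple_mem_factor hi'
  rcases parity_eq_zero_or_one (idxParity (ν.rowOf (lo i))) with hp | hp <;> rw [hp] at h ⊢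
  · rw [← mul_assoc, ν.simple_mul_x h, smul_mul_assoc]
  · rw [x_mul_y_comm, ← mul_assoc, ν.simple_mul_y h, smul_mul_assoc]

theorem SComp.xy_mem_rightEig (ν : SComp m n r) : ν.x * ν.y ∈ rightEig ν := by
  intro i hi'
  have h := ν.simple_mem_factor hi'
  rcases parity_eq_zero_or_one (idxParity (ν.rowOf (lo i))) with hp | hp <;> rw [hp] at h ⊢
  · rw [x_mul_y_comm, mul_assoc, ν.x_mul_simple h, mul_smul_comm]
  · rw [mul_assoc, ν.y_mul_simple h, mul_smul_comm]

open Classical in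
theorem SComp.xy_mul_T (ν : SComp m n r) {w : Perm (Fin r)} (hw : IncrOn ν.rowOf w⁻¹) :
    ν.x * ν.y * Hecke.T w = ∑ u ∈ elts ν.evenYoung, ∑ v ∈ elts ν.oddYoung,
      negqPow (len v) • Hecke.T (u * v * w) := by
  simp only [SComp.x, SComp.y, Finset.sum_mul, Finset.mul_sum]
  rw [Finset.sum_comm]
  refine Finset.sum_congr rfl fun u hu => Finset.sum_congr rfl fun v hv => ?_
  rw [ν.mem_elts_even] at hu
  rw [ν.mem_elts_odd] at hv
  rw [mul_smul_comm, smul_mul_assoc, T_mul_T_factor ν 0 hu hv, Hecke.T_mul_T]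
  exact len_mul_of_incrOn ν.rowOf_mono hw _
    ((ν.mem_young _).1 (mul_mem (ν.factor_le _ hu) (ν.factor_le _ hv)))

theorem SComp.eq_one_of_mul_eq_one (ν : SComp m n r) {u v : Perm (Fin r)} (hu : u ∈ ν.factor 0)
    (hv : v ∈ ν.factor 1) (h : u * v = 1) : u = 1 ∧ v = 1 := by
  have h1 : u = v⁻¹ := eq_inv_of_mul_eq_one_left h
  have h2 : u = 1 := ν.factor_disjoint 0 hu (h1 ▸ inv_mem hv)
  refine ⟨h2, ?_⟩
  rwa [h2, one_mul] at h

-- The product expands along the coset of `w`, whose only shortest element is `w` itself, coming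
-- from `u = v = 1`.
open Classical in
theorem SComp.coeff_xy_mul_T (ν : SComp m n r) {w w' : Perm (Fin r)} (hw : IncrOn ν.rowOf w⁻¹)
    (hw' : IncrOn ν.rowOf w'⁻¹) : coeff w' (ν.x * ν.y * Hecke.T w) = if w = w' then 1 else 0 := by
  have key : ∀ u ∈ elts ν.evenYoung, ∀ v ∈ elts ν.oddYoung, u * v * w = w' → u = 1 ∧ v = 1 := by
    intro u hu v hv h
    rw [ν.mem_elts_even] at hu
    rw [ν.mem_elts_odd] at hv
    exact ν.eq_one_of_mul_eq_one hu hv (eq_one_of_incrOn ν.rowOf_mono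
      ((ν.mem_young _).1 (mul_mem (ν.factor_le _ hu) (ν.factor_le _ hv))) hw (by rwa [h]))
  rw [ν.xy_mul_T hw]
  simp only [map_sum, map_smul, Hecke.coeff_T, smul_eq_mul]
  rw [Finset.sum_eq_single 1, Finset.sum_eq_single 1]
  · simp [len_one, negqPow]
  · intro v hv h1
    rw [if_neg, mul_zero]
    exact fun h => h1 (key 1 (mem_elts.2 (one_mem _)) v hv h).2
  · exact fun h => absurd (mem_elts.2 (one_mem _)) h
  · intro u hu h1
    refine Finset.sum_eq_zero fun v hv => ?_
    rw [if_neg, mul_zero]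
    exact fun h => h1 (key u hu v hv h).1
  · exact fun h => absurd (mem_elts.2 (one_mem _)) h

theorem SComp.exists_incrOn (ν : SComp m n r) (w : Perm (Fin r)) :
    ∃ x ∈ ν.young, IncrOn ν.rowOf (x * w)⁻¹ := by
  obtain ⟨x, hx, hmin⟩ := (elts ν.young).exists_min_image (fun x => len (x * w))
    ⟨1, mem_elts.2 (one_mem _)⟩
  rw [mem_elts] at hx
  refine ⟨x, hx, incrOn_of_simple ν.rowOf_mono fun i hi' => ?_⟩
  by_contra hc
  have h1 := hmin (simple i * x) (mem_elts.2 (mul_mem (ν.simple_mem_young hi') hx))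
  have h2 := len_simple_mul_lt i (x * w) (by rwa [← leftAsc_inv, inv_inv] at hc)
  rw [← mul_assoc] at h2
  omega

/-- Every coset contains a shortest element, and a left eigenvector is determined on the coset by
its coefficient there. -/
theorem eq_of_coeff_incrOn {ν : SComp m n r} {z z' : Hecke r} (hz : z ∈ leftEig ν)
    (hz' : z' ∈ leftEig ν) (h : ∀ w, IncrOn ν.rowOf w⁻¹ → coeff w z = coeff w z') : z = z' := by
  refine Hecke.ext_coeff fun w => ?_
  obtain ⟨x, hx, hw⟩ := ν.exists_incrOn w
  have := coeff_eq_zero_of_leftEig (sub_mem hz hz') (inv_mem hx)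
    (w := x * w) (by rw [map_sub, h _ hw, sub_self])
  rwa [inv_mul_cancel_left, map_sub, sub_eq_zero] at this

/-- The summands of `T_D`. -/
theorem SMat.T_d_mul (D : SMat m n r) {u v : Perm (Fin r)} (hu : u ∈ D.co.factor 0)
    (hv : v ∈ D.co.factor 1) : D.ro.x * D.ro.y * Hecke.T D.d * Hecke.T u * Hecke.T v =
      D.ro.x * D.ro.y * Hecke.T (D.d * (u * v)) := by
  rw [mul_assoc _ (Hecke.T u), T_mul_T_factor D.co 0 hu hv, mul_assoc, Hecke.T_mul_T D.d]
  exact len_mul_of_incrOn_right D.co.rowOf_mono D.d_incrOn _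
    ((D.co.mem_young _).1 (mul_mem (D.co.factor_le _ hu) (D.co.factor_le _ hv)))

theorem SMat.kindCount_d_mul (D : SMat m n r) {u v : Perm (Fin r)} (hu : u ∈ D.co.factor 0)
    (hv : v ∈ D.co.factor 1) : kindCount D.ro D.co (some 1) (D.d * (u * v)) = len v := by
  have hv' := D.co.factor_le _ hv
  have h1 : len (D.d * v) = len D.d + len v :=
    len_mul_of_incrOn_right D.co.rowOf_mono D.d_incrOn _ ((D.co.mem_young _).1 hv')
  rw [D.len_eq ((D.mem_perms_mul hv').2 D.d_mem), kindCount_mul_factor (by simp) D.d hv,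
    D.kindCount_some_d] at h1
  rw [D.co.factor_commute 0 hu hv, ← mul_assoc, kindCount_mul_factor (by simp) _ hu]
  omega

theorem SMat.TD_mem_leftEig (D : SMat m n r) : D.TD ∈ leftEig D.ro := by
  rw [SMat.TD]
  refine sum_mem fun u _ => sum_mem fun v _ => Submodule.smul_mem _ _ ?_
  rw [mul_assoc, mul_assoc]
  exact mul_mem_leftEig D.ro.xy_mem_leftEig _

/-- Both sides are left eigenvectors, so only coefficients at shortest coset elements matter. The
summand of `T_D` at `u`, `v` meets just one of these, `d u v`, whose odd count is `l(v)`. The right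
eigenvector property of `T_D` comes for free. -/
theorem SMat.TD_eq_eigvec (D : SMat m n r) : D.TD = D.eigvec := by
  classical
  refine eq_of_coeff_incrOn D.TD_mem_leftEig D.eigvec_mem_leftEig fun w hw => ?_
  have key : ∀ u ∈ elts D.co.evenYoung, ∀ v ∈ (elts D.co.oddYoung).filter
      (fun v => u * v ∈ minReps D.stab),
      coeff w (negqPow (len v) •
        (D.ro.x * D.ro.y * Hecke.T D.d * Hecke.T u * Hecke.T v)) =
      if D.d * (u * v) = w then negqPow (len v) else 0 := by
    intro u hu v hv
    rw [Finset.mem_filter, D.co.mem_elts_odd] at hv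
    rw [D.co.mem_elts_even] at hu
    rw [D.T_d_mul hu hv.1, map_smul, D.ro.coeff_xy_mul_T (D.incrOn_of_minReps
      (mul_mem (D.co.factor_le _ hu) (D.co.factor_le _ hv.1)) hv.2) hw, smul_eq_mul, mul_ite,
      mul_one, mul_zero]
  rw [D.coeff_eigvec, SMat.TD]
  simp only [map_sum]
  rw [Finset.sum_congr rfl fun u hu => Finset.sum_congr rfl fun v hv => key u hu v hv]
  split_ifs with hwD
  · obtain ⟨y, hy, hrep, rfl⟩ := D.exists_minReps hwD hw
    obtain ⟨u, hu, v, hv, rfl⟩ := D.co.exists_factor 0 hy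
    rw [zero_add] at hv
    have huniq : ∀ u' ∈ D.co.factor 0, ∀ v' ∈ D.co.factor 1,
        D.d * (u' * v') = D.d * (u * v) → u' = u ∧ v' = v := by
      intro u' hu' v' hv' h
      have h1 := mul_left_cancel h
      have h2 : (u⁻¹ * u') * (v' * v⁻¹) = 1 := by
        rw [mul_assoc, ← mul_assoc u', h1]
        group
      obtain ⟨h3, h4⟩ := D.co.eq_one_of_mul_eq_one (mul_mem (inv_mem hu) hu')
        (mul_mem hv' (inv_mem hv)) h2
      exact ⟨(inv_mul_eq_one.1 h3).symm, mul_inv_eq_one.1 h4⟩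
    rw [Finset.sum_eq_single u, Finset.sum_eq_single v, if_pos rfl, D.kindCount_d_mul hu hv]
    · intro v' hv' hne
      rw [Finset.mem_filter, D.co.mem_elts_odd] at hv'
      exact if_neg fun h => hne (huniq u hu v' hv'.1 h).2
    · intro h
      exact absurd (Finset.mem_filter.2 ⟨D.co.mem_elts_odd.2 hv, hrep⟩) h
    · intro u' hu' hne
      refine Finset.sum_eq_zero fun v' hv' => ?_
      rw [Finset.mem_filter, D.co.mem_elts_odd] at hv'
      exact if_neg fun h => hne (huniq u' (D.co.mem_elts_even.1 hu') v' hv'.1 h).1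
    · intro h
      exact absurd (D.co.mem_elts_even.2 hu) h
  · refine Finset.sum_eq_zero fun u hu => Finset.sum_eq_zero fun v hv => ?_
    rw [Finset.mem_filter, D.co.mem_elts_odd] at hv
    refine if_neg fun h => hwD ?_
    rw [← h, D.mem_perms_mul]
    · exact D.d_mem
    · exact mul_mem (D.co.factor_le _ (D.co.mem_elts_even.1 hu)) (D.co.factor_le _ hv.1)

/-- The exponent of `v` in the normalization of `T_D`. -/
noncomputable def SMat.expo (D : SMat m n r) : ℤ := -(D.lenEven : ℤ) + D.lenOdd - len D.d

theorem SMat.nTD_eq (D : SMat m n r) : D.nTD = vpow D.expo • D.eigvec := by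
  rw [SMat.nTD, D.TD_eq_eigvec, SMat.expo]

theorem SMat.nTD_mem_leftEig (D : SMat m n r) : D.nTD ∈ leftEig D.ro := by
  rw [D.nTD_eq]
  exact Submodule.smul_mem _ _ D.eigvec_mem_leftEig

theorem SMat.nTD_mem_rightEig (D : SMat m n r) : D.nTD ∈ rightEig D.co := by
  rw [D.nTD_eq]
  exact Submodule.smul_mem _ _ D.eigvec_mem_rightEig

open Classical in
theorem SMat.coeff_nTD (D : SMat m n r) (w : Perm (Fin r)) : coeff w D.nTD =
    if w ∈ D.perms then vpow D.expo * negqPow (kindCount D.ro D.co (some 1) w) else 0 := by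
  rw [D.nTD_eq, map_smul, D.coeff_eigvec, smul_eq_mul, mul_ite, mul_zero]

theorem SMat.isUnit_coeff_nTD (D : SMat m n r) {w : Perm (Fin r)} (hw : w ∈ D.perms) :
    IsUnit (coeff w D.nTD) := by
  classical
  rw [D.coeff_nTD, if_pos hw]
  exact (vpow_isUnit _).mul (negqPow_isUnit _)

/-- The coordinates of two-sided eigenvectors. -/
noncomputable def SMat.coord (D : SMat m n r) (z : Hecke r) : Zv :=
  vpow (-D.expo) * coeff D.d z

open Classical in
theorem eq_sum_nTD {ν ξ : SComp m n r} {z : Hecke r} (hl : z ∈ leftEig ν)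
    (hr : z ∈ rightEig ξ) :
    z = ∑ D : SMat m n r with D.ro = ν ∧ D.co = ξ, D.coord z • D.nTD := by
  conv_lhs => rw [eq_sum_eigvec hl hr]
  refine Finset.sum_congr rfl fun D _ => ?_
  rw [D.nTD_eq, smul_smul, SMat.coord, mul_right_comm, vpow_mul, neg_add_cancel, vpow_zero, one_mul]

theorem coeff_sum_nTD {s : Finset (SMat m n r)} {ν ξ : SComp m n r}
    (hs : ∀ C ∈ s, C.ro = ν ∧ C.co = ξ) (c : SMat m n r → Zv) {D : SMat m n r} (hD : D ∈ s)
    {w : Perm (Fin r)} (hw : w ∈ D.perms) :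
    coeff w (∑ C ∈ s, c C • C.nTD) = c D * coeff w D.nTD := by
  classical
  rw [map_sum, Finset.sum_eq_single D, map_smul, smul_eq_mul]
  · intro C hC hne
    rw [map_smul, C.coeff_nTD, if_neg, smul_zero]
    exact fun h => hne (SMat.eq_of_mem_perms ((hs C hC).1.trans (hs D hD).1.symm)
      ((hs C hC).2.trans (hs D hD).2.symm) h hw)
  · exact fun h => absurd hD h

theorem nTD_linearIndependent {s : Finset (SMat m n r)} {ν ξ : SComp m n r}
    (hs : ∀ C ∈ s, C.ro = ν ∧ C.co = ξ) {c c' : SMat m n r → Zv}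
    (h : ∑ C ∈ s, c C • C.nTD = ∑ C ∈ s, c' C • C.nTD) : ∀ D ∈ s, c D = c' D := by
  intro D hD
  have := congrArg (coeff D.d) h
  rw [coeff_sum_nTD hs _ hD D.d_mem, coeff_sum_nTD hs _ hD D.d_mem] at this
  exact (D.isUnit_coeff_nTD D.d_mem).mul_right_cancel this

/-! The bar involution on the normalized elements. -/

theorem invert_eigval_mul (p : ZMod 2) :
    LaurentPolynomial.invert (eigval p) * eigval p = 1 := by
  rcases parity_eq_zero_or_one p with rfl | rfl
  · rw [eigval_zero, invert_vpow, qinv_mul_qq]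
  · rw [eigval_one, map_neg, map_one]
    ring

/-- Bar turns `T_s z = e z` into `T_s⁻¹ (bar z) = ē (bar z)`, and `ē e = 1` for both eigenvalues. -/
theorem bar_mem_leftEig {ν : SComp m n r} {z : Hecke r} (hz : z ∈ leftEig ν) :
    Hecke.bar z ∈ leftEig ν := by
  intro i hi'
  have h := congrArg Hecke.bar (hz i hi')
  rw [Hecke.bar_mul, Hecke.bar_T_simple, Hecke.bar_smul] at h
  have h2 := congrArg (fun a => eigval (idxParity (ν.rowOf (lo i))) • (Hecke.T (simple i) * a)) h
  simp only [mul_smul_comm, smul_smul] at h2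
  rw [← mul_assoc, Hecke.T_mul_invT, one_mul, mul_comm, invert_eigval_mul, one_smul] at h2
  exact h2.symm

theorem bar_mem_rightEig {ξ : SComp m n r} {z : Hecke r} (hz : z ∈ rightEig ξ) :
    Hecke.bar z ∈ rightEig ξ := by
  intro i hi'
  have h := congrArg Hecke.bar (hz i hi')
  rw [Hecke.bar_mul, Hecke.bar_T_simple, Hecke.bar_smul] at h
  have h2 := congrArg (fun a => eigval (idxParity (ξ.rowOf (lo i))) • (a * Hecke.T (simple i))) h
  simp only [smul_mul_assoc, smul_smul] at h2
  rw [mul_assoc, Hecke.invT_mul_T, mul_one, mul_comm, invert_eigval_mul, one_smul] at h2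
  exact h2.symm

/-- The coefficients of the bar involution on the normalized elements. -/
noncomputable def barMat (C D : SMat m n r) : Zv :=
  open Classical in if C.ro = D.ro ∧ C.co = D.co then C.coord (Hecke.bar D.nTD) else 0

open Classical in
theorem bar_nTD (D : SMat m n r) : Hecke.bar D.nTD =
    ∑ C : SMat m n r with C.ro = D.ro ∧ C.co = D.co, barMat C D • C.nTD := by
  conv_lhs => rw [eq_sum_nTD (bar_mem_leftEig D.nTD_mem_leftEig)
    (bar_mem_rightEig D.nTD_mem_rightEig)]
  refine Finset.sum_congr rfl fun C hC => ?_
  rw [barMat, if_pos (Finset.mem_filter.1 hC).2]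

theorem nTD_eq_sum (D : SMat m n r) : D.nTD = ∑ w ∈ D.perms, coeff w D.nTD • Hecke.T w := by
  classical
  refine Hecke.ext_coeff fun w => ?_
  rw [coeff_sum_smul_T]
  split_ifs with h
  · rfl
  · rw [D.coeff_nTD, if_neg h]

theorem coeff_bar_nTD (D : SMat m n r) (w : Perm (Fin r)) : coeff w (Hecke.bar D.nTD) =
    ∑ u ∈ D.perms, LaurentPolynomial.invert (coeff u D.nTD) * coeff w (Hecke.bar (Hecke.T u)) := by
  conv_lhs => rw [nTD_eq_sum, Hecke.bar_sum]
  simp only [Hecke.bar_smul, map_sum, map_smul, smul_eq_mul]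

theorem bruhatLE_of_coeff_bar_nTD (D : SMat m n r) {w : Perm (Fin r)}
    (h : coeff w (Hecke.bar D.nTD) ≠ 0) : bruhatLE w D.wPlus := by
  rw [coeff_bar_nTD] at h
  obtain ⟨u, hu, hne⟩ := Finset.exists_ne_zero_of_sum_ne_zero h
  exact Relation.ReflTransGen.trans (Hecke.bruhatLE_of_coeff_bar_T u w (right_ne_zero_of_mul hne))
    (D.bruhatLE_wPlus hu)

theorem coeff_bar_nTD_of_mem {C D : SMat m n r} (h1 : C.ro = D.ro) (h2 : C.co = D.co)
    {w : Perm (Fin r)} (hw : w ∈ C.perms) :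
    coeff w (Hecke.bar D.nTD) = barMat C D * coeff w C.nTD := by
  classical
  rw [bar_nTD]
  exact coeff_sum_nTD (fun C hC => (Finset.mem_filter.1 hC).2) (fun C => barMat C D)
    (Finset.mem_filter.2 ⟨Finset.mem_univ _, h1, h2⟩) hw

/-- Read off at `w_C^+`, where `𝒯_C` has a unit coefficient and the other `𝒯` with the same row and
column sums have none. -/
theorem barMat_eq_zero {C D : SMat m n r} (h : ¬ C.le D) : barMat C D = 0 := by
  by_cases h1 : C.ro = D.ro ∧ C.co = D.co
  · by_contra hne
    refine h ⟨h1.1, h1.2, bruhatLE_of_coeff_bar_nTD D ?_⟩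
    rw [coeff_bar_nTD_of_mem h1.1 h1.2 C.wPlus_mem]
    exact mul_ne_zero hne (C.isUnit_coeff_nTD C.wPlus_mem).ne_zero
  · rw [barMat, if_neg h1]

/-- At `w⁺` only `bar T_{w⁺}` contributes, with coefficient `v^{-2l}` for `l = l(w⁺)`. The
coefficient `c = ± v^{-l}` of `𝒯_D` satisfies `c̄ v^{-2l} = c`. -/
theorem barMat_self (D : SMat m n r) : barMat D D = 1 := by
  classical
  have h := coeff_bar_nTD_of_mem (rfl : D.ro = D.ro) (rfl : D.co = D.co) D.wPlus_mem
  rw [coeff_bar_nTD, Finset.sum_eq_single D.wPlus, Hecke.coeff_bar_T_self] at h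
  · refine (D.isUnit_coeff_nTD D.wPlus_mem).mul_right_cancel ?_
    rw [← h, one_mul, D.coeff_nTD, if_pos D.wPlus_mem]
    have h1 : D.expo = 2 * kindCount D.ro D.co (some 1) D.wPlus - len D.wPlus := D.exponent_eq
    rw [h1, negqPow, neg_pow, vpow_pow, map_mul, map_mul, map_pow, map_neg, map_one,
      invert_vpow, invert_vpow, mul_left_comm, mul_left_comm _ ((-1) ^ _), mul_assoc, vpow_mul,
      vpow_mul, vpow_mul]
    congr 2
    ring
  · intro u hu hne
    have : coeff D.wPlus (Hecke.bar (Hecke.T u)) = 0 := by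
      by_contra hc
      exact hne ((Hecke.bruhatLE_of_coeff_bar_T _ _ hc).eq_of_len_le (D.len_le_wPlus hu)).symm
    rw [this, mul_zero]
  · exact fun h => absurd D.wPlus_mem h

theorem isBarMatrix_barMat : IsBarMatrix (barMat : SMat m n r → SMat m n r → Zv) := by
  classical
  refine ⟨fun C D h => barMat_eq_zero h, fun D => ?_⟩
  rw [bar_nTD]
  symm
  refine Finset.sum_subset_zero_on_sdiff ?_ ?_ fun _ _ => rfl
  · intro C hC
    have := (Finset.mem_filter.1 hC).2
    exact Finset.mem_filter.2 ⟨Finset.mem_univ _, this.1, this.2.1⟩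
  · intro C hC
    rw [Finset.mem_sdiff, Finset.mem_filter, Finset.mem_filter] at hC
    rw [barMat_eq_zero fun h => hC.2 ⟨Finset.mem_univ _, h⟩, zero_smul]

theorem IsBarMatrix.eq_barMat {R : SMat m n r → SMat m n r → Zv} (hR : IsBarMatrix R) :
    R = barMat := by
  classical
  funext C D
  by_cases h : C.le D
  · have := (hR.2 D).symm.trans (isBarMatrix_barMat.2 D)
    exact nTD_linearIndependent (c := fun C => R C D) (c' := fun C => barMat C D)
      (fun C hC => ⟨(Finset.mem_filter.1 hC).2.1, (Finset.mem_filter.1 hC).2.2.1⟩) this C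
      (Finset.mem_filter.2 ⟨Finset.mem_univ _, h⟩)
  · rw [hR.1 C D h, barMat_eq_zero h]

/-! The diagonal matrices. -/

/-- The matrix of the double coset of the identity. -/
def SComp.diag (ν : SComp m n r) : SMat m n r :=
  ⟨fun i j => if i = j then ν.1 i else 0, by simp [ν.2], fun i j h => by
    dsimp only
    rw [if_neg]
    · exact Nat.zero_le _
    · rintro rfl
      rw [CharTwo.add_self_eq_zero] at h
      exact absurd h zero_ne_one⟩

theorem SComp.ro_diag (ν : SComp m n r) : ν.diag.ro = ν :=
  Subtype.ext (funext fun i => by simp [SMat.ro, SComp.diag])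

theorem SComp.co_diag (ν : SComp m n r) : ν.diag.co = ν :=
  Subtype.ext (funext fun i => by simp [SMat.co, SComp.diag])

theorem SComp.one_mem_diag (ν : SComp m n r) : 1 ∈ ν.diag.perms := by
  classical
  rw [SMat.mem_perms, ν.ro_diag, ν.co_diag]
  intro i j
  rw [matOf_eq]
  change _ = if i = j then ν.1 i else 0
  split_ifs with h
  · subst h
    rw [← ν.card_rowOf]
    congr 1
    ext k
    simp
  · rw [Finset.card_eq_zero, Finset.eq_empty_iff_forall_notMem]
    intro k hk
    simp only [Finset.mem_filter, Finset.mem_univ, true_and, Perm.one_apply, Prod.mk.injEq] at hk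
    exact h (hk.1.symm.trans hk.2)

theorem SComp.mem_perms_diag (ν : SComp m n r) (w : Perm (Fin r)) :
    w ∈ ν.diag.perms ↔ w ∈ ν.young := by
  rw [ν.diag.mem_perms_iff ν.one_mem_diag, ν.ro_diag, ν.co_diag]
  constructor
  · rintro ⟨x, hx, y, hy, rfl⟩
    exact mul_mem (mul_mem hx (one_mem _)) hy
  · intro h
    exact ⟨w, h, 1, one_mem _, by group⟩

theorem SComp.d_diag (ν : SComp m n r) : ν.diag.d = 1 := by
  have := ν.diag.len_d_le ν.one_mem_diag
  rw [len_one, Nat.le_zero] at this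
  exact eq_one_of_len _ this

theorem incrOn_one {α : Type*} (c : Fin r → α) : IncrOn c (1 : Perm (Fin r)) := fun _ _ h _ => h

theorem SComp.xy_eq_eigvec (ν : SComp m n r) : ν.x * ν.y = ν.diag.eigvec := by
  classical
  have h1 : ν.diag.eigvec ∈ leftEig ν := by
    have := ν.diag.eigvec_mem_leftEig
    rwa [ν.ro_diag] at this
  refine eq_of_coeff_incrOn ν.xy_mem_leftEig h1 fun w hw => ?_
  have h2 := ν.coeff_xy_mul_T (w := 1) (w' := w) (by rw [inv_one]; exact incrOn_one _) hw
  rw [← Hecke.one_def, mul_one] at h2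
  rw [h2]
  split_ifs with h
  · rw [← h, ← ν.d_diag, ν.diag.coeff_eigvec_d]
  · rw [SMat.coeff_eigvec, if_neg]
    rw [ν.mem_perms_diag]
    intro hw'
    refine h (eq_one_of_incrOn ν.rowOf_mono ((ν.mem_young w).1 hw') (w := 1) ?_ ?_).symm
    · rw [inv_one]
      exact incrOn_one _
    · rwa [mul_one]

theorem dcoset_one (H : Subgroup (Perm (Fin r))) : dcoset H H 1 = elts H := by
  ext w
  rw [mem_dcoset, mem_elts]
  constructor
  · rintro ⟨x, hx, y, hy, rfl⟩
    exact mul_mem (mul_mem hx (one_mem _)) hy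
  · intro h
    exact ⟨w, h, 1, one_mem _, by group⟩

theorem SComp.expo_diag (ν : SComp m n r) : ν.diag.expo =
    -(maxLen (elts ν.evenYoung) : ℤ) + maxLen (elts ν.oddYoung) := by
  rw [SMat.expo, SMat.lenEven, SMat.lenOdd, ν.ro_diag, ν.co_diag, ν.d_diag, len_one, dcoset_one,
    dcoset_one]
  simp

theorem SComp.nT_eq_nTD (ν : SComp m n r) : ν.nT = ν.diag.nTD := by
  rw [SComp.nT, SMat.nTD_eq, ν.xy_eq_eigvec, ν.expo_diag]

/-- The generator is the `𝒯` of the diagonal matrix. A Young subgroup is a lower set in the Bruhat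
order, so no other matrix lies below this one. -/
theorem SComp.bar_nT (ν : SComp m n r) : Hecke.bar ν.nT = ν.nT := by
  classical
  rw [ν.nT_eq_nTD, bar_nTD, Finset.sum_eq_single ν.diag]
  · rw [barMat_self, one_smul]
  · intro C hC hne
    obtain ⟨-, h1, h2⟩ := Finset.mem_filter.1 hC
    rw [barMat_eq_zero, zero_smul]
    intro hle
    refine hne (SMat.eq_of_mem_perms h1 h2 C.wPlus_mem ?_)
    rw [ν.mem_perms_diag, ν.mem_young]
    exact comp_eq_of_bruhatLE ν.rowOf_mono hle.2.2
      ((ν.mem_young _).1 ((ν.mem_perms_diag _).1 ν.diag.wPlus_mem))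
  · exact fun h => absurd (Finset.mem_filter.2 ⟨Finset.mem_univ _, rfl, rfl⟩) h

end QSuper

namespace QSuper

/-! ### Canonical bases of modules with a unitriangular bar involution -/

theorem zero_mem_vInvPoly : (0 : Zv) ∈ vInvPoly := ⟨0, by simp⟩

theorem add_mem_vInvPoly {a b : Zv} (ha : a ∈ vInvPoly) (hb : b ∈ vInvPoly) :
    a + b ∈ vInvPoly := by
  obtain ⟨f, rfl⟩ := ha
  obtain ⟨g, rfl⟩ := hb
  exact ⟨f + g, by rw [map_add, mul_add]⟩

theorem neg_mem_vInvPoly {a : Zv} (ha : a ∈ vInvPoly) : -a ∈ vInvPoly := by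
  obtain ⟨f, rfl⟩ := ha
  exact ⟨-f, by rw [map_neg, mul_neg]⟩

theorem sum_mem_vInvPoly {ι : Type*} (s : Finset ι) (f : ι → Zv) (h : ∀ i ∈ s, f i ∈ vInvPoly) :
    ∑ i ∈ s, f i ∈ vInvPoly :=
  Finset.sum_induction f (· ∈ vInvPoly) (fun _ _ => add_mem_vInvPoly) zero_mem_vInvPoly h

theorem monomial_mem_vInvPoly (a : ℤ) {n : ℤ} (hn : n < 0) :
    LaurentPolynomial.C a * vpow n ∈ vInvPoly := by
  obtain ⟨k, rfl⟩ : ∃ k : ℕ, n = -1 + k * (-1) := ⟨(-n - 1).toNat, by omega⟩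
  refine ⟨Polynomial.monomial k a, ?_⟩
  rw [Polynomial.aeval_monomial, vpow, LaurentPolynomial.T_add, vpow, LaurentPolynomial.T_pow]
  simp only [mul_neg, mul_one]
  exact mul_left_comm _ _ _

theorem coeff_of_mem_vInvPoly {a : Zv} (ha : a ∈ vInvPoly) {n : ℤ} (hn : 0 ≤ n) :
    a.coeff n = 0 := by
  obtain ⟨f, rfl⟩ := ha
  induction f using Polynomial.induction_on' with
  | add f g hf hg =>
    rw [map_add, mul_add]
    simp only [AddMonoidAlgebra.coeff_add, Finsupp.add_apply, hf, hg, add_zero]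
  | monomial k c =>
    have : vpow (-1) * Polynomial.aeval (vpow (-1)) (Polynomial.monomial k c) =
        LaurentPolynomial.C c * vpow (-1 + k * (-1)) := by
      rw [Polynomial.aeval_monomial, vpow, vpow, LaurentPolynomial.T_add, LaurentPolynomial.T_pow]
      exact mul_left_comm _ _ _
    rw [this, vpow, ← LaurentPolynomial.single_eq_C_mul_T]
    simp only [AddMonoidAlgebra.coeff_single]
    exact Finsupp.single_eq_of_ne (by omega)

/-- The exponents are negative, yet their set is symmetric. -/
theorem eq_zero_of_mem_vInvPoly {a : Zv} (ha : a ∈ vInvPoly)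
    (h : LaurentPolynomial.invert a = a) : a = 0 := by
  ext n
  rcases le_or_gt 0 n with hn | hn
  · rw [coeff_of_mem_vInvPoly ha hn]
    rfl
  · rw [← h, LaurentPolynomial.invert_apply, coeff_of_mem_vInvPoly ha (by omega)]
    rfl

theorem exists_sub_invert {a : Zv} (h : LaurentPolynomial.invert a = -a) :
    ∃ p ∈ vInvPoly, a = p - LaurentPolynomial.invert p := by
  classical
  have hc : ∀ n, a.coeff (-n) = -a.coeff n := fun n => by
    rw [← LaurentPolynomial.invert_apply, h]
    rfl
  -- The part of `a` with negative exponents; the constant coefficient of `a` vanishes, being its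
  -- own negative.
  let p : Zv := ∑ n ∈ a.coeff.support with n < 0, LaurentPolynomial.C (a.coeff n) * vpow n
  have hp : ∀ n, p.coeff n = if n < 0 then a.coeff n else 0 := by
    intro n
    have : p.coeff n = ∑ k ∈ a.coeff.support with k < 0, if k = n then a.coeff k else 0 := by
      simp only [p, AddMonoidAlgebra.coeff_sum, Finsupp.finsetSum_apply, vpow,
        ← LaurentPolynomial.single_eq_C_mul_T, AddMonoidAlgebra.coeff_single,
        Finsupp.single_apply]
    rw [this, Finset.sum_ite_eq']
    simp only [Finset.mem_filter, Finsupp.mem_support_iff]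
    split_ifs with h1 h2 h2
    · rfl
    · exact absurd h1.2 h2
    · by_contra h3
      exact h1 ⟨fun h4 => h3 h4.symm, h2⟩
    · rfl
  refine ⟨p, sum_mem_vInvPoly _ _ fun n hn =>
    monomial_mem_vInvPoly _ (Finset.mem_filter.1 hn).2, ?_⟩
  ext n
  have h0 := hc 0
  rw [AddMonoidAlgebra.coeff_sub, Finsupp.sub_apply, LaurentPolynomial.invert_apply, hp, hp, hc n]
  rcases lt_trichotomy n 0 with hn | rfl | hn
  · rw [if_pos hn, if_neg (by omega), sub_zero]
  · rw [neg_zero] at h0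
    simp only [lt_irrefl, if_false, neg_zero, sub_self]
    omega
  · rw [if_neg (by omega), if_pos (by omega)]
    ring

section CanonicalBasis

variable {ι M : Type*} [Fintype ι] [AddCommGroup M] [Module Zv M]

/-- A semilinear involution that is unitriangular on a basis. -/
structure IsBarInvolution (b : Module.Basis ι Zv M) (lt : ι → ι → Prop) (ht : ι → ℕ)
    (β : M →+ M) : Prop where
  semilinear : ∀ (a : Zv) (x : M), β (a • x) = LaurentPolynomial.invert a • β x
  involutive : ∀ x, β (β x) = x
  lt_trans : ∀ {i j k}, lt i j → lt j k → lt i k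
  ht_lt : ∀ {i j}, lt i j → ht i < ht j
  diag : ∀ i, b.repr (β (b i)) i = 1
  triangular : ∀ i j, i ≠ j → ¬ lt i j → b.repr (β (b j)) i = 0

namespace IsBarInvolution

variable {b : Module.Basis ι Zv M} {lt : ι → ι → Prop} {ht : ι → ℕ} {β : M →+ M}

theorem repr_apply (h : IsBarInvolution b lt ht β) (x : M) (i : ι) :
    b.repr (β x) i = ∑ j, LaurentPolynomial.invert (b.repr x j) * b.repr (β (b j)) i := by
  conv_lhs => rw [← b.sum_repr x, map_sum]
  simp only [h.semilinear, map_sum, map_smul, Finsupp.finsetSum_apply, Finsupp.smul_apply,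
    smul_eq_mul]

/-- By unitriangularity the other coordinates that could contribute lie above `i`, where `x` has
none. -/
theorem repr_top (h : IsBarInvolution b lt ht β) {x : M} {i : ι}
    (hi : ∀ j, lt i j → b.repr x j = 0) :
    b.repr (β x) i = LaurentPolynomial.invert (b.repr x i) := by
  rw [h.repr_apply, Finset.sum_eq_single i, h.diag, mul_one]
  · intro j _ hj
    by_cases hlt : lt i j
    · rw [hi j hlt, map_zero, zero_mul]
    · rw [h.triangular i j hj.symm hlt, mul_zero]
  · exact fun h => absurd (Finset.mem_univ _) h

/-- Uniqueness of canonical bases: a nonzero coordinate of maximal height would be bar-invariant and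
in `v⁻¹ ℤ[v⁻¹]`. -/
theorem eq_zero (h : IsBarInvolution b lt ht β) {x : M} (hx : β x = x)
    (hp : ∀ i, b.repr x i ∈ vInvPoly) : x = 0 := by
  classical
  by_contra hne
  have : (Finset.univ.filter fun i => b.repr x i ≠ 0).Nonempty := by
    by_contra hc
    rw [Finset.not_nonempty_iff_eq_empty, Finset.filter_eq_empty_iff] at hc
    refine hne (b.ext_elem fun i => ?_)
    rw [map_zero, Finsupp.zero_apply]
    exact not_not.1 (hc (Finset.mem_univ i))
  obtain ⟨i, hi, hmax⟩ := Finset.exists_max_image _ ht this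
  rw [Finset.mem_filter] at hi
  refine hi.2 (eq_zero_of_mem_vInvPoly (hp i) ?_)
  rw [← h.repr_top, hx]
  intro j hj
  by_contra hc
  have := hmax j (Finset.mem_filter.2 ⟨Finset.mem_univ _, hc⟩)
  exact absurd (h.ht_lt hj) (not_lt.2 this)

/-- Peel off an index `i` of maximal height in the lower set `S`. Its coordinate is anti-invariant,
hence `p - p̄` with `p ∈ v⁻¹ ℤ[v⁻¹]`; subtracting `u - β u` for `u = p b_i` leaves an anti-invariant
element supported on `S` without `i`. -/
theorem exists_sub (h : IsBarInvolution b lt ht β) (S : Finset ι)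
    (hS : ∀ i j, lt i j → j ∈ S → i ∈ S) (z : M) (hz : ∀ i, i ∉ S → b.repr z i = 0)
    (hβ : β z = -z) : ∃ y, (∀ i, i ∉ S → b.repr y i = 0) ∧ (∀ i, b.repr y i ∈ vInvPoly) ∧
      z = y - β y := by
  classical
  induction hn : S.card generalizing S z with
  | zero =>
    rw [Finset.card_eq_zero] at hn
    subst hn
    have : z = 0 := b.ext_elem fun i => by
      rw [hz i (Finset.notMem_empty i), map_zero, Finsupp.zero_apply]
    exact ⟨0, by simp, by simp [zero_mem_vInvPoly], by simp [this]⟩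
  | succ n ih =>
    obtain ⟨i, hi, hmax⟩ := S.exists_max_image ht (Finset.card_pos.1 (by omega))
    have htop : ∀ j, lt i j → j ∉ S := fun j hj hjS =>
      absurd (h.ht_lt hj) (not_lt.2 (hmax j hjS))
    have h1 : LaurentPolynomial.invert (b.repr z i) = -b.repr z i := by
      rw [← h.repr_top fun j hj => hz j (htop j hj), hβ, map_neg, Finsupp.neg_apply]
    obtain ⟨p, hp, hpz⟩ := exists_sub_invert h1
    set u := p • b i with hu
    have hru : ∀ j, j ≠ i → b.repr u j = 0 := fun j hj => by
      rw [hu, map_smul, b.repr_self, Finsupp.smul_apply, Finsupp.single_eq_of_ne hj, smul_zero]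
    have hri : b.repr u i = p := by
      rw [hu, map_smul, b.repr_self, Finsupp.smul_apply, Finsupp.single_eq_same, smul_eq_mul,
        mul_one]
    have hrβ : ∀ j, j ∉ S → b.repr (β u) j = 0 := fun j hj => by
      rw [hu, h.semilinear, map_smul, Finsupp.smul_apply, h.triangular, smul_zero]
      · rintro rfl
        exact hj hi
      · exact fun hlt => hj (hS _ _ hlt hi)
    have e1 : ∀ j k, lt j k → k ∈ S.erase i → j ∈ S.erase i := by
      intro j k hjk hk
      have hkS := Finset.mem_of_mem_erase hk
      refine Finset.mem_erase.2 ⟨?_, hS j k hjk hkS⟩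
      rintro rfl
      exact htop k hjk hkS
    have e2 : ∀ j, j ∉ S.erase i → b.repr (z - (u - β u)) j = 0 := by
      intro j hj
      rw [map_sub, map_sub, Finsupp.sub_apply, Finsupp.sub_apply]
      by_cases hji : j = i
      · rw [hji, h.repr_top fun k hk => hru k fun e => htop k hk (e ▸ hi), hri, hpz, sub_self]
      · have hjS : j ∉ S := fun h => hj (Finset.mem_erase.2 ⟨hji, h⟩)
        rw [hz j hjS, hru j hji, hrβ j hjS, sub_self, sub_self]
    have e3 : β (z - (u - β u)) = -(z - (u - β u)) := by
      rw [map_sub, map_sub, h.involutive, hβ]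
      abel
    obtain ⟨y, hy1, hy2, hy3⟩ := ih (S.erase i) e1 (z - (u - β u)) e2 e3
      (by rw [Finset.card_erase_of_mem hi, hn, Nat.add_sub_cancel])
    refine ⟨y + u, fun j hj => ?_, fun j => ?_, ?_⟩
    · rw [map_add, Finsupp.add_apply, hy1 j (fun h => hj (Finset.mem_of_mem_erase h)), hru, add_zero]
      rintro rfl
      exact hj hi
    · rw [map_add, Finsupp.add_apply]
      refine add_mem_vInvPoly (hy2 j) ?_
      by_cases hj : j = i
      · rw [hj, hri]
        exact hp
      · rw [hru j hj]
        exact zero_mem_vInvPoly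
    · rw [map_add, add_sub_add_comm, ← hy3, sub_add_cancel]

/-- The canonical basis, as a family. -/
theorem exists_canonical (h : IsBarInvolution b lt ht β) (i : ι) :
    ∃ θ, β θ = θ ∧ (∀ j, b.repr (θ - b i) j ∈ vInvPoly) ∧
      ∀ j, ¬ lt j i → b.repr (θ - b i) j = 0 := by
  classical
  have e1 : ∀ j, j ∉ (Finset.univ.filter fun j => lt j i) → b.repr (β (b i) - b i) j = 0 := by
    intro j hj
    rw [map_sub, Finsupp.sub_apply]
    by_cases hji : j = i
    · rw [hji, h.diag, b.repr_self, Finsupp.single_eq_same, sub_self]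
    · rw [h.triangular j i hji fun hc => hj (Finset.mem_filter.2 ⟨Finset.mem_univ _, hc⟩),
        b.repr_self, Finsupp.single_eq_of_ne hji, sub_zero]
  -- From `β b_i - b_i = y - β y` it follows that `b_i + y` is fixed by `β`.
  obtain ⟨y, h1, h2, h3⟩ := h.exists_sub (Finset.univ.filter fun j => lt j i)
    (fun j k hjk hk => Finset.mem_filter.2 ⟨Finset.mem_univ _,
      h.lt_trans hjk (Finset.mem_filter.1 hk).2⟩) (β (b i) - b i) e1
    (by rw [map_sub, h.involutive, neg_sub])
  refine ⟨b i + y, ?_, fun j => ?_, fun j hj => ?_⟩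
  · rw [map_add, ← sub_eq_zero]
    rw [← sub_eq_zero] at h3
    rw [← h3]
    abel
  · rw [add_sub_cancel_left]
    exact h2 j
  · rw [add_sub_cancel_left]
    exact h1 j fun hc => hj (Finset.mem_filter.1 hc).2

theorem mem_span_range (h : IsBarInvolution b lt ht β) {θ : ι → M}
    (hθ : ∀ i j, ¬ lt j i → b.repr (θ i - b i) j = 0) (i : ι) :
    b i ∈ Submodule.span Zv (Set.range θ) := by
  induction hn : ht i using Nat.strong_induction_on generalizing i with
  | _ n ih =>
    have : b i = θ i - ∑ j, b.repr (θ i - b i) j • b j := by rw [b.sum_repr, sub_sub_cancel]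
    rw [this]
    refine sub_mem (Submodule.subset_span ⟨i, rfl⟩) (sum_mem fun j _ => ?_)
    by_cases hlt : lt j i
    · exact Submodule.smul_mem _ _ (ih _ (hn ▸ h.ht_lt hlt) j rfl)
    · rw [hθ i j hlt, zero_smul]
      exact zero_mem _

/-- A family that is unitriangular with respect to a basis is a basis. -/
theorem exists_basis (h : IsBarInvolution b lt ht β) {θ : ι → M}
    (hθ : ∀ i j, ¬ lt j i → b.repr (θ i - b i) j = 0) :
    ∃ Θ : Module.Basis ι Zv M, ⇑Θ = θ := by
  have : Module.Finite Zv M := Module.Finite.of_basis b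
  have hsurj : Function.Surjective (b.constr Zv θ) := by
    rw [← LinearMap.range_eq_top, Module.Basis.constr_range, eq_top_iff, ← b.span_eq,
      Submodule.span_le]
    rintro _ ⟨i, rfl⟩
    exact h.mem_span_range hθ i
  -- A surjective endomorphism of a finite module over a commutative ring is injective, so spanning
  -- suffices.
  have hinj := OrzechProperty.injective_of_surjective_endomorphism _ hsurj
  refine ⟨b.map (LinearEquiv.ofBijective _ ⟨hinj, hsurj⟩), ?_⟩
  ext i
  rw [Module.Basis.map_apply]
  exact b.constr_basis Zv θ i

end IsBarInvolution

end CanonicalBasis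

end QSuper

namespace QSuper

open Equiv (Perm)
open Hecke (coeff)

variable {m n r : ℕ}

/-! ### The annihilator of the generator of a signed permutation module -/

theorem mul_T_of_mem_factor {ξ : SComp m n r} {z : Hecke r} (hz : z ∈ rightEig ξ) (p : ZMod 2)
    {u : Perm (Fin r)} (hu : u ∈ ξ.factor p) : z * Hecke.T u = eigval p ^ len u • z := by
  refine stab_induction (ξ.parityMap_mono p) (Q := fun u => z * Hecke.T u = eigval p ^ len u • z)
    ?_ ?_ u ((ξ.mem_factor p u).1 hu)
  · rw [len_one, pow_zero, one_smul, ← Hecke.one_def, mul_one]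
  · intro i u hi' _ hasc ih
    obtain ⟨h1, h2⟩ := ξ.parityMap_simple p hi'
    rw [Hecke.T_simple_mul_of_leftAsc i u hasc, ← mul_assoc, hz i h1, h2, smul_mul_assoc, ih,
      smul_smul, len_simple_mul i u hasc, pow_succ']

/-- The eigenvalue of `x_ξ y_η` on right eigenvectors. -/
noncomputable def SComp.poincare (ξ : SComp m n r) : Zv :=
  (∑ u ∈ elts ξ.evenYoung, qq ^ len u) * ∑ v ∈ elts ξ.oddYoung, vpow (-2) ^ len v

theorem mul_xy_of_mem_rightEig {ξ : SComp m n r} {z : Hecke r} (hz : z ∈ rightEig ξ) :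
    z * (ξ.x * ξ.y) = ξ.poincare • z := by
  have h1 : z * ξ.x = (∑ u ∈ elts ξ.evenYoung, qq ^ len u) • z := by
    rw [SComp.x, Finset.mul_sum, Finset.sum_smul]
    refine Finset.sum_congr rfl fun u hu => ?_
    rw [mul_T_of_mem_factor hz 0 (ξ.mem_elts_even.1 hu), eigval_zero]
  have h2 : z * ξ.y = (∑ v ∈ elts ξ.oddYoung, vpow (-2) ^ len v) • z := by
    rw [SComp.y, Finset.mul_sum, Finset.sum_smul]
    refine Finset.sum_congr rfl fun v hv => ?_
    rw [mul_smul_comm, mul_T_of_mem_factor hz 1 (ξ.mem_elts_odd.1 hv), eigval_one, smul_smul,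
      negqPow, ← mul_pow, mul_neg_one, neg_neg]
  rw [← mul_assoc, h1, smul_mul_assoc, h2, smul_smul, SComp.poincare]

/-- At `v = 1` it becomes the product of the orders of the two factors. -/
theorem SComp.poincare_ne_zero (ξ : SComp m n r) : ξ.poincare ≠ 0 := by
  intro h
  have := congrArg (LaurentPolynomial.eval₂ (RingHom.id ℤ) 1) h
  rw [SComp.poincare, map_mul, map_sum, map_sum, map_zero] at this
  simp only [map_pow, LaurentPolynomial.eval₂_T, one_zpow, Units.val_one, one_pow,
    Finset.sum_const, nsmul_eq_mul, mul_one] at this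
  rw [mul_eq_zero] at this
  have hc : ∀ H : Subgroup (Perm (Fin r)), (elts H).card ≠ 0 := fun H =>
    Finset.card_ne_zero_of_mem (mem_elts.2 H.one_mem)
  rcases this with h | h
  · exact hc _ (by exact_mod_cast h)
  · exact hc _ (by exact_mod_cast h)

theorem smul_eq_zero_hecke {c : Zv} (hc : c ≠ 0) {z : Hecke r} (h : c • z = 0) : z = 0 := by
  refine Hecke.ext_coeff fun w => ?_
  have := congrArg (coeff w) h
  rw [map_smul, map_zero, smul_eq_mul] at this
  rw [(mul_eq_zero.1 this).resolve_left hc, map_zero]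

/-- `P z h = z (x y) h = 0` with `P ≠ 0`, and the Hecke algebra is torsion-free. This is why `nT h ↦
z h` is well defined. -/
theorem mul_eq_zero_of_nT_mul {ξ : SComp m n r} {z : Hecke r} (hz : z ∈ rightEig ξ) {h : Hecke r}
    (hh : ξ.nT * h = 0) : z * h = 0 := by
  have h1 : ξ.x * ξ.y * h = 0 := by
    rw [SComp.nT, smul_mul_assoc] at hh
    exact smul_eq_zero_hecke (vpow_ne_zero _) hh
  refine smul_eq_zero_hecke ξ.poincare_ne_zero ?_
  rw [← smul_mul_assoc, ← mul_xy_of_mem_rightEig hz, mul_assoc, h1, mul_zero]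

theorem mul_eq_mul_of_nT_mul {ξ : SComp m n r} {z : Hecke r} (hz : z ∈ rightEig ξ) {h h' : Hecke r}
    (hh : ξ.nT * h = ξ.nT * h') : z * h = z * h' := by
  rw [← sub_eq_zero, ← mul_sub]
  exact mul_eq_zero_of_nT_mul hz (by rw [mul_sub, hh, sub_self])

/-! ### Signed permutation modules -/

theorem SComp.nT_mem_leftEig (ν : SComp m n r) : ν.nT ∈ leftEig ν :=
  Submodule.smul_mem _ _ ν.xy_mem_leftEig

theorem SComp.nT_mem_rightEig (ν : SComp m n r) : ν.nT ∈ rightEig ν :=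
  Submodule.smul_mem _ _ ν.xy_mem_rightEig

theorem SComp.exists_nT_mul (ν : SComp m n r) {z : Hecke r} (hz : z ∈ ν.qmod) :
    ∃ h, z = ν.nT * h := by
  rw [SComp.qmod, Submodule.mem_span_singleton] at hz
  obtain ⟨a, rfl⟩ := hz
  refine ⟨vpow (-(-(maxLen (elts ν.evenYoung) : ℤ) + maxLen (elts ν.oddYoung))) • a.unop, ?_⟩
  rw [SComp.nT, smul_mul_assoc, mul_smul_comm, smul_smul, vpow_mul, add_neg_cancel, vpow_zero,
    one_smul]
  rfl

theorem SComp.mem_leftEig_of_mem_qmod (ν : SComp m n r) {z : Hecke r} (hz : z ∈ ν.qmod) :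
    z ∈ leftEig ν := by
  obtain ⟨h, rfl⟩ := ν.exists_nT_mul hz
  exact mul_mem_leftEig ν.nT_mem_leftEig h

theorem SComp.mul_mem_qmod (ν : SComp m n r) {z : Hecke r} (hz : z ∈ ν.qmod) (h : Hecke r) :
    z * h ∈ ν.qmod := by
  rw [← op_smul_eq_mul]
  exact Submodule.smul_mem _ _ hz

theorem SComp.smul_mem_qmod (ν : SComp m n r) {z : Hecke r} (hz : z ∈ ν.qmod) (c : Zv) :
    c • z ∈ ν.qmod := Submodule.smul_of_tower_mem _ c hz

theorem SMat.nTD_mem_qmod (D : SMat m n r) : D.nTD ∈ D.ro.qmod := by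
  rw [SMat.nTD, SMat.TD]
  refine D.ro.smul_mem_qmod (sum_mem fun u _ => sum_mem fun v _ => D.ro.smul_mem_qmod ?_ _) _
  exact D.ro.mul_mem_qmod (D.ro.mul_mem_qmod (D.ro.mul_mem_qmod
    (Submodule.subset_span rfl) _) _) _

theorem SComp.bar_mem_qmod (ν : SComp m n r) {z : Hecke r} (hz : z ∈ ν.qmod) :
    Hecke.bar z ∈ ν.qmod := by
  obtain ⟨h, rfl⟩ := ν.exists_nT_mul hz
  rw [Hecke.bar_mul, ν.bar_nT]
  exact ν.nT_mul_mem _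

/-- The homomorphism `nT h ↦ z h` of signed permutation modules. -/
noncomputable def qmodHom (ν k : SComp m n r) (z : Hecke r) (hz : z ∈ rightEig ν)
    (hk : z ∈ k.qmod) : ν.qmod →ₗ[(Hecke r)ᵐᵒᵖ] k.qmod where
  toFun a := ⟨z * (ν.exists_nT_mul a.2).choose, k.mul_mem_qmod hk _⟩
  map_add' a b := Subtype.ext <| by
    change z * _ = z * _ + z * _
    rw [← mul_add]
    refine mul_eq_mul_of_nT_mul hz ?_
    rw [← (ν.exists_nT_mul (a + b).2).choose_spec, mul_add,
      ← (ν.exists_nT_mul a.2).choose_spec, ← (ν.exists_nT_mul b.2).choose_spec]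
    rfl
  map_smul' c a := Subtype.ext <| by
    change z * _ = z * _ * c.unop
    rw [mul_assoc]
    refine mul_eq_mul_of_nT_mul hz ?_
    rw [← (ν.exists_nT_mul (c • a).2).choose_spec, ← mul_assoc,
      ← (ν.exists_nT_mul a.2).choose_spec]
    rfl

theorem qmodHom_apply {ν k : SComp m n r} {z : Hecke r} (hz : z ∈ rightEig ν) (hk : z ∈ k.qmod)
    (a : ν.qmod) {h : Hecke r} (ha : (a : Hecke r) = ν.nT * h) :
    (qmodHom ν k z hz hk a : Hecke r) = z * h := by
  refine mul_eq_mul_of_nT_mul hz ?_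
  rw [← (ν.exists_nT_mul a.2).choose_spec, ha]

end QSuper

namespace QSuper

open Equiv (Perm)
open Hecke (coeff)

variable {m n r : ℕ}

/-! ### The standard basis of the quantum Schur superalgebra -/

namespace QSchur

/-- The image of a generator under an element of the quantum Schur superalgebra. -/
noncomputable def val (f : QSchur m n r) (ν k : SComp m n r) : Hecke r :=
  (SuperEnd.toEnd f (genMul ν 1) k : k.qmod)

theorem val_add (f g : QSchur m n r) (ν k : SComp m n r) :
    val (f + g) ν k = val f ν k + val g ν k := rfl

theorem val_smul (c : Zv) (f : QSchur m n r) (ν k : SComp m n r) :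
    val (c • f) ν k = c • val f ν k := rfl

/-- The image of a generator, as a linear map. -/
noncomputable def valHom (ν k : SComp m n r) : QSchur m n r →ₗ[Zv] Hecke r where
  toFun f := val f ν k
  map_add' f g := val_add f g ν k
  map_smul' c f := val_smul c f ν k

theorem val_sum_smul {ι : Type*} (s : Finset ι) (c : ι → Zv) (f : ι → QSchur m n r)
    (ν k : SComp m n r) : val (∑ i ∈ s, c i • f i) ν k = ∑ i ∈ s, c i • val (f i) ν k := by
  have := map_sum (valHom ν k) (fun i => c i • f i) s
  simp only [map_smul] at this
  exact this

theorem genMul_eq (ν : SComp m n r) (h : Hecke r) :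
    genMul ν h = MulOpposite.op h • genMul ν 1 := by
  rw [genMul, genMul, ← Pi.single_smul]
  congr 1
  refine Subtype.ext ?_
  change ν.nT * h = ν.nT * 1 * h
  rw [mul_one]

theorem apply_genMul (f : QSchur m n r) (ν k : SComp m n r) (h : Hecke r) :
    ((SuperEnd.toEnd f (genMul ν h) k : k.qmod) : Hecke r) = val f ν k * h := by
  rw [genMul_eq, map_smul]
  rfl

theorem zero_smul_eq (f : QSchur m n r) : (0 : Zv) • f = 0 := zero_smul Zv f

theorem ext_val {f g : QSchur m n r} (h : ∀ ν k, val f ν k = val g ν k) : f = g := by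
  refine SuperEnd.ext_toEnd fun k ν => LinearMap.ext fun x => Subtype.ext ?_
  obtain ⟨a, ha⟩ := ν.exists_nT_mul x.2
  have hx : Pi.single ν x = genMul ν a := by
    rw [genMul]
    congr 1
    exact Subtype.ext ha
  rw [SuperEnd.entry_apply, SuperEnd.entry_apply, hx, apply_genMul, apply_genMul, h]

theorem val_mem_qmod (f : QSchur m n r) (ν k : SComp m n r) : val f ν k ∈ k.qmod :=
  (SuperEnd.toEnd f (genMul ν 1) k : k.qmod).2

theorem val_mem_leftEig (f : QSchur m n r) (ν k : SComp m n r) : val f ν k ∈ leftEig k :=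
  k.mem_leftEig_of_mem_qmod (val_mem_qmod f ν k)

/-- An `ℋ`-linear map transports the relation `nT T_s = e nT` of the generator to its image. -/
theorem val_mem_rightEig (f : QSchur m n r) (ν k : SComp m n r) : val f ν k ∈ rightEig ν := by
  intro i hi'
  have h : genMul ν (Hecke.T (simple i)) =
      genMul ν (eigval (idxParity (ν.rowOf (lo i))) • (1 : Hecke r)) := by
    rw [genMul, genMul]
    congr 1
    refine Subtype.ext ?_
    change ν.nT * _ = ν.nT * _
    rw [ν.nT_mem_rightEig i hi', mul_smul_comm, mul_one]
  rw [← apply_genMul, h, apply_genMul, mul_smul_comm, mul_one]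

end QSchur

open QSchur

/-- The standard basis elements of the quantum Schur superalgebra. -/
noncomputable def stdElem (D : SMat m n r) : QSchur m n r :=
  SuperEnd.toEnd.symm (LinearMap.single _ _ D.ro ∘ₗ
    qmodHom D.co D.ro D.nTD D.nTD_mem_rightEig D.nTD_mem_qmod ∘ₗ LinearMap.proj D.co)

theorem isStandardFamily_stdElem : IsStandardFamily (stdElem : SMat m n r → QSchur m n r) := by
  classical
  intro D ν h k
  change ((Pi.single D.ro (qmodHom D.co D.ro D.nTD D.nTD_mem_rightEig D.nTD_mem_qmod
    (genMul ν h D.co)) : ∀ k : SComp m n r, k.qmod) k : Hecke r) = _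
  by_cases hk : k = D.ro
  · subst hk
    rw [Pi.single_eq_same]
    by_cases hν : ν = D.co
    · subst hν
      rw [if_pos ⟨rfl, rfl⟩]
      refine qmodHom_apply _ _ _ ?_
      rw [genMul, Pi.single_eq_same]
    · rw [if_neg fun h => hν h.1, genMul, Pi.single_eq_of_ne fun h => hν h.symm, map_zero]
      rfl
  · rw [if_neg fun h => hk h.2, Pi.single_eq_of_ne hk]
    rfl

open Classical in
theorem IsStandardFamily.val_eq {φ : SMat m n r → QSchur m n r} (hφ : IsStandardFamily φ)
    (D : SMat m n r) (ν k : SComp m n r) :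
    val (φ D) ν k = if ν = D.co ∧ k = D.ro then D.nTD else 0 := by
  have := hφ D ν 1 k
  rwa [mul_one] at this

theorem IsStandardFamily.eq {φ φ' : SMat m n r → QSchur m n r} (hφ : IsStandardFamily φ)
    (hφ' : IsStandardFamily φ') : φ = φ' := by
  funext D
  exact ext_val fun ν k => by rw [hφ.val_eq, hφ'.val_eq]

open Classical in
theorem IsStandardFamily.val_sum {φ : SMat m n r → QSchur m n r} (hφ : IsStandardFamily φ)
    (c : SMat m n r → Zv) (ν k : SComp m n r) : val (∑ D, c D • φ D) ν k =
      ∑ D : SMat m n r with D.ro = k ∧ D.co = ν, c D • D.nTD := by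
  rw [val_sum_smul, Finset.sum_filter]
  refine Finset.sum_congr rfl fun D _ => ?_
  rw [hφ.val_eq, smul_ite, smul_zero]
  simp only [eq_comm, and_comm]

/-- The values on generators determine `f`, and they are two-sided eigenvectors, so their
coordinates in the `𝒯_D` are those of `f` in the `φ_D`. -/
theorem IsStandardFamily.eq_sum {φ : SMat m n r → QSchur m n r} (hφ : IsStandardFamily φ)
    (f : QSchur m n r) : f = ∑ D, D.coord (val f D.co D.ro) • φ D := by
  classical
  refine ext_val fun ν k => ?_
  rw [hφ.val_sum]
  conv_lhs => rw [eq_sum_nTD (val_mem_leftEig f ν k) (val_mem_rightEig f ν k)]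
  refine Finset.sum_congr rfl fun D hD => ?_
  obtain ⟨-, rfl, rfl⟩ := Finset.mem_filter.1 hD
  rfl

theorem IsStandardFamily.linearIndependent {φ : SMat m n r → QSchur m n r}
    (hφ : IsStandardFamily φ) : LinearIndependent Zv φ := by
  classical
  rw [Fintype.linearIndependent_iff]
  intro c hc D
  have h1 := hφ.val_sum c D.co D.ro
  rw [hc] at h1
  have h2 : ∑ C : SMat m n r with C.ro = D.ro ∧ C.co = D.co, c C • C.nTD =
      ∑ C : SMat m n r with C.ro = D.ro ∧ C.co = D.co, (0 : Zv) • C.nTD := by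
    rw [← h1]
    simp only [zero_smul, Finset.sum_const_zero]
    rfl
  exact nTD_linearIndependent (c' := fun _ => 0) (fun C hC => (Finset.mem_filter.1 hC).2) h2 D
    (Finset.mem_filter.2 ⟨Finset.mem_univ _, rfl, rfl⟩)

/-- The standard basis. -/
noncomputable def IsStandardFamily.basis {φ : SMat m n r → QSchur m n r}
    (hφ : IsStandardFamily φ) : Module.Basis (SMat m n r) Zv (QSchur m n r) :=
  Module.Basis.mk hφ.linearIndependent fun f _ => by
    rw [hφ.eq_sum f]
    exact sum_mem fun D _ => Submodule.smul_mem _ _ (Submodule.subset_span ⟨D, rfl⟩)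

theorem IsStandardFamily.coe_basis {φ : SMat m n r → QSchur m n r}
    (hφ : IsStandardFamily φ) : ⇑hφ.basis = φ := Module.Basis.coe_mk _ _

/-! ### The bar involution of the quantum Schur superalgebra -/

/-- The bar involution on a signed permutation module. -/
noncomputable def SComp.barMod (ν : SComp m n r) : ν.qmod →+ ν.qmod :=
  AddMonoidHom.mk' (fun x => ⟨Hecke.bar (x : Hecke r), ν.bar_mem_qmod x.2⟩)
    fun x y => Subtype.ext (Hecke.bar_add (x : Hecke r) (y : Hecke r))

theorem SComp.barMod_barMod (ν : SComp m n r) (x : ν.qmod) : ν.barMod (ν.barMod x) = x :=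
  Subtype.ext (Hecke.bar_bar _)

variable (m n r) in
/-- The bar involution on the sum of the signed permutation modules. -/
noncomputable def barPi : (∀ k : SComp m n r, k.qmod) →+ (∀ k : SComp m n r, k.qmod) where
  toFun x k := k.barMod (x k)
  map_zero' := funext fun k => k.barMod.map_zero
  map_add' x y := funext fun k => k.barMod.map_add (x k) (y k)

theorem barPi_barPi (x : ∀ k : SComp m n r, k.qmod) : barPi m n r (barPi m n r x) = x :=
  funext fun k => k.barMod_barMod (x k)

theorem barPi_apply (x : ∀ k : SComp m n r, k.qmod) (k : SComp m n r) :
    barPi m n r x k = k.barMod (x k) := rfl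

theorem barPi_single (ν : SComp m n r) (x : ν.qmod) :
    barPi m n r (Pi.single ν x : ∀ k : SComp m n r, k.qmod) =
      (Pi.single ν (ν.barMod x) : ∀ k : SComp m n r, k.qmod) := by
  funext k
  rw [barPi_apply]
  exact Pi.apply_single (fun k : SComp m n r => (k.barMod : k.qmod → k.qmod))
    (fun k => map_zero k.barMod) ν x k

theorem barPi_op_smul (h : Hecke r) (x : ∀ k : SComp m n r, k.qmod) :
    barPi m n r (MulOpposite.op h • x) = MulOpposite.op (Hecke.bar h) • barPi m n r x :=
  funext fun k => Subtype.ext (Hecke.bar_mul (x k : Hecke r) h)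

/-- Conjugation by the bar involution. -/
noncomputable def barConj (f : Module.End (Hecke r)ᵐᵒᵖ (∀ k : SComp m n r, k.qmod)) :
    Module.End (Hecke r)ᵐᵒᵖ (∀ k : SComp m n r, k.qmod) where
  toFun x := barPi m n r (f (barPi m n r x))
  map_add' x y := by rw [map_add, map_add, map_add]
  map_smul' c x := by
    obtain ⟨h, rfl⟩ := MulOpposite.op_surjective c
    -- The two semilinear maps twist the scalar by bar twice, so the conjugate is linear.
    rw [barPi_op_smul, map_smul, barPi_op_smul, Hecke.bar_bar, RingHom.id_apply]

theorem entry_barConj (f : Module.End (Hecke r)ᵐᵒᵖ (∀ k : SComp m n r, k.qmod))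
    (l k : SComp m n r) (x : k.qmod) : SuperEnd.entry l k (barConj f) x =
      l.barMod (SuperEnd.entry l k f (k.barMod x)) := by
  rw [SuperEnd.entry_apply, SuperEnd.entry_apply, ← barPi_single]
  rfl

variable (m n r) in
/-- The bar involution of the quantum Schur superalgebra. -/
noncomputable def barSchur : QSchur m n r →+* QSchur m n r where
  toFun f := SuperEnd.toEnd.symm (barConj (SuperEnd.toEnd f))
  map_one' := LinearMap.ext fun x => barPi_barPi x
  map_zero' := LinearMap.ext fun x => (barPi m n r).map_zero
  map_add' f g := LinearMap.ext fun x => (barPi m n r).map_add _ _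
  -- The signs are integers depending only on the degrees of the summands, and conjugation acts
  -- entry by entry; the two bars at each intermediate module cancel.
  map_mul' f g := SuperEnd.ext_toEnd fun l k => LinearMap.ext fun x => by
    rw [SuperEnd.entry_mul, AddEquiv.apply_symm_apply, entry_barConj, SuperEnd.entry_mul]
    simp only [LinearMap.sum_apply, LinearMap.smul_apply, LinearMap.comp_apply, map_sum,
      map_zsmul, AddEquiv.apply_symm_apply, entry_barConj, SComp.barMod_barMod]

theorem barSchur_barSchur (f : QSchur m n r) : barSchur m n r (barSchur m n r f) = f :=
  LinearMap.ext fun x => by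
    change barPi m n r (barPi m n r (SuperEnd.toEnd f (barPi m n r (barPi m n r x)))) = _
    rw [barPi_barPi, barPi_barPi]
    rfl

theorem barPi_genMul_one (ν : SComp m n r) : barPi m n r (genMul ν 1) = genMul ν 1 := by
  rw [genMul, barPi_single]
  congr 1
  refine Subtype.ext ?_
  change Hecke.bar (ν.nT * 1) = ν.nT * 1
  rw [mul_one, ν.bar_nT]

/-- The generators being fixed by bar, conjugation of a homomorphism is bar on the image of the
generator. -/
theorem val_barSchur (f : QSchur m n r) (ν k : SComp m n r) :
    val (barSchur m n r f) ν k = Hecke.bar (val f ν k) := by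
  change ((barPi m n r (SuperEnd.toEnd f (barPi m n r (genMul ν 1))) k : k.qmod) : Hecke r) = _
  rw [barPi_genMul_one]
  rfl

theorem barSchur_smul (a : Zv) (f : QSchur m n r) :
    barSchur m n r (a • f) = LaurentPolynomial.invert a • barSchur m n r f :=
  ext_val fun ν k => by
    rw [val_barSchur, val_smul, val_smul, val_barSchur, Hecke.bar_smul]

theorem isBarExtension_barSchur {φ : SMat m n r → QSchur m n r} (hφ : IsStandardFamily φ) :
    IsBarExtension φ barMat (barSchur m n r) := by
  classical
  refine ⟨fun a => ?_, fun D => ext_val fun ν k => ?_⟩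
  · rw [Algebra.algebraMap_eq_smul_one, Algebra.algebraMap_eq_smul_one, barSchur_smul, map_one]
  · rw [val_barSchur, hφ.val_sum, hφ.val_eq]
    split_ifs with h
    · obtain ⟨rfl, rfl⟩ := h
      exact bar_nTD D
    · rw [Hecke.bar_zero, Finset.sum_eq_zero]
      intro C hC
      obtain ⟨-, rfl, rfl⟩ := Finset.mem_filter.1 hC
      rw [barMat, if_neg fun h' => h ⟨h'.2, h'.1⟩, zero_smul]

theorem IsBarExtension.eq {φ : SMat m n r → QSchur m n r} (hφ : IsStandardFamily φ)
    {R : SMat m n r → SMat m n r → Zv} {β β' : QSchur m n r →+* QSchur m n r}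
    (h : IsBarExtension φ R β) (h' : IsBarExtension φ R β') : β = β' := by
  refine RingHom.ext fun f => ?_
  rw [hφ.eq_sum f, map_sum, map_sum]
  refine Finset.sum_congr rfl fun D _ => ?_
  rw [Algebra.smul_def, map_mul, map_mul, h.1, h'.1, h.2, h'.2]

/-! ### The canonical basis -/

theorem SMat.le_trans {A B C : SMat m n r} (h1 : A.le B) (h2 : B.le C) : A.le C :=
  ⟨h1.1.trans h2.1, h1.2.1.trans h2.2.1, Relation.ReflTransGen.trans h1.2.2 h2.2.2⟩

/-- Equal lengths would force equal longest elements, hence the same double coset and the same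
matrix. -/
theorem SMat.len_lt_of_lt {A B : SMat m n r} (h : A.lt B) : len A.wPlus < len B.wPlus := by
  by_contra hc
  have := h.1.2.2.eq_of_len_le (not_lt.1 hc)
  exact h.2 (SMat.eq_of_mem_perms h.1.1 h.1.2.1 A.wPlus_mem (this ▸ B.wPlus_mem))

theorem SMat.lt_trans {A B C : SMat m n r} (h1 : A.lt B) (h2 : B.lt C) : A.lt C := by
  refine ⟨SMat.le_trans h1.1 h2.1, ?_⟩
  rintro rfl
  have e1 := SMat.len_lt_of_lt h1
  have e2 := SMat.len_lt_of_lt h2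
  omega

theorem repr_barSchur {φ : SMat m n r → QSchur m n r} (hφ : IsStandardFamily φ)
    (C D : SMat m n r) : hφ.basis.repr (barSchur m n r (hφ.basis D)) C = barMat C D := by
  rw [hφ.coe_basis, (isBarExtension_barSchur hφ).2 D]
  have := congrFun (hφ.basis.repr_sum_self fun C => barMat C D) C
  rwa [hφ.coe_basis] at this

theorem isBarInvolution_barSchur {φ : SMat m n r → QSchur m n r} (hφ : IsStandardFamily φ) :
    IsBarInvolution hφ.basis SMat.lt (fun D => len D.wPlus)
      (barSchur m n r : QSchur m n r →+ QSchur m n r) where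
  semilinear := barSchur_smul
  involutive := barSchur_barSchur
  lt_trans := SMat.lt_trans
  ht_lt := SMat.len_lt_of_lt
  diag D := (repr_barSchur hφ D D).trans (barMat_self D)
  triangular C D hne hlt := (repr_barSchur hφ C D).trans
    (barMat_eq_zero fun hle => hlt ⟨hle, hne⟩)

open Classical in
theorem repr_of_eq_sum {φ : SMat m n r → QSchur m n r} (hφ : IsStandardFamily φ)
    {f : QSchur m n r} {p : SMat m n r → Zv} {D : SMat m n r}
    (h : f = ∑ C with SMat.lt C D, p C • φ C) (C : SMat m n r) :
    hφ.basis.repr f C = if SMat.lt C D then p C else 0 := by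
  have h1 : f = ∑ C, (if SMat.lt C D then p C else 0) • hφ.basis C := by
    rw [h, Finset.sum_filter, hφ.coe_basis]
    refine Finset.sum_congr rfl fun C _ => ?_
    split_ifs
    · rfl
    · rw [QSchur.zero_smul_eq]
  rw [h1]
  exact congrFun (hφ.basis.repr_sum_self _) C

theorem IsCanonicalFamily.eq {φ : SMat m n r → QSchur m n r} (hφ : IsStandardFamily φ)
    {Θ Θ' : SMat m n r → QSchur m n r} (h : IsCanonicalFamily φ (barSchur m n r) Θ)
    (h' : IsCanonicalFamily φ (barSchur m n r) Θ') : Θ = Θ' := by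
  classical
  funext D
  obtain ⟨p, hp, he⟩ := h.2 D
  obtain ⟨p', hp', he'⟩ := h'.2 D
  rw [← sub_eq_zero]
  refine (isBarInvolution_barSchur hφ).eq_zero ?_ fun C => ?_
  · change barSchur m n r (Θ D - Θ' D) = _
    rw [map_sub, h.1, h'.1]
  · rw [← sub_sub_sub_cancel_right (Θ D) (Θ' D) (φ D), map_sub, Finsupp.sub_apply,
      repr_of_eq_sum hφ he, repr_of_eq_sum hφ he']
    split_ifs
    · rw [sub_eq_add_neg]
      exact add_mem_vInvPoly (hp C) (neg_mem_vInvPoly (hp' C))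
    · rw [sub_zero]
      exact zero_mem_vInvPoly

theorem exists_canonical_basis {φ : SMat m n r → QSchur m n r} (hφ : IsStandardFamily φ) :
    ∃ Θ : Module.Basis (SMat m n r) Zv (QSchur m n r),
      IsCanonicalFamily φ (barSchur m n r) Θ := by
  classical
  have H := isBarInvolution_barSchur hφ
  choose θ h1 h2 h3 using H.exists_canonical
  obtain ⟨Θ, rfl⟩ := H.exists_basis (θ := θ) h3
  refine ⟨Θ, h1, fun D => ⟨fun C => hφ.basis.repr (Θ D - hφ.basis D) C, h2 D, ?_⟩⟩
  conv_lhs => rw [← hφ.coe_basis, ← hφ.basis.sum_repr (Θ D - hφ.basis D)]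
  rw [Finset.sum_filter]
  refine Finset.sum_congr rfl fun C _ => ?_
  split_ifs with hlt
  · rw [hφ.coe_basis]
  · rw [h3 D C hlt]
    exact QSchur.zero_smul_eq _

end QSuper

theorem mainTheorem2 (m n r : ℕ) (hmn : ¬ (m = 0 ∧ n = 0)) :
    (∃! φ : QSuper.SMat m n r → QSuper.QSchur m n r, QSuper.IsStandardFamily φ) ∧
    (∃! R : QSuper.SMat m n r → QSuper.SMat m n r → QSuper.Zv, QSuper.IsBarMatrix R) ∧
    ∀ (φ : QSuper.SMat m n r → QSuper.QSchur m n r)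
      (R : QSuper.SMat m n r → QSuper.SMat m n r → QSuper.Zv),
      QSuper.IsStandardFamily φ → QSuper.IsBarMatrix R →
      (∃ b : Module.Basis (QSuper.SMat m n r) QSuper.Zv (QSuper.QSchur m n r), ⇑b = φ) ∧
      (∀ D, R D D = 1) ∧
      ∃ β : QSuper.QSchur m n r →+* QSuper.QSchur m n r,
        QSuper.IsBarExtension φ R β ∧
        (∀ β' : QSuper.QSchur m n r →+* QSuper.QSchur m n r,
          QSuper.IsBarExtension φ R β' → β' = β) ∧
        (∀ a, β (β a) = a) ∧
        ∃ Θ : Module.Basis (QSuper.SMat m n r) QSuper.Zv (QSuper.QSchur m n r),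
          QSuper.IsCanonicalFamily φ β Θ ∧
          ∀ Θ' : QSuper.SMat m n r → QSuper.QSchur m n r,
            QSuper.IsCanonicalFamily φ β Θ' → Θ' = Θ := by
  refine ⟨⟨QSuper.stdElem, QSuper.isStandardFamily_stdElem,
    fun φ hφ => hφ.eq QSuper.isStandardFamily_stdElem⟩,
    ⟨QSuper.barMat, QSuper.isBarMatrix_barMat, fun R hR => hR.eq_barMat⟩, ?_⟩
  intro φ R hφ hR
  obtain rfl := hR.eq_barMat
  have hβ := QSuper.isBarExtension_barSchur hφ
  obtain ⟨Θ, hΘ⟩ := QSuper.exists_canonical_basis hφ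
  exact ⟨⟨hφ.basis, hφ.coe_basis⟩, QSuper.barMat_self, QSuper.barSchur m n r, hβ,
    fun β' hβ' => hβ'.eq hφ hβ, QSuper.barSchur_barSchur, Θ, hΘ,
    fun Θ' hΘ' => hΘ'.eq hφ hΘ⟩
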